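/- Let $\mathbf{k}$ be a field of characteristic $0$, let $\mathfrak g, V$ be $\mathbf k$-vector spaces and $\alpha:\mathfrak g\to\mathfrak g$, $\beta:V\to V$ linear maps. **Definitions.** For spaces with linear maps $(A,a)$, $(B,b)$ let $C^n(A_a,B_b)=\{f\in\mathrm{Hom}(A^{\otimes n},B): b\circ f=f\circ a^{\otimes n}\}$; a subscript on $\mathrm{Hom}$ denotes the same equivariance. Put $H=\mathfrak g\oplus V$, $\gamma=\alpha\oplus\beta$, and let $\mathfrak l=\bigoplus_{n\ge0}C^{n+1}(H_\gamma,H_\gamma)$, with $C^{n+1}$ in degree $n$, carry Balavoine's bracket $[P,Q]_B=P\diamond Q-(-1)^{(m-1)(n-1)}Q\diamond P$ for $P\in C^m$, $Q\in C^n$, where $$(P\diamond Q)(x_1,\dots,x_{m+n-1})=\sum_{i=1}^m\ \sum_{\sigma\in \mathbb S_{(i-1,n-1)}}(-1)^{(i-1)(n-1)}(-1)^\sigma P\big(\gamma^{n-1}x_{\sigma(1)},\dots,\gamma^{n-1}x_{\sigma(i-1)},Q(x_{\sigma(i)},\dots,x_{\sigma(i+n-2)},x_{i+n-1}),\gamma^{n-1}x_{i+n},\dots,\gamma^{n-1}x_{m+n-1}\big)$$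 and $\mathbb S_{(p,q)}$ is the set of $(p,q)$-shuffles. Let $\mathfrak a=\bigoplus_{n\ge0}C^{n+1}(V_\beta,\mathfrak g_\alpha)\subset\mathfrak l$, let $P:\mathfrak l\to\mathfrak l$ be the projection onto $\mathfrak a$ sending $f$ to its component $V^{\otimes (n+1)}\to\mathfrak g$, and let $$\mathfrak q=\bigoplus_{n\ge0}\big(\mathrm{Hom}(\wedge^{n+1}\mathfrak g_\alpha,\mathfrak g_\alpha)\oplus\mathrm{Hom}(\wedge^n\mathfrak g_\alpha\otimes V_\beta,V_\beta)\big)\subset\mathfrak l ,$$ where $(f_1,f_2)$ is the map $((x_i,u_i))_{i=1}^{n+1}\mapsto (f_1(x_1,\dots,x_{n+1}),f_2(x_1,\dots,x_n,u_{n+1}))$. The space $s^{-1}\mathfrak q\oplus\mathfrak a$ is graded by $|s^{-1}q|=|q|-1$ and $|p|$ the degree in $\mathfrak l$. An $L_\infty$-algebra is a $\mathbb Z$-graded vector space $L=\bigoplus_{i\in\mathbb Z} L_i$ with graded symmetric multilinear operations $l_k:L^{\otimes k}\to L$ ($k\ge1$) of degree $1$ such that $\sum_{i+j=n+1}\sum_{\sigma\in\mathbb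 S_{(i,n-i)}}\varepsilon(\sigma)\,l_j(l_i(x_{\sigma(1)},\dots,x_{\sigma(i)}),x_{\sigma(i+1)},\dots,x_{\sigma(n)})=0$ for all $n\ge1$ and homogeneous $x_1,\dots,x_n$, with $\varepsilon(\sigma)$ the Koszul sign. A Maurer–Cartan element is $\theta\in L_0$ for which $\sum_{k\ge1}\frac1{k!}l_k(\theta,\dots,\theta)$ has finitely many nonzero terms and is $0$. A Hom-Lie-Leibniz triple $(\mathfrak g_\alpha^\mu,V_\beta^\rho,T)$ consists of - a Hom-Lie bracket: $\mu$ bilinear and skew-symmetric with $\alpha\mu(x,y)=\mu(\alpha x,\alpha y)$ and $\mu(\alpha x,\mu(y,z))+\mu(\alpha y,\mu(z,x))+\mu(\alpha z,\mu(x,y))=0$; - a representation: $\rho:\mathfrak g\to\mathrm{End}(V)$ linear with $\beta(\rho(x)v)=\rho(\alpha x)\beta(v)$ and $\rho(\alpha x)\rho(y)-\rho(\alpha y)\rho(x)=\rho(\mu(x,y))\beta$; - an embedding tensor: $T:V\to\mathfrak g$ linear with $\alpha T=T\beta$ and $\mu(Tu,Tv)=T(\rho(Tu)v)$. For $\mu\in\mathrm{Hom}(\wedge^2\mathfrak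 g_\alpha,\mathfrak g_\alpha)$ and $\rho\in\mathrm{Hom}(\mathfrak g_\alpha\otimes V_\beta,V_\beta)$ let $(\mu\boxplus\rho)((x,u),(y,v))=(\mu(x,y),\rho(x,v))$. **Theorem.** 1. There are unique graded symmetric multilinear operations $\{l_k\}_{k\ge1}$ on $s^{-1}\mathfrak q\oplus\mathfrak a$ with, for homogeneous $q,q'\in\mathfrak q$ and $p_1,\dots,p_{k-1}\in\mathfrak a$, $$l_2\big((s^{-1}q,0),(s^{-1}q',0)\big)=\big((-1)^{|q|}s^{-1}[q,q']_B,0\big),$$ $$l_k\big((s^{-1}q,0),(0,p_1),\dots,(0,p_{k-1})\big)=\big(0,P[\cdots[[q,p_1]_B,p_2]_B,\dots,p_{k-1}]_B\big)\quad(k\ge2),$$ and which, up to permutation of these inputs, vanish on all other families of inputs each taken from $s^{-1}\mathfrak q$ or from $\mathfrak a$. With them $s^{-1}\mathfrak q\oplus\mathfrak a$ is an $L_\infty$-algebra. For every $\theta$ of degree $0$, the series $\sum_{k\ge1}\frac1{k!}l_k(\theta,\dots,\theta)$ and $l_k^\theta(x_1,\dots,x_k)=\sum_{n\ge0}\frac1{n!}l_{n+k}(\theta,\dots,\theta,x_1,\dots,x_k)$,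 $k\ge1$, have only finitely many nonzero terms. 2. The degree $0$ elements are exactly the $(s^{-1}(\mu\boxplus\rho),T)$ with $\mu\in\mathrm{Hom}(\wedge^2\mathfrak g_\alpha,\mathfrak g_\alpha)$, $\rho\in\mathrm{Hom}(\mathfrak g_\alpha\otimes V_\beta,V_\beta)$, $T\in\mathrm{Hom}(V_\beta,\mathfrak g_\alpha)$, each for a unique $(\mu,\rho,T)$; and $(\mathfrak g_\alpha^\mu,V_\beta^\rho,T)$ is a Hom-Lie-Leibniz triple if and only if $(s^{-1}(\mu\boxplus\rho),T)$ is a Maurer–Cartan element. 3. If $(\mathfrak g_\alpha^\mu,V_\beta^\rho,T)$ is a Hom-Lie-Leibniz triple and $\theta=(s^{-1}(\mu\boxplus\rho),T)$, then $(s^{-1}\mathfrak q\oplus\mathfrak a,\{l_k^\theta\}_{k\ge1})$ is an $L_\infty$-algebra (the controlling $L_\infty$-algebra), whose Maurer–Cartan series has finitely many nonzero terms at every element of degree $0$. For all $\mu'\in\mathrm{Hom}(\wedge^2\mathfrak g_\alpha,\mathfrak g_\alpha)$, $\rho'\in\mathrm{Hom}(\mathfrak g_\alpha\otimes V_\beta,V_\beta)$,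 $T'\in\mathrm{Hom}(V_\beta,\mathfrak g_\alpha)$, the triple $(\mathfrak g_\alpha^{\mu+\mu'},V_\beta^{\rho+\rho'},T+T')$ is a Hom-Lie-Leibniz triple if and only if $(s^{-1}(\mu'\boxplus\rho'),T')$ is a Maurer–Cartan element of the controlling $L_\infty$-algebra. -/

import Mathlib

open scoped DirectSum Nat

noncomputable section

namespace HomLL

/-! ### Signs and shuffles -/

/-- The Koszul sign of `σ` on homogeneous elements of degrees `d 0, …, d (n-1)`: the sign with
`x (σ 0) ⊙ ⋯ ⊙ x (σ (n-1)) = ± x 0 ⊙ ⋯ ⊙ x (n-1)` in the graded symmetric algebra. -/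
def koszulSign {n : ℕ} (σ : Equiv.Perm (Fin n)) (d : Fin n → ℤ) : ℤˣ :=
  ∏ i : Fin n, ∏ j : Fin n,
    if i < j ∧ σ j < σ i then Int.negOnePow (d (σ i) * d (σ j)) else 1

/-- `σ` is a `(p, q)`-shuffle of the first `p + q` of `N` letters (and fixes the other letters):
it is increasing on the positions `[0, p)` and on the positions `[p, p + q)`. -/
def IsShuffle {N : ℕ} (p q : ℕ) (σ : Equiv.Perm (Fin N)) : Prop :=
  (∀ a b : Fin N, a < b → b.1 < p → σ a < σ b) ∧
  (∀ a b : Fin N, a < b → p ≤ a.1 → b.1 < p + q → σ a < σ b) ∧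
  (∀ a : Fin N, p + q ≤ a.1 → σ a = a)

open Classical in
/-- The finite set of `(p, q)`-shuffles of the first `p + q` of `N` letters. -/
def shuffles (N p q : ℕ) : Finset (Equiv.Perm (Fin N)) :=
  Finset.univ.filter (IsShuffle p q)

/-! ### `L_∞`-algebras, in the convention of graded symmetric operations of degree `1` -/

section LInfinity

variable {𝕜 : Type*} [Field 𝕜] {L : Type*} [AddCommGroup L] [Module 𝕜 L]

/-- Operations `l k : L^k → L` (only `k ≥ 1` matters) are multilinear. -/
def IsMultilinearFamily (𝕜 : Type*) [Field 𝕜] {L : Type*} [AddCommGroup L] [Module 𝕜 L]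
    (l : (k : ℕ) → (Fin k → L) → L) : Prop :=
  ∀ k, 1 ≤ k → ∃ M : MultilinearMap 𝕜 (fun _ : Fin k => L) L, ∀ x, M x = l k x

/-- Graded symmetry of operations on the graded vector space `L = ⨁ i, 𝒜 i`. -/
def IsGradedSymmetric (𝒜 : ℤ → Submodule 𝕜 L) (l : (k : ℕ) → (Fin k → L) → L) : Prop :=
  ∀ k, 1 ≤ k → ∀ (σ : Equiv.Perm (Fin k)) (d : Fin k → ℤ) (x : Fin k → L),
    (∀ i, x i ∈ 𝒜 (d i)) → l k (fun i => x (σ i)) = koszulSign σ d • l k x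

/-- `(L = ⨁ i, 𝒜 i, {l k}_{k ≥ 1})` is an `L_∞`-algebra. In the `n`-th higher Jacobi identity
`n = m + 1`, the inner operation has `i + 1` inputs and the outer one has `(m - i) + 1` inputs. -/
structure IsLInfinity (𝒜 : ℤ → Submodule 𝕜 L) (l : (k : ℕ) → (Fin k → L) → L) : Prop where
  internal : DirectSum.IsInternal 𝒜
  multilinear : IsMultilinearFamily 𝕜 l
  degree_one : ∀ k, 1 ≤ k → ∀ (d : Fin k → ℤ) (x : Fin k → L),
    (∀ i, x i ∈ 𝒜 (d i)) → l k x ∈ 𝒜 ((∑ i, d i) + 1)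
  symmetric : IsGradedSymmetric 𝒜 l
  jacobi : ∀ (m : ℕ) (d : Fin (m + 1) → ℤ) (x : Fin (m + 1) → L),
    (∀ i, x i ∈ 𝒜 (d i)) →
    ∑ i : Fin (m + 1), ∑ σ ∈ shuffles (m + 1) (i.1 + 1) (m - i.1),
      koszulSign σ d •
        l ((m - i.1) + 1)
          (Fin.cons (l (i.1 + 1) (fun a => x (σ ⟨a.1, by omega⟩)))
            (fun b : Fin (m - i.1) => x (σ ⟨i.1 + 1 + b.1, by omega⟩))) = 0

/-- The Maurer–Cartan series `∑_{k ≥ 1} (1/k!) l_k(θ, …, θ)` has finitely many nonzero terms. -/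
def MCSeriesFinite (l : (k : ℕ) → (Fin k → L) → L) (θ : L) : Prop :=
  {k : ℕ | 1 ≤ k ∧ l k (fun _ => θ) ≠ 0}.Finite

/-- `θ ∈ L_0` is a Maurer–Cartan element: the series `∑_{k ≥ 1} (1/k!) l_k(θ, …, θ)` converges
(has finitely many nonzero terms) and its sum is `0`. -/
structure IsMaurerCartan (𝒜 : ℤ → Submodule 𝕜 L) (l : (k : ℕ) → (Fin k → L) → L) (θ : L) :
    Prop where
  degree_zero : θ ∈ 𝒜 0
  finite : MCSeriesFinite l θ
  sum_eq_zero : ∑ᶠ k : ℕ, (((k + 1)! : ℕ) : 𝕜)⁻¹ • l (k + 1) (fun _ => θ) = 0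

/-- The series defining the twisted operation `l_k^θ (x_1, …, x_k)` has finitely many nonzero
terms. -/
def TwistSeriesFinite (l : (k : ℕ) → (Fin k → L) → L) (θ : L) : Prop :=
  ∀ k, 1 ≤ k → ∀ x : Fin k → L,
    {n : ℕ | l (n + k) (Fin.append (fun _ : Fin n => θ) x) ≠ 0}.Finite

/-- The operations twisted by `θ`:
`l_k^θ (x_1, …, x_k) = ∑_{n ≥ 0} (1/n!) l_{n+k}(θ, …, θ, x_1, …, x_k)`. -/
def twist (𝕜 : Type*) [Field 𝕜] {L : Type*} [AddCommGroup L] [Module 𝕜 L]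
    (l : (k : ℕ) → (Fin k → L) → L) (θ : L) (k : ℕ) (x : Fin k → L) : L :=
  ∑ᶠ n : ℕ, ((n ! : ℕ) : 𝕜)⁻¹ • l (n + k) (Fin.append (fun _ : Fin n => θ) x)

end LInfinity

/-! ### Equivariant multilinear maps and Balavoine's bracket -/

section Balavoine

variable {𝕜 : Type*} [Field 𝕜]
variable {A : Type*} [AddCommGroup A] [Module 𝕜 A] {B : Type*} [AddCommGroup B] [Module 𝕜 B]
variable {H : Type*} [AddCommGroup H] [Module 𝕜 H]

/-- `C^n(A_a, B_b) = Hom(A_a^{⊗ n}, B_b)`: multilinear maps `f` with `b ∘ f = f ∘ a^{⊗ n}`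
(used for `n ≥ 1`). -/
def Cochain (a : A →ₗ[𝕜] A) (b : B →ₗ[𝕜] B) (n : ℕ) :
    Submodule 𝕜 (MultilinearMap 𝕜 (fun _ : Fin n => A) B) where
  carrier := {f | ∀ x, b (f x) = f (fun i => a (x i))}
  add_mem' := by intro f g hf hg x; simp [hf x, hg x]
  zero_mem' := by intro x; simp
  smul_mem' := by intro c f hf x; simp [hf x]

/-- The inputs of `P` in the partial composition at slot `i`:
`γ^n x_0, …, γ^n x_{i-1}, Q(x_i, …, x_{i+n}), γ^n x_{i+n+1}, …, γ^n x_{m+n}`. -/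
def insArgs (γ : H →ₗ[𝕜] H) {m n : ℕ} (Q : MultilinearMap 𝕜 (fun _ : Fin (n + 1) => H) H)
    (i : Fin (m + 1)) (x : Fin (m + n + 1) → H) (t : Fin (m + 1)) : H :=
  if t < i then (γ ^ n) (x ⟨t.1, by omega⟩)
  else if t = i then Q (fun s => x ⟨i.1 + s.1, by omega⟩)
  else (γ ^ n) (x ⟨t.1 + n, by omega⟩)


/-- The block of inputs (slot of `P`) to which the position `j` belongs. -/
def insSlot {m n : ℕ} (i : Fin (m + 1)) (j : Fin (m + n + 1)) : Fin (m + 1) :=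
  if h : j.1 < i.1 then ⟨j.1, by omega⟩
  else if h' : j.1 ≤ i.1 + n then i
  else ⟨j.1 - n, by omega⟩

theorem insArgs_update_of_ne (γ : H →ₗ[𝕜] H) {m n : ℕ}
    (Q : MultilinearMap 𝕜 (fun _ : Fin (n + 1) => H) H) (i : Fin (m + 1))
    (x : Fin (m + n + 1) → H) (j : Fin (m + n + 1)) (v : H) (t : Fin (m + 1))
    (ht : t ≠ insSlot i j) :
    insArgs γ Q i (Function.update x j v) t = insArgs γ Q i x t := by
  have ht' : t.1 ≠ (insSlot i j).1 := fun h => ht (Fin.ext h)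
  unfold insSlot at ht'
  unfold insArgs
  split_ifs with h1 h2
  · rw [Function.update_of_ne]
    intro h
    have hv : t.1 = j.1 := congrArg Fin.val h
    rw [Fin.lt_def] at h1
    split_ifs at ht' <;> (try simp only at ht') <;> omega
  · congr 1
    funext s
    rw [Function.update_of_ne]
    intro h
    have hv : i.1 + s.1 = j.1 := congrArg Fin.val h
    have := s.2
    have h2' := congrArg Fin.val h2
    split_ifs at ht' <;> (try simp only at ht') <;> omega
  · rw [Function.update_of_ne]
    intro h
    have hv : t.1 + n = j.1 := congrArg Fin.val h
    rw [Fin.lt_def] at h1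
    rw [Fin.ext_iff] at h2
    split_ifs at ht' <;> (try simp only at ht') <;> omega

theorem insArgs_update_slot (γ : H →ₗ[𝕜] H) {m n : ℕ}
    (Q : MultilinearMap 𝕜 (fun _ : Fin (n + 1) => H) H) (i : Fin (m + 1))
    (x : Fin (m + n + 1) → H) (j : Fin (m + n + 1)) :
    ∃ f : H →ₗ[𝕜] H, ∀ v,
      insArgs γ Q i (Function.update x j v) (insSlot i j) = f v := by
  by_cases h : j.1 < i.1
  · refine ⟨γ ^ n, fun v => ?_⟩
    have e : insSlot i j = ⟨j.1, by omega⟩ := by simp [insSlot, h]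
    rw [e]
    simp [insArgs, Fin.lt_def, h]
  by_cases h' : j.1 ≤ i.1 + n
  · refine ⟨Q.toLinearMap (fun s => x ⟨i.1 + s.1, by omega⟩) ⟨j.1 - i.1, by omega⟩, fun v => ?_⟩
    have e : insSlot i j = i := by simp [insSlot, h, h']
    rw [e]
    simp only [insArgs, lt_irrefl, if_false, if_true, MultilinearMap.toLinearMap_apply]
    congr 1
    funext s
    by_cases hs : s = ⟨j.1 - i.1, by omega⟩
    · subst hs
      have : (⟨i.1 + (j.1 - i.1), by omega⟩ : Fin (m + n + 1)) = j := Fin.ext (by simp; omega)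
      simp [this]
    · rw [Function.update_of_ne hs, Function.update_of_ne]
      intro hh
      apply hs
      have := congrArg Fin.val hh
      simp only at this
      exact Fin.ext (by simp only; omega)
  · refine ⟨γ ^ n, fun v => ?_⟩
    have e : insSlot i j = ⟨j.1 - n, by omega⟩ := by simp [insSlot, h, h']
    rw [e]
    have h1 : ¬ ((⟨j.1 - n, by omega⟩ : Fin (m + 1)) < i) := by rw [Fin.lt_def]; simp only; omega
    have h2 : (⟨j.1 - n, by omega⟩ : Fin (m + 1)) ≠ i := by
      rw [Ne, Fin.ext_iff]; simp only; omega
    have : (⟨j.1 - n + n, by omega⟩ : Fin (m + n + 1)) = j := Fin.ext (by simp only; omega)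
    simp [insArgs, h1, h2, this]

theorem insArgs_update (γ : H →ₗ[𝕜] H) {m n : ℕ}
    (Q : MultilinearMap 𝕜 (fun _ : Fin (n + 1) => H) H) (i : Fin (m + 1))
    (x : Fin (m + n + 1) → H) (j : Fin (m + n + 1)) :
    ∃ f : H →ₗ[𝕜] H, ∀ v, insArgs γ Q i (Function.update x j v) =
      Function.update (insArgs γ Q i x) (insSlot i j) (f v) := by
  obtain ⟨f, hf⟩ := insArgs_update_slot γ Q i x j
  refine ⟨f, fun v => ?_⟩
  funext t
  by_cases ht : t = insSlot i j
  · subst ht; rw [hf, Function.update_self]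
  · rw [insArgs_update_of_ne γ Q i x j v t ht, Function.update_of_ne ht]

/-- The partial composition `P(γ^n x_0, …, γ^n x_{i-1}, Q(x_i, …, x_{i+n}), γ^n x_{i+n+1}, …)`. -/
def insertAt (γ : H →ₗ[𝕜] H) {m n : ℕ} (P : MultilinearMap 𝕜 (fun _ : Fin (m + 1) => H) H)
    (Q : MultilinearMap 𝕜 (fun _ : Fin (n + 1) => H) H) (i : Fin (m + 1)) :
    MultilinearMap 𝕜 (fun _ : Fin (m + n + 1) => H) H :=
  MultilinearMap.mk' (fun x => P (insArgs γ Q i x))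
    (by
      intro x j u v
      obtain ⟨f, hf⟩ := insArgs_update γ Q i x j
      simp only [hf, map_add, MultilinearMap.map_update_add])
    (by
      intro x j c v
      obtain ⟨f, hf⟩ := insArgs_update γ Q i x j
      simp only [hf, map_smul, MultilinearMap.map_update_smul])

theorem insertAt_apply (γ : H →ₗ[𝕜] H) {m n : ℕ}
    (P : MultilinearMap 𝕜 (fun _ : Fin (m + 1) => H) H)
    (Q : MultilinearMap 𝕜 (fun _ : Fin (n + 1) => H) H) (i : Fin (m + 1))
    (x : Fin (m + n + 1) → H) : insertAt γ P Q i x = P (insArgs γ Q i x) := rfl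

/-- `P ⋄ Q` for `P` of arity `m + 1` and `Q` of arity `n + 1`:
`∑_i ∑_{σ ∈ Sh(i, n)} (-1)^{i n} (-1)^σ P(γ^n x_{σ 0}, …, γ^n x_{σ (i-1)},
Q(x_{σ i}, …, x_{σ (i+n-1)}, x_{i+n}), γ^n x_{i+n+1}, …, γ^n x_{m+n})`,
where `i = 0, …, m` and the shuffles permute the first `i + n` of the `m + n + 1` inputs. -/
def diamond (γ : H →ₗ[𝕜] H) {m n : ℕ} (P : MultilinearMap 𝕜 (fun _ : Fin (m + 1) => H) H)
    (Q : MultilinearMap 𝕜 (fun _ : Fin (n + 1) => H) H) :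
    MultilinearMap 𝕜 (fun _ : Fin (m + n + 1) => H) H :=
  ∑ i : Fin (m + 1), ∑ σ ∈ shuffles (m + n + 1) i.1 n,
    ((-1 : 𝕜) ^ (i.1 * n) * ((Equiv.Perm.sign σ : ℤ) : 𝕜)) •
      (insertAt γ P Q i).domDomCongr σ

theorem diamond_apply (γ : H →ₗ[𝕜] H) {m n : ℕ}
    (P : MultilinearMap 𝕜 (fun _ : Fin (m + 1) => H) H)
    (Q : MultilinearMap 𝕜 (fun _ : Fin (n + 1) => H) H) (x : Fin (m + n + 1) → H) :
    diamond γ P Q x = ∑ i : Fin (m + 1), ∑ σ ∈ shuffles (m + n + 1) i.1 n,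
      ((-1 : 𝕜) ^ (i.1 * n) * ((Equiv.Perm.sign σ : ℤ) : 𝕜)) •
        P (insArgs γ Q i (fun t => x (σ t))) := by
  simp [diamond, insertAt_apply]

theorem insArgs_add (γ : H →ₗ[𝕜] H) {m n : ℕ}
    (Q Q' : MultilinearMap 𝕜 (fun _ : Fin (n + 1) => H) H) (i : Fin (m + 1))
    (x : Fin (m + n + 1) → H) :
    insArgs γ (Q + Q') i x = Function.update (insArgs γ Q i x) i
      (insArgs γ Q i x i + insArgs γ Q' i x i) ∧
    insArgs γ Q' i x = Function.update (insArgs γ Q i x) i (insArgs γ Q' i x i) := by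
  constructor <;> funext t <;> by_cases h : t = i
  · subst h; simp [insArgs]
  · simp [insArgs, h]
  · subst h; simp [insArgs]
  · simp [insArgs, h]

theorem insArgs_smul (γ : H →ₗ[𝕜] H) {m n : ℕ} (c : 𝕜)
    (Q : MultilinearMap 𝕜 (fun _ : Fin (n + 1) => H) H) (i : Fin (m + 1))
    (x : Fin (m + n + 1) → H) :
    insArgs γ (c • Q) i x = Function.update (insArgs γ Q i x) i (c • insArgs γ Q i x i) := by
  funext t
  by_cases h : t = i
  · subst h; simp [insArgs]
  · simp [insArgs, h]

theorem insertAt_add_right (γ : H →ₗ[𝕜] H) {m n : ℕ}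
    (P : MultilinearMap 𝕜 (fun _ : Fin (m + 1) => H) H)
    (Q Q' : MultilinearMap 𝕜 (fun _ : Fin (n + 1) => H) H) (i : Fin (m + 1))
    (x : Fin (m + n + 1) → H) :
    P (insArgs γ (Q + Q') i x) = P (insArgs γ Q i x) + P (insArgs γ Q' i x) := by
  have h := (insArgs_add γ Q Q' i x).2
  rw [(insArgs_add γ Q Q' i x).1, MultilinearMap.map_update_add, Function.update_eq_self, ← h]

theorem insertAt_smul_right (γ : H →ₗ[𝕜] H) {m n : ℕ}
    (P : MultilinearMap 𝕜 (fun _ : Fin (m + 1) => H) H) (c : 𝕜)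
    (Q : MultilinearMap 𝕜 (fun _ : Fin (n + 1) => H) H) (i : Fin (m + 1))
    (x : Fin (m + n + 1) → H) :
    P (insArgs γ (c • Q) i x) = c • P (insArgs γ Q i x) := by
  rw [insArgs_smul, MultilinearMap.map_update_smul, Function.update_eq_self]

theorem map_pow_cochain {γ : H →ₗ[𝕜] H} {n : ℕ}
    {Q : MultilinearMap 𝕜 (fun _ : Fin (n + 1) => H) H} (hQ : Q ∈ Cochain γ γ (n + 1))
    {m : ℕ} (i : Fin (m + 1)) (x : Fin (m + n + 1) → H) (t : Fin (m + 1)) :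
    γ (insArgs γ Q i x t) = insArgs γ Q i (fun j => γ (x j)) t := by
  have hc : ∀ v, γ ((γ ^ n) v) = (γ ^ n) (γ v) := fun v => by
    rw [← Module.End.mul_apply, ← Module.End.mul_apply, ← pow_succ, ← pow_succ']
  unfold insArgs
  split_ifs
  · exact hc _
  · exact hQ _
  · exact hc _

theorem diamond_mem {γ : H →ₗ[𝕜] H} {m n : ℕ}
    {P : MultilinearMap 𝕜 (fun _ : Fin (m + 1) => H) H} (hP : P ∈ Cochain γ γ (m + 1))
    {Q : MultilinearMap 𝕜 (fun _ : Fin (n + 1) => H) H} (hQ : Q ∈ Cochain γ γ (n + 1)) :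
    diamond γ P Q ∈ Cochain γ γ (m + n + 1) := by
  intro x
  rw [diamond_apply, diamond_apply, map_sum]
  refine Finset.sum_congr rfl fun i _ => ?_
  rw [map_sum]
  refine Finset.sum_congr rfl fun σ _ => ?_
  rw [map_smul, hP]
  congr 2
  funext t
  exact map_pow_cochain hQ i _ t

/-- `C^{n+1}(H_γ, H_γ)` as a vector space. -/
def CochainSpace (γ : H →ₗ[𝕜] H) (n : ℕ) : Type _ := Cochain γ γ (n + 1)

instance (γ : H →ₗ[𝕜] H) (n : ℕ) : AddCommGroup (CochainSpace γ n) :=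
  inferInstanceAs (AddCommGroup (Cochain γ γ (n + 1)))

instance (γ : H →ₗ[𝕜] H) (n : ℕ) : Module 𝕜 (CochainSpace γ n) :=
  inferInstanceAs (Module 𝕜 (Cochain γ γ (n + 1)))

/-- The multilinear map underlying an element of `C^{n+1}(H_γ, H_γ)`. -/
def CochainSpace.toMap {γ : H →ₗ[𝕜] H} {n : ℕ} :
    CochainSpace γ n →ₗ[𝕜] MultilinearMap 𝕜 (fun _ : Fin (n + 1) => H) H :=
  (Cochain γ γ (n + 1)).subtype

theorem CochainSpace.toMap_mem {γ : H →ₗ[𝕜] H} {n : ℕ} (f : CochainSpace γ n) :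
    f.toMap ∈ Cochain γ γ (n + 1) := Subtype.property (p := (· ∈ Cochain γ γ (n + 1))) f

/-- The element of `C^{n+1}(H_γ, H_γ)` given by an equivariant multilinear map. -/
def CochainSpace.mk {γ : H →ₗ[𝕜] H} {n : ℕ}
    (f : MultilinearMap 𝕜 (fun _ : Fin (n + 1) => H) H) (hf : f ∈ Cochain γ γ (n + 1)) :
    CochainSpace γ n := (⟨f, hf⟩ : Cochain γ γ (n + 1))

@[simp] theorem CochainSpace.toMap_mk {γ : H →ₗ[𝕜] H} {n : ℕ}
    (f : MultilinearMap 𝕜 (fun _ : Fin (n + 1) => H) H) (hf : f ∈ Cochain γ γ (n + 1)) :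
    (CochainSpace.mk f hf).toMap = f := rfl

theorem CochainSpace.ext {γ : H →ₗ[𝕜] H} {n : ℕ} {f f' : CochainSpace γ n}
    (h : ∀ x, f.toMap x = f'.toMap x) : f = f' :=
  Subtype.ext (MultilinearMap.ext h)

/-- `⋄` as a bilinear map `C^{m+1} × C^{n+1} → C^{m+n+1}` on equivariant maps. -/
def diamondHom (γ : H →ₗ[𝕜] H) (m n : ℕ) :
    CochainSpace γ m →ₗ[𝕜] CochainSpace γ n →ₗ[𝕜] CochainSpace γ (m + n) :=
  LinearMap.mk₂ 𝕜
    (fun P Q => CochainSpace.mk (diamond γ P.toMap Q.toMap) (diamond_mem P.toMap_mem Q.toMap_mem))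
    (by
      intro P P' Q
      apply CochainSpace.ext
      intro x
      simp [diamond_apply, Finset.sum_add_distrib])
    (by
      intro c P Q
      apply CochainSpace.ext
      intro x
      simp [diamond_apply, Finset.smul_sum, smul_comm c])
    (by
      intro P Q Q'
      apply CochainSpace.ext
      intro x
      simp [diamond_apply, insertAt_add_right, Finset.sum_add_distrib])
    (by
      intro c P Q
      apply CochainSpace.ext
      intro x
      simp [diamond_apply, insertAt_smul_right, Finset.smul_sum, smul_comm c])

/-- The graded vector space `⨁_{n ≥ 0} C^{n+1}(H_γ, H_γ)`; the summand `C^{n+1}` has degree `n`. -/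
abbrev BalavoineSpace (γ : H →ₗ[𝕜] H) : Type _ := ⨁ n : ℕ, CochainSpace γ n

/-- The bracket `[P, Q]_B = P ⋄ Q - (-1)^{mn} Q ⋄ P` for `P` of degree `m` and `Q` of degree `n`. -/
def homogeneousBracket (γ : H →ₗ[𝕜] H) (m n : ℕ) :
    CochainSpace γ m →ₗ[𝕜] CochainSpace γ n →ₗ[𝕜] BalavoineSpace γ :=
  (diamondHom γ m n).compr₂ (DirectSum.lof 𝕜 ℕ (fun k => CochainSpace γ k) (m + n)) -
    ((-1 : 𝕜) ^ (m * n)) •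
      ((diamondHom γ n m).compr₂
        (DirectSum.lof 𝕜 ℕ (fun k => CochainSpace γ k) (n + m))).flip

/-- Balavoine's bracket, extended bilinearly to the direct sum. -/
def balavoineBracket (γ : H →ₗ[𝕜] H) :
    BalavoineSpace γ →ₗ[𝕜] BalavoineSpace γ →ₗ[𝕜] BalavoineSpace γ :=
  DirectSum.toModule 𝕜 ℕ _ fun m =>
    (DirectSum.toModule 𝕜 ℕ _ fun n => (homogeneousBracket γ m n).flip).flip

/-- The elements of the direct sum that are homogeneous of degree `i ∈ ℤ`. -/
def homogeneousPart (γ : H →ₗ[𝕜] H) (i : ℤ) : Submodule 𝕜 (BalavoineSpace γ) where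
  carrier := {x | ∀ n : ℕ, (n : ℤ) ≠ i → x n = 0}
  add_mem' := by intro x y hx hy n hn; simp [hx n hn, hy n hn]
  zero_mem' := by intro n _; simp
  smul_mem' := by intro c x hx n hn; simp [DirectSum.smul_apply, hx n hn]

/-- The iterated bracket `[⋯[[x, p_0], p_1], ⋯, p_{k-1}]`. -/
def nestedBracket (γ : H →ₗ[𝕜] H) (x : BalavoineSpace γ) {k : ℕ}
    (p : Fin k → BalavoineSpace γ) : BalavoineSpace γ :=
  (List.ofFn p).foldl (fun y a => balavoineBracket γ y a) x

end Balavoine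

/-! ### Hom-Lie-Leibniz triples -/

section Triples

variable {𝕜 : Type*} [Field 𝕜]
variable {g : Type*} [AddCommGroup g] [Module 𝕜 g] {V : Type*} [AddCommGroup V] [Module 𝕜 V]

/-- `(g, μ, α)` is a (multiplicative) Hom-Lie algebra. -/
structure IsHomLie (α : g →ₗ[𝕜] g) (μ : g →ₗ[𝕜] g →ₗ[𝕜] g) : Prop where
  skew : ∀ x y, μ x y = -μ y x
  multiplicative : ∀ x y, α (μ x y) = μ (α x) (α y)
  hom_jacobi : ∀ x y z, μ (α x) (μ y z) + μ (α y) (μ z x) + μ (α z) (μ x y) = 0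

/-- `(V, ρ, β)` is a representation of the Hom-Lie algebra `(g, μ, α)`. -/
structure IsHomLieRep (α : g →ₗ[𝕜] g) (β : V →ₗ[𝕜] V) (μ : g →ₗ[𝕜] g →ₗ[𝕜] g)
    (ρ : g →ₗ[𝕜] V →ₗ[𝕜] V) : Prop where
  equivariant : ∀ x v, β (ρ x v) = ρ (α x) (β v)
  bracket : ∀ x y v, ρ (α x) (ρ y v) - ρ (α y) (ρ x v) = ρ (μ x y) (β v)

/-- `T : V → g` is an embedding tensor. -/
structure IsEmbeddingTensor (α : g →ₗ[𝕜] g) (β : V →ₗ[𝕜] V) (μ : g →ₗ[𝕜] g →ₗ[𝕜] g)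
    (ρ : g →ₗ[𝕜] V →ₗ[𝕜] V) (T : V →ₗ[𝕜] g) : Prop where
  equivariant : ∀ v, α (T v) = T (β v)
  embedding : ∀ u v, μ (T u) (T v) = T (ρ (T u) v)

/-- `((g, μ, α), (V, ρ, β), T)` is a Hom-Lie-Leibniz triple. -/
structure IsHomLieLeibnizTriple (α : g →ₗ[𝕜] g) (β : V →ₗ[𝕜] V) (μ : g →ₗ[𝕜] g →ₗ[𝕜] g)
    (ρ : g →ₗ[𝕜] V →ₗ[𝕜] V) (T : V →ₗ[𝕜] g) : Prop where
  homLie : IsHomLie α μ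
  rep : IsHomLieRep α β μ ρ
  embeddingTensor : IsEmbeddingTensor α β μ ρ T

/-- `Hom(∧² g_α, g_α)`: alternating bilinear maps `μ` with `α ∘ μ = μ ∘ (α ∧ α)`. -/
def WedgeTwoHom (α : g →ₗ[𝕜] g) : Submodule 𝕜 (g →ₗ[𝕜] g →ₗ[𝕜] g) where
  carrier := {μ | (∀ x, μ x x = 0) ∧ ∀ x y, α (μ x y) = μ (α x) (α y)}
  add_mem' := by
    rintro a b ⟨ha, ha'⟩ ⟨hb, hb'⟩
    exact ⟨fun x => by simp [ha, hb], fun x y => by simp [ha', hb']⟩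
  zero_mem' := ⟨fun x => by simp, fun x y => by simp⟩
  smul_mem' := by
    rintro c a ⟨ha, ha'⟩
    exact ⟨fun x => by simp [ha], fun x y => by simp [ha']⟩

/-- `Hom(g_α ⊗ V_β, V_β)`: maps `ρ` with `β (ρ x v) = ρ (α x) (β v)`. -/
def ActionHom (α : g →ₗ[𝕜] g) (β : V →ₗ[𝕜] V) : Submodule 𝕜 (g →ₗ[𝕜] V →ₗ[𝕜] V) where
  carrier := {ρ | ∀ x v, β (ρ x v) = ρ (α x) (β v)}
  add_mem' := by intro a b ha hb x v; simp [ha x v, hb x v]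
  zero_mem' := by intro x v; simp
  smul_mem' := by intro c a ha x v; simp [ha x v]

/-- `Hom(V_β, g_α)`: linear maps `T` with `α ∘ T = T ∘ β`. -/
def TwistHom (α : g →ₗ[𝕜] g) (β : V →ₗ[𝕜] V) : Submodule 𝕜 (V →ₗ[𝕜] g) where
  carrier := {T | ∀ v, α (T v) = T (β v)}
  add_mem' := by intro a b ha hb v; simp [ha v, hb v]
  zero_mem' := by intro v; simp
  smul_mem' := by intro c a ha v; simp [ha v]

/-! ### The graded subspaces `q` and `a`, and the graded space `s⁻¹q ⊕ a` -/

/-- The degree `n` part of `q`, namely `Hom(∧^{n+1} g_α, g_α) ⊕ Hom(∧^n g_α ⊗ V_β, V_β)`, where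
`(f₁, f₂)` is viewed as the map
`((x_0, v_0), …, (x_n, v_n)) ↦ (f₁(x_0, …, x_n), f₂(x_0, …, x_{n-1}; v_n))` on `g ⊕ V`. -/
def qPart (α : g →ₗ[𝕜] g) (β : V →ₗ[𝕜] V) (n : ℕ) :
    Submodule 𝕜 (CochainSpace (α.prodMap β) n) where
  carrier := {f | ∃ (f₁ : g [⋀^Fin (n + 1)]→ₗ[𝕜] g) (f₂ : g [⋀^Fin n]→ₗ[𝕜] (V →ₗ[𝕜] V)),
    (∀ x, α (f₁ x) = f₁ (fun i => α (x i))) ∧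
    (∀ x v, β (f₂ x v) = f₂ (fun i => α (x i)) (β v)) ∧
    ∀ w : Fin (n + 1) → g × V,
      f.toMap w = (f₁ (fun i => (w i).1), f₂ (fun i => (w i.castSucc).1) (w (Fin.last n)).2)}
  add_mem' := by
    rintro f f' ⟨f₁, f₂, h₁, h₂, h⟩ ⟨f₁', f₂', h₁', h₂', h'⟩
    exact ⟨f₁ + f₁', f₂ + f₂', fun x => by simp [h₁, h₁'], fun x v => by simp [h₂, h₂'],
      fun w => by simp [h, h']⟩
  zero_mem' := ⟨0, 0, fun x => by simp, fun x v => by simp, fun w => by simp; rfl⟩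
  smul_mem' := by
    rintro c f ⟨f₁, f₂, h₁, h₂, h⟩
    exact ⟨c • f₁, c • f₂, fun x => by simp [h₁], fun x v => by simp [h₂],
      fun w => by simp [h]⟩

/-- The degree `n` part `C^{n+1}(V_β, g_α)` of `a`, where `f` is viewed as the map
`((x_0, v_0), …, (x_n, v_n)) ↦ (f(v_0, …, v_n), 0)` on `g ⊕ V`. -/
def aPart (α : g →ₗ[𝕜] g) (β : V →ₗ[𝕜] V) (n : ℕ) :
    Submodule 𝕜 (CochainSpace (α.prodMap β) n) where
  carrier := {f | ∃ T ∈ Cochain β α (n + 1), ∀ w : Fin (n + 1) → g × V,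
    f.toMap w = (T (fun i => (w i).2), 0)}
  add_mem' := by
    rintro f f' ⟨T, hT, h⟩ ⟨T', hT', h'⟩
    exact ⟨T + T', add_mem hT hT', fun w => by simp [h, h']⟩
  zero_mem' := ⟨0, zero_mem _, fun w => by simp; rfl⟩
  smul_mem' := by
    rintro c f ⟨T, hT, h⟩
    exact ⟨c • T, Submodule.smul_mem _ c hT, fun w => by simp [h]⟩

/-- The graded space `𝔩 = ⨁_{n ≥ 0} C^{n+1}((g ⊕ V)_{α ⊕ β}, (g ⊕ V)_{α ⊕ β})`. -/
abbrev LSpace (α : g →ₗ[𝕜] g) (β : V →ₗ[𝕜] V) : Type _ := BalavoineSpace (α.prodMap β)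

/-- `q = ⨁_{n ≥ 0} (Hom(∧^{n+1} g_α, g_α) ⊕ Hom(∧^n g_α ⊗ V_β, V_β)) ⊆ 𝔩`. -/
def qSpace (α : g →ₗ[𝕜] g) (β : V →ₗ[𝕜] V) : Submodule 𝕜 (LSpace α β) :=
  ⨅ n : ℕ, (qPart α β n).comap
    (DirectSum.component 𝕜 ℕ (fun n => CochainSpace (α.prodMap β) n) n)

/-- `a = ⨁_{n ≥ 0} C^{n+1}(V_β, g_α) ⊆ 𝔩`. -/
def aSpace (α : g →ₗ[𝕜] g) (β : V →ₗ[𝕜] V) : Submodule 𝕜 (LSpace α β) :=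
  ⨅ n : ℕ, (aPart α β n).comap
    (DirectSum.component 𝕜 ℕ (fun n => CochainSpace (α.prodMap β) n) n)

/-- The projection onto `a`, in one degree: it sends `f` to the map
`((x_0, v_0), …, (x_n, v_n)) ↦ (pr_g f((0, v_0), …, (0, v_n)), 0)`. -/
def projPart (α : g →ₗ[𝕜] g) (β : V →ₗ[𝕜] V) (n : ℕ) :
    CochainSpace (α.prodMap β) n →ₗ[𝕜]
      CochainSpace (α.prodMap β) n where
  toFun f := CochainSpace.mk
    ((LinearMap.inl 𝕜 g V ∘ₗ LinearMap.fst 𝕜 g V).compMultilinearMap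
      (f.toMap.compLinearMap fun _ => LinearMap.inr 𝕜 g V ∘ₗ LinearMap.snd 𝕜 g V))
    (by
      intro x
      have h := congrArg Prod.fst (f.toMap_mem fun i => ((0 : g), (x i).2))
      simp only [LinearMap.prodMap_apply, map_zero] at h
      simp [h])
  map_add' f f' := by
    apply CochainSpace.ext
    intro x
    exact Prod.ext rfl (add_zero (0 : V)).symm
  map_smul' c f := by
    apply CochainSpace.ext
    intro x
    exact Prod.ext rfl (smul_zero c).symm

/-- The projection `P : 𝔩 → 𝔩` onto `a`. -/
def projA (α : g →ₗ[𝕜] g) (β : V →ₗ[𝕜] V) : LSpace α β →ₗ[𝕜] LSpace α β :=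
  DirectSum.lmap (fun n => projPart α β n)

/-- The underlying space of `s⁻¹q ⊕ a`; the pair `(x, p)` stands for `(s⁻¹x, p)`. -/
abbrev TripleSpace (α : g →ₗ[𝕜] g) (β : V →ₗ[𝕜] V) : Type _ := qSpace α β × aSpace α β

/-- The grading of `s⁻¹q ⊕ a`: `(s⁻¹x, p)` has degree `i` if `x` has degree `i + 1` and `p` has
degree `i`. -/
def tripleGrading (α : g →ₗ[𝕜] g) (β : V →ₗ[𝕜] V) (i : ℤ) : Submodule 𝕜 (TripleSpace α β) :=
  ((homogeneousPart (α.prodMap β) (i + 1)).comap (qSpace α β).subtype).prod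
    ((homogeneousPart (α.prodMap β) i).comap (aSpace α β).subtype)

/-- The operations on `s⁻¹q ⊕ a` are Voronov's higher derived brackets (for `Δ = 0`). Since an
element is a sum of homogeneous elements of `s⁻¹q` and of `a`, these clauses determine `l k` for
all `k ≥ 1`. In `vanish`, `S` is the set of inputs that lie in `s⁻¹q`. -/
structure IsHigherDerivedBracket (α : g →ₗ[𝕜] g) (β : V →ₗ[𝕜] V)
    (l : (k : ℕ) → (Fin k → TripleSpace α β) → TripleSpace α β) : Prop where
  multilinear : IsMultilinearFamily 𝕜 l
  symmetric : IsGradedSymmetric (tripleGrading α β) l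
  two : ∀ (d e : ℤ) (x y : qSpace α β),
    (x : LSpace α β) ∈ homogeneousPart (α.prodMap β) d →
    (y : LSpace α β) ∈ homogeneousPart (α.prodMap β) e →
    ((l 2 ![(x, 0), (y, 0)]).1 : LSpace α β) =
        Int.negOnePow d • balavoineBracket (α.prodMap β) (x : LSpace α β) (y : LSpace α β) ∧
      (l 2 ![(x, 0), (y, 0)]).2 = 0
  mixed : ∀ k, 1 ≤ k → ∀ (d : ℤ) (e : Fin k → ℤ) (x : qSpace α β) (p : Fin k → aSpace α β),
    (x : LSpace α β) ∈ homogeneousPart (α.prodMap β) d →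
    (∀ i, (p i : LSpace α β) ∈ homogeneousPart (α.prodMap β) (e i)) →
    (l (k + 1) (Fin.cons (x, 0) (fun i => (0, p i)))).1 = 0 ∧
      ((l (k + 1) (Fin.cons (x, 0) (fun i => (0, p i)))).2 : LSpace α β) =
        projA α β (nestedBracket (α.prodMap β) (x : LSpace α β) (fun i => (p i : LSpace α β)))
  vanish : ∀ k, 1 ≤ k → ∀ (S : Finset (Fin k)) (w : Fin k → TripleSpace α β),
    (∀ i ∈ S, (w i).2 = 0) → (∀ i ∉ S, (w i).1 = 0) →
    ¬ (S.card = 2 ∧ k = 2) → ¬ (S.card = 1 ∧ 2 ≤ k) → l k w = 0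

/-! ### The element `(s⁻¹(μ ⊞ ρ), T)` -/

/-- `(μ ⊞ ρ)((x, u), (y, v)) = (μ(x, y), ρ(x, v))`. -/
def boxPlus (μ : g →ₗ[𝕜] g →ₗ[𝕜] g) (ρ : g →ₗ[𝕜] V →ₗ[𝕜] V) :
    MultilinearMap 𝕜 (fun _ : Fin 2 => g × V) (g × V) :=
  MultilinearMap.mk' (fun w => (μ (w 0).1 (w 1).1, ρ (w 0).1 (w 1).2))
    (by intro w i a b; fin_cases i <;> simp)
    (by intro w i c a; fin_cases i <;> simp)

/-- `T : V → g` viewed as the map `(x, v) ↦ (T v, 0)` on `g ⊕ V`. -/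
def tensorMap (T : V →ₗ[𝕜] g) : MultilinearMap 𝕜 (fun _ : Fin 1 => g × V) (g × V) :=
  MultilinearMap.ofSubsingleton 𝕜 (g × V) (g × V) (0 : Fin 1)
    (LinearMap.inl 𝕜 g V ∘ₗ T ∘ₗ LinearMap.snd 𝕜 g V)

/-- `μ ⊞ ρ` as an element of `C^2((g ⊕ V)_{α ⊕ β}, (g ⊕ V)_{α ⊕ β})`. -/
def boxPlusCochain {α : g →ₗ[𝕜] g} {β : V →ₗ[𝕜] V} (μ : WedgeTwoHom α) (ρ : ActionHom α β) :
    CochainSpace (α.prodMap β) 1 :=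
  CochainSpace.mk (boxPlus μ.1 ρ.1) fun w => by
    simp only [boxPlus, MultilinearMap.mk'_apply, LinearMap.prodMap_apply]
    rw [μ.2.2, ρ.2]

/-- `T` as an element of `C^1((g ⊕ V)_{α ⊕ β}, (g ⊕ V)_{α ⊕ β})`. -/
def tensorCochain {α : g →ₗ[𝕜] g} {β : V →ₗ[𝕜] V} (T : TwistHom α β) :
    CochainSpace (α.prodMap β) 0 :=
  CochainSpace.mk (tensorMap T.1) fun w => by
    simp [tensorMap, T.2 (w 0).2]

theorem boxPlusCochain_mem {α : g →ₗ[𝕜] g} {β : V →ₗ[𝕜] V} (μ : WedgeTwoHom α)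
    (ρ : ActionHom α β) : boxPlusCochain μ ρ ∈ qPart α β 1 := by
  refine ⟨{ MultilinearMap.mk' (fun x : Fin 2 → g => μ.1 (x 0) (x 1))
      (by intro w i a b; fin_cases i <;> simp)
      (by intro w i c a; fin_cases i <;> simp) with
      map_eq_zero_of_eq' := ?_ }, AlternatingMap.ofSubsingleton 𝕜 g (V →ₗ[𝕜] V) (0 : Fin 1) ρ.1,
      ?_, ?_, ?_⟩
  · intro x i j hij hne
    fin_cases i <;> fin_cases j <;> simp_all [μ.2.1]
  · intro x
    exact μ.2.2 _ _
  · intro x v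
    exact ρ.2 _ _
  · intro w
    rfl

theorem tensorCochain_mem {α : g →ₗ[𝕜] g} {β : V →ₗ[𝕜] V} (T : TwistHom α β) :
    tensorCochain T ∈ aPart α β 0 := by
  refine ⟨MultilinearMap.ofSubsingleton 𝕜 V g (0 : Fin 1) T.1, ?_, ?_⟩
  · intro x
    exact T.2 _
  · intro w
    rfl

theorem lof_mem_of_mem {α : g →ₗ[𝕜] g} {β : V →ₗ[𝕜] V}
    (N : ∀ n : ℕ, Submodule 𝕜 (CochainSpace (α.prodMap β) n)) (n : ℕ)
    {f : CochainSpace (α.prodMap β) n} (hf : f ∈ N n) :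
    DirectSum.lof 𝕜 ℕ (fun n => CochainSpace (α.prodMap β) n) n f ∈
      ⨅ n : ℕ, (N n).comap
        (DirectSum.component 𝕜 ℕ
          (fun n => CochainSpace (α.prodMap β) n) n) := by
  rw [Submodule.mem_iInf]
  intro k
  rw [Submodule.mem_comap]
  by_cases h : n = k
  · subst h
    rw [DirectSum.component.lof_self]
    exact hf
  · rw [DirectSum.component.of, dif_neg h]
    exact zero_mem _

/-- The element `(s⁻¹(μ ⊞ ρ), T)` of `s⁻¹q ⊕ a`. -/
def tripleElement {α : g →ₗ[𝕜] g} {β : V →ₗ[𝕜] V} (μ : WedgeTwoHom α) (ρ : ActionHom α β)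
    (T : TwistHom α β) : TripleSpace α β :=
  (⟨DirectSum.lof 𝕜 ℕ (fun n => CochainSpace (α.prodMap β) n) 1
      (boxPlusCochain μ ρ), lof_mem_of_mem (qPart α β) 1 (boxPlusCochain_mem μ ρ)⟩,
    ⟨DirectSum.lof 𝕜 ℕ (fun n => CochainSpace (α.prodMap β) n) 0
      (tensorCochain T), lof_mem_of_mem (aPart α β) 0 (tensorCochain_mem T)⟩)

end Triples

end HomLL

end

noncomputable section

namespace HomLL


/-! ### Twisted insertion of functionals on lists -/

section Insertion

variable {𝕜 : Type*} [Field 𝕜] {H : Type*} [AddCommGroup H] [Module 𝕜 H]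

/-! The theorem is an instance of Voronov's higher derived brackets. Balavoine's bracket is a graded
Lie bracket (`bracket_jacobi`), 𝔞 is abelian, 𝔮 is a subalgebra (`bracket_qSpace`), and the
projection satisfies P[x,y] = P[Px,y] + P[x,Py] (`projA_bracket`). For p of degree 0 write e =
exp([·,p]). The Maurer–Cartan series at (s⁻¹q, p) is formally (-½[q,q], P(e q)). The higher Jacobi
identities are the polarized form of three facts: the Jacobi identity on 𝔮, the rule [e q, e q] =
e[q,q] because e is an automorphism, and P[D,D] = 2P[PD,D] for D = e q. `VoronovData` isolates this
argument; `split_derived`, `split_projection` and `split_qBracket` carry it out.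

All sums over shuffles are replaced by recursions that decide the fate of one letter at a time. For
⋄ this gives `insertion`, whose associator is graded symmetric in the two inserted maps
(`insertion_insertion_symm`, a graded pre-Lie identity); the Jacobi identity follows. For the
L_∞-relations it gives `splitSum`, a signed sum over splittings of a word into two subwords.

Finiteness comes from a weight: the number of inputs in 𝔤 minus the number of outputs in 𝔤, detected
by conjugation with the automorphism that doubles 𝔤. The bracket adds weights, 𝔮 has weight n in
degree n, 𝔞 has weight -1, and P kills every weight other than -1. Hence q of degree n contributes
to the 𝔞-component only of l_{n+2}.

In degree 0 the element π = μ ⊞ ρ has weight 1, so only l_2 and l_3 survive and the series is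
(-½[π,π], ½P[[π,T],T]). The first component is the Hom-Jacobi identity together with the
representation identity, the second is the embedding tensor identity (`isHomLieLeibnizTriple_iff`).

The relations of the twisted operations are the untwisted relations on words θ…θ x_1…x_k, weighted
by 1/n!. The value of the twisted functional at the empty word is the Maurer–Cartan series of θ, and
the twisted series at θ' is the Taylor difference between the series at θ + θ' and at θ
(`IsListLInfinity.finsum_listTwist`). Uniqueness holds because homogeneous elements of s⁻¹𝔮 and 𝔞
span and the clauses cover all families of them. -/

/-- A functional on lists that is additive in every entry. -/
def ListAdditive {T M : Type*} [Add T] [Add M] (P : List T → M) : Prop :=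
  ∀ a x y b, P (a ++ (x + y) :: b) = P (a ++ x :: b) + P (a ++ y :: b)

theorem ListAdditive.cons {T M : Type*} [Add T] [Add M] {P : List T → M} (hP : ListAdditive P)
    (z : T) : ListAdditive fun t => P (z :: t) :=
  fun a x y b => hP (z :: a) x y b

theorem ListAdditive.map_zero {T M : Type*} [AddGroup T] [AddGroup M] {P : List T → M}
    (hP : ListAdditive P) (a b : List T) : P (a ++ 0 :: b) = 0 := by
  have h := hP a 0 0 b
  rwa [add_zero, left_eq_add] at h

variable (𝕜) in
/-- The insertion of a functional `Q` of `k` variables into `P`, where the variables of `P` that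
are not used by `Q` are twisted by `τ`. -/
def insertion (τ : H → H) : ℕ → (List H → H) → (List H → H) → List H → H
  | 0, Q, P, l => P (Q [] :: l.map τ)
  | _ + 1, _, _, [] => 0
  -- The last variable of `Q` keeps its place, so a letter left to `P` passes only the `k` other
  -- variables that `Q` still needs. The product of these signs is (-1)^{in}(-1)^σ.
  | k + 1, Q, P, x :: l => (-1 : 𝕜) ^ k • insertion τ (k + 1) Q (fun t => P (τ x :: t)) l +
      insertion τ k (fun t => Q (x :: t)) P l

theorem insertion_zero (τ : H → H) (Q P : List H → H) (l : List H) :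
    insertion 𝕜 τ 0 Q P l = P (Q [] :: l.map τ) := by
  cases l <;> rfl

@[simp] theorem insertion_nil (τ : H → H) (k : ℕ) (Q P : List H → H) :
    insertion 𝕜 τ (k + 1) Q P [] = 0 := rfl

theorem insertion_cons (τ : H → H) (k : ℕ) (Q P : List H → H) (x : H) (l : List H) :
    insertion 𝕜 τ (k + 1) Q P (x :: l) =
      (-1 : 𝕜) ^ k • insertion 𝕜 τ (k + 1) Q (fun t => P (τ x :: t)) l +
        insertion 𝕜 τ k (fun t => Q (x :: t)) P l := rfl

/-- The value of `Q` is always an entry of `P`, so `P` is never evaluated at the empty word. This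
matters when `P` has arity one. -/
theorem insertion_congr_left (τ : H → H) (k : ℕ) (Q : List H → H) {P P' : List H → H}
    (h : ∀ t, t ≠ [] → P t = P' t) (l : List H) :
    insertion 𝕜 τ k Q P l = insertion 𝕜 τ k Q P' l := by
  induction l generalizing k Q P P' with
  | nil =>
    cases k with
    | zero => simp only [insertion_zero]; exact h _ (by simp)
    | succ k => rfl
  | cons x l ih =>
    cases k with
    | zero => simp only [insertion_zero]; exact h _ (by simp)
    | succ k =>
      rw [insertion_cons, insertion_cons, ih _ _ (fun t _ => h (τ x :: t) (by simp)), ih _ _ h]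

theorem insertion_congr_right (τ : H → H) (k : ℕ) {Q Q' : List H → H} (P : List H → H)
    (h : ∀ t, t.length = k → Q t = Q' t) (l : List H) :
    insertion 𝕜 τ k Q P l = insertion 𝕜 τ k Q' P l := by
  induction l generalizing k Q Q' P with
  | nil =>
    cases k with
    | zero => simp only [insertion_zero]; rw [h [] rfl]
    | succ k => rfl
  | cons x l ih =>
    cases k with
    | zero => simp only [insertion_zero]; rw [h [] rfl]
    | succ k =>
      rw [insertion_cons, insertion_cons, ih _ _ h, ih k P (fun t ht => h (x :: t) (by simp [ht]))]

theorem insertion_eq_zero_of_length_lt (τ : H → H) (k : ℕ) (Q P : List H → H) (l : List H)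
    (h : l.length < k) : insertion 𝕜 τ k Q P l = 0 := by
  induction l generalizing k Q P with
  | nil =>
    cases k with
    | zero => simp at h
    | succ k => rfl
  | cons x l ih =>
    cases k with
    | zero => simp at h
    | succ k =>
      simp only [List.length_cons] at h
      rw [insertion_cons, ih _ _ _ (by omega), ih _ _ _ (by omega), smul_zero, add_zero]

theorem insertion_add_left (τ : H → H) (k : ℕ) (Q P P' : List H → H) (l : List H) :
    insertion 𝕜 τ k Q (fun t => P t + P' t) l =
      insertion 𝕜 τ k Q P l + insertion 𝕜 τ k Q P' l := by
  induction l generalizing k Q P P' with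
  | nil =>
    cases k with
    | zero => simp only [insertion_zero]
    | succ k => simp
  | cons x l ih =>
    cases k with
    | zero => simp only [insertion_zero]
    | succ k =>
      simp only [insertion_cons, ih, smul_add]
      abel

theorem insertion_smul_left (τ : H → H) (k : ℕ) (Q P : List H → H) (c : 𝕜) (l : List H) :
    insertion 𝕜 τ k Q (fun t => c • P t) l = c • insertion 𝕜 τ k Q P l := by
  induction l generalizing k Q P with
  | nil =>
    cases k with
    | zero => simp only [insertion_zero]
    | succ k => simp
  | cons x l ih =>
    cases k with
    | zero => simp only [insertion_zero]
    | succ k => simp only [insertion_cons, ih, smul_add, smul_comm c]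

theorem insertion_zero_left (τ : H → H) (k : ℕ) (Q : List H → H) (l : List H) :
    insertion 𝕜 τ k Q (fun _ => 0) l = 0 := by
  simpa using insertion_smul_left (𝕜 := 𝕜) τ k Q (fun _ => 0) 0 l

/-- `Q` turns `k` letters into one entry, so an outer functional of arity `d + 1` sees exactly `d`
further letters. -/
theorem insertion_eq_zero_of_arity (τ : H → H) (k : ℕ) (Q P : List H → H) (l : List H)
    {d : ℕ} (hP : ∀ t, t.length ≠ d + 1 → P t = 0) (h : l.length ≠ d + k) :
    insertion 𝕜 τ k Q P l = 0 := by
  induction l generalizing k Q P d with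
  | nil =>
    cases k with
    | zero => rw [insertion_zero]; apply hP; simp at h ⊢; omega
    | succ k => rfl
  | cons x l ih =>
    cases k with
    | zero => rw [insertion_zero]; apply hP; simp at h ⊢; omega
    | succ k =>
      simp only [List.length_cons] at h
      rw [insertion_cons, ih k _ _ hP (by omega), add_zero]
      cases d with
      | zero =>
        rw [insertion_congr_left (P' := fun _ => 0)]
        · rw [insertion_zero_left, smul_zero]
        · intro t ht
          apply hP
          simpa using ht
      | succ d =>
        rw [ih (d := d) _ _ _ (fun t ht => hP _ (by simpa using ht)) (by omega), smul_zero]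

theorem insertion_add_right (τ : H → H) (k : ℕ) (Q Q' : List H → H) {P : List H → H}
    (hP : ListAdditive P) (l : List H) :
    insertion 𝕜 τ k (fun t => Q t + Q' t) P l =
      insertion 𝕜 τ k Q P l + insertion 𝕜 τ k Q' P l := by
  induction l generalizing k Q Q' P with
  | nil =>
    cases k with
    | zero => simp only [insertion_zero]; exact hP [] _ _ _
    | succ k => simp
  | cons x l ih =>
    cases k with
    | zero => simp only [insertion_zero]; exact hP [] _ _ _
    | succ k =>
      simp only [insertion_cons, ih _ _ _ hP, ih _ _ _ (hP.cons _), smul_add]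
      abel

theorem insertion_zero_right (τ : H → H) (k : ℕ) {P : List H → H} (hP : ListAdditive P)
    (l : List H) : insertion 𝕜 τ k (fun _ => 0) P l = 0 := by
  have h := insertion_add_right (𝕜 := 𝕜) τ k (fun _ => 0) (fun _ => 0) hP l
  simpa using h

theorem insertion_neg_right (τ : H → H) (k : ℕ) (Q : List H → H) {P : List H → H}
    (hP : ListAdditive P) (l : List H) :
    insertion 𝕜 τ k (fun t => -Q t) P l = -insertion 𝕜 τ k Q P l := by
  have h := insertion_add_right (𝕜 := 𝕜) τ k Q (fun t => -Q t) hP l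
  simp only [add_neg_cancel, insertion_zero_right τ k hP] at h
  exact (neg_eq_of_add_eq_zero_right h.symm).symm

/-- For a sign, additivity replaces homogeneity, so the associator identity needs only
`ListAdditive`. -/
theorem insertion_sign_smul_right (τ : H → H) (k n : ℕ) (Q : List H → H) {P : List H → H}
    (hP : ListAdditive P) (l : List H) :
    insertion 𝕜 τ k (fun t => (-1 : 𝕜) ^ n • Q t) P l = (-1 : 𝕜) ^ n • insertion 𝕜 τ k Q P l := by
  rcases neg_one_pow_eq_or 𝕜 n with h | h <;> simp [h, insertion_neg_right τ k Q hP]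

/-- Precomposing the outer functional. -/
theorem insertion_comp_map_left (τ η : H → H) (k : ℕ) (Q P : List H → H) (l : List H) :
    insertion 𝕜 τ k Q (fun t => P (t.map η)) l =
      insertion 𝕜 (fun x => η (τ x)) k (fun t => η (Q t)) P l := by
  induction l generalizing k Q P with
  | nil =>
    cases k with
    | zero => simp [insertion_zero]
    | succ k => simp
  | cons x l ih =>
    cases k with
    | zero => simp [insertion_zero, Function.comp_def]
    | succ k =>
      simp only [insertion_cons, List.map_cons]
      rw [ih (k + 1) Q (fun t => P (η (τ x) :: t)), ih k _ P]

/-- Precomposing the result. -/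
theorem insertion_map (τ ψ : H → H) (k : ℕ) (Q P : List H → H) (l : List H) :
    insertion 𝕜 τ k Q P (l.map ψ) =
      insertion 𝕜 (fun x => τ (ψ x)) k (fun t => Q (t.map ψ)) P l := by
  induction l generalizing k Q P with
  | nil =>
    cases k with
    | zero => simp [insertion_zero]
    | succ k => simp
  | cons x l ih =>
    cases k with
    | zero => simp [insertion_zero, Function.comp_def]
    | succ k => simp only [insertion_cons, List.map_cons, ih]

theorem map_insertion (τ : H → H) (η : H →ₗ[𝕜] H) (k : ℕ) (Q P : List H → H) (l : List H) :
    η (insertion 𝕜 τ k Q P l) = insertion 𝕜 τ k Q (fun t => η (P t)) l := by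
  induction l generalizing k Q P with
  | nil =>
    cases k with
    | zero => simp [insertion_zero]
    | succ k => simp
  | cons x l ih =>
    cases k with
    | zero => simp [insertion_zero]
    | succ k => simp only [insertion_cons, map_add, map_smul, ih]

/-- Base case of the associator identity: `Q` has all its variables and is a constant, so `R` cannot
enter it and the second term on the left vanishes. On the right the constant is either left to `P`,
which gives the left side up to sign, or consumed by `R'`, and that part cancels against the
subtracted term. -/
theorem insertion_insertion_zero_left (τ σ : H → H) (hτσ : ∀ x, τ (σ x) = σ (τ x)) (r : ℕ)
    {P Q R Q' R' : List H → H} (hP : ListAdditive P)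
    (hQ : ∀ t, Q (t.map σ) = σ (Q' t)) (hR : ∀ t, R' (t.map τ) = τ (R t)) (l : List H) :
    insertion 𝕜 σ (r + 1) R (insertion 𝕜 τ 0 Q P) l -
        insertion 𝕜 (fun x => τ (σ x)) r (insertion 𝕜 σ (r + 1) R Q) P l =
      (-1 : 𝕜) ^ r • (insertion 𝕜 τ 0 Q' (insertion 𝕜 σ (r + 1) R' P) l -
        insertion 𝕜 (fun x => τ (σ x)) r (insertion 𝕜 τ 0 Q' R') P l) := by
  have h1 : insertion 𝕜 (fun x => τ (σ x)) r (insertion 𝕜 σ (r + 1) R Q) P l = 0 := by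
    rw [insertion_congr_right (Q' := fun _ => 0), insertion_zero_right _ _ hP]
    intro t ht
    exact insertion_eq_zero_of_length_lt _ _ _ _ _ (by omega)
  have h2 : insertion 𝕜 τ 0 Q P = fun t => (fun s => P (Q [] :: s)) (t.map τ) := by
    funext t; rw [insertion_zero]
  have h3 : insertion 𝕜 τ 0 Q' R' = fun t => (fun s => R' (Q' [] :: s)) (t.map τ) := by
    funext t; rw [insertion_zero]
  have hc : Q [] = σ (Q' []) := hQ []
  rw [h1, sub_zero, h2, insertion_comp_map_left σ τ _ _ (fun s => P (Q [] :: s)), insertion_zero, insertion_cons,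
    insertion_map, insertion_map, h3, hc]
  simp only [hτσ, hR]
  rw [add_sub_cancel_right, smul_smul, ← mul_pow]
  simp

/-- The associator counts the insertions of `Q` and `R` into different slots of `P`, and these may
be made in either order. The primed functionals are needed for the induction: a letter reaches `Q`
after the twist `σ` on one side and untwisted on the other. For equivariant cochains `Q' = Q` and
`R' = R`. Since `q` and `r` are arities, one more than degrees, the sign exponent is (q+1)(r+1). -/
theorem insertion_insertion_symm (τ σ : H → H) (hτσ : ∀ x, τ (σ x) = σ (τ x)) (q r : ℕ)
    (hqr : q + r ≠ 0) {P Q R Q' R' : List H → H} (hP : ListAdditive P) (hQa : ListAdditive Q)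
    (hR'a : ListAdditive R')
    (hQ : ∀ t, Q (t.map σ) = σ (Q' t)) (hR : ∀ t, R' (t.map τ) = τ (R t)) (l : List H) :
    insertion 𝕜 σ r R (insertion 𝕜 τ q Q P) l -
        insertion 𝕜 (fun x => τ (σ x)) (q + r - 1) (insertion 𝕜 σ r R Q) P l =
      (-1 : 𝕜) ^ ((q + 1) * (r + 1)) • (insertion 𝕜 τ q Q' (insertion 𝕜 σ r R' P) l -
        insertion 𝕜 (fun x => τ (σ x)) (q + r - 1) (insertion 𝕜 τ q Q' R') P l) := by
  induction l generalizing q r P Q R Q' R' with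
  | nil =>
    rcases q with _ | q
    · rcases r with _ | r
      · simp at hqr
      · have h := insertion_insertion_zero_left (𝕜 := 𝕜) τ σ hτσ r hP hQ hR []
        simp only [zero_add, Nat.add_sub_cancel, one_mul, pow_succ, mul_neg, mul_one, neg_neg]
        exact h
    · rcases r with _ | r
      · have h := insertion_insertion_zero_left (𝕜 := 𝕜) σ τ (fun x => (hτσ x).symm) q hP hR hQ []
        simp only [zero_add, add_zero, Nat.add_sub_cancel, mul_one, pow_succ, mul_neg, neg_neg,
          hτσ]
        rw [h, smul_smul, ← mul_pow]
        simp
      · simp [show q + 1 + (r + 1) - 1 = q + r + 1 by omega]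
  | cons x l ih =>
    rcases q with _ | q
    · rcases r with _ | r
      · simp at hqr
      · have h := insertion_insertion_zero_left (𝕜 := 𝕜) τ σ hτσ r hP hQ hR (x :: l)
        simp only [zero_add, Nat.add_sub_cancel, one_mul, pow_succ, mul_neg, mul_one, neg_neg]
        exact h
    · rcases r with _ | r
      · have h := insertion_insertion_zero_left (𝕜 := 𝕜) σ τ (fun x => (hτσ x).symm) q hP hR hQ
          (x :: l)
        simp only [zero_add, add_zero, Nat.add_sub_cancel, mul_one, pow_succ, mul_neg, neg_neg,
          hτσ]
        rw [h, smul_smul, ← mul_pow]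
        simp
      -- The first letter goes to `P`, to `Q` or to `R`; each possibility is one use of the
      -- induction hypothesis.
      · have i1 := ih (q + 1) (r + 1) (by omega) (hP.cons (τ (σ x))) hQa hR'a hQ hR
        have i2 := ih q (r + 1) (by omega) (Q := fun t => Q (σ x :: t))
          (Q' := fun t => Q' (x :: t)) hP (hQa.cons _) hR'a
          (fun t => by simpa using hQ (x :: t)) hR
        have i3 := ih (q + 1) r (by omega) (R := fun t => R (x :: t))
          (R' := fun t => R' (τ x :: t)) hP hQa (hR'a.cons _) hQ
          (fun t => by simpa using hR (x :: t))
        rw [show q + 1 + (r + 1) - 1 = q + r + 1 by omega] at i1 ⊢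
        rw [show q + (r + 1) - 1 = q + r by omega] at i2
        rw [show q + 1 + r - 1 = q + r by omega] at i3
        simp only [insertion_cons, insertion_add_left, insertion_smul_left,
          insertion_add_right _ _ _ _ hP, insertion_sign_smul_right _ _ _ _ hP] at i1 i2 i3 ⊢
        simp only [← hτσ] at i1 i2 i3 ⊢
        rcases neg_one_pow_eq_or 𝕜 q with hq | hq <;> rcases neg_one_pow_eq_or 𝕜 r with hr | hr <;>
        simp only [pow_add, pow_mul, hq, hr, pow_one, mul_add, add_mul, mul_one, one_mul, mul_neg,
          neg_neg, one_pow, neg_smul, one_smul] at i1 i2 i3 ⊢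
        · linear_combination (norm := module) i1 + i2 + i3
        · linear_combination (norm := module) -i1 - i2 + i3
        · linear_combination (norm := module) -i1 + i2 + i3
        · linear_combination (norm := module) i1 - i2 + i3

end Insertion

/-! ### Signs as scalars -/

section Sign

variable (𝕜 : Type*) [Field 𝕜]

/-- `(-1)^d` as a scalar. -/
def sgn (d : ℤ) : 𝕜 := ((Int.negOnePow d : ℤ) : 𝕜)

theorem sgn_add (d e : ℤ) : sgn 𝕜 (d + e) = sgn 𝕜 d * sgn 𝕜 e := by
  simp [sgn, Int.negOnePow_add]

@[simp] theorem sgn_zero : sgn 𝕜 0 = 1 := by simp [sgn]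

@[simp] theorem sgn_one : sgn 𝕜 1 = -1 := by simp [sgn]

theorem sgn_eq_or (d : ℤ) : sgn 𝕜 d = 1 ∨ sgn 𝕜 d = -1 := by
  rcases Int.even_or_odd d with h | h
  · left; simp [sgn, Int.negOnePow_even d h]
  · right; simp [sgn, Int.negOnePow_odd d h]

theorem sgn_mul_self (d : ℤ) : sgn 𝕜 d * sgn 𝕜 d = 1 := by
  rcases sgn_eq_or 𝕜 d with h | h <;> simp [h]

theorem sgn_eq_of_even_sub {d e : ℤ} (h : Even (d - e)) : sgn 𝕜 d = sgn 𝕜 e := by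
  rw [sgn, sgn, (Int.negOnePow_eq_iff d e).2 h]

theorem sgn_natCast (n : ℕ) : sgn 𝕜 n = (-1) ^ n := by
  induction n with
  | zero => simp
  | succ n ih => rw [Nat.cast_succ, sgn_add, ih, sgn_one, pow_succ]

variable {𝕜} {M : Type*} [AddCommGroup M] [Module 𝕜 M]

theorem units_smul_eq (u : ℤˣ) (m : M) : u • m = ((u : ℤ) : 𝕜) • m := by
  rw [Units.smul_def, Int.cast_smul_eq_zsmul]

theorem negOnePow_smul_eq (d : ℤ) (m : M) : Int.negOnePow d • m = sgn 𝕜 d • m :=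
  units_smul_eq _ m

end Sign

/-! ### Removing the first letter from a permutation -/

section InsertPerm

/-- The permutation that sends the position `p` to `0` and is `σ` elsewhere. -/
def insertPerm {N : ℕ} (p : Fin (N + 1)) (σ : Equiv.Perm (Fin N)) : Equiv.Perm (Fin (N + 1)) :=
  (finSuccEquiv' p).trans ((Equiv.optionCongr σ).trans (finSuccEquiv N).symm)

@[simp] theorem insertPerm_self {N : ℕ} (p : Fin (N + 1)) (σ : Equiv.Perm (Fin N)) :
    insertPerm p σ p = 0 := by
  simp [insertPerm]

@[simp] theorem insertPerm_succAbove {N : ℕ} (p : Fin (N + 1)) (σ : Equiv.Perm (Fin N))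
    (j : Fin N) : insertPerm p σ (p.succAbove j) = (σ j).succ := by
  simp [insertPerm]

@[simp] theorem insertPerm_zero_succ {N : ℕ} (σ : Equiv.Perm (Fin N)) (j : Fin N) :
    insertPerm 0 σ j.succ = (σ j).succ := by
  simpa using insertPerm_succAbove 0 σ j

theorem val_succAbove {N : ℕ} (p : Fin (N + 1)) (j : Fin N) :
    (p.succAbove j).1 = if j.1 < p.1 then j.1 else j.1 + 1 := by
  unfold Fin.succAbove
  simp only [Fin.lt_def, Fin.val_castSucc]
  split_ifs <;> simp

theorem exists_insertPerm {N : ℕ} (σ : Equiv.Perm (Fin (N + 1))) :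
    ∃ σ', σ = insertPerm (σ.symm 0) σ' := by
  let e : Option (Fin N) ≃ Option (Fin N) :=
    (finSuccEquiv' (σ.symm 0)).symm.trans (σ.trans (finSuccEquiv N))
  have he : e.symm none = none := by simp [e]
  refine ⟨Equiv.removeNone e, ?_⟩
  ext1 c
  rcases Fin.eq_self_or_eq_succAbove (σ.symm 0) c with rfl | ⟨j, rfl⟩
  · simp
  · rw [insertPerm_succAbove]
    have h : some (Equiv.removeNone e j) = e (some j) := by
      refine Equiv.removeNone_some e (Option.ne_none_iff_exists'.1 fun hn => ?_)
      rw [← e.apply_symm_apply none, he] at hn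
      simpa using e.injective hn
    have h2 : e (some j) = finSuccEquiv N (σ ((σ.symm 0).succAbove j)) := by simp [e]
    rw [h2] at h
    rw [← finSuccEquiv_symm_some, h, Equiv.symm_apply_apply]

theorem insertPerm_injective {N : ℕ} (p : Fin (N + 1)) :
    Function.Injective (insertPerm (N := N) p) := by
  intro σ σ' h
  ext1 j
  have := congrArg (fun τ : Equiv.Perm (Fin (N + 1)) => τ (p.succAbove j)) h
  simpa using this

/-- The letter 0 is the smallest, so its inversions are exactly with the letters at positions before
`p`. -/
theorem koszulSign_insertPerm {N : ℕ} (p : Fin (N + 1)) (σ : Equiv.Perm (Fin N))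
    (d : Fin (N + 1) → ℤ) :
    koszulSign (insertPerm p σ) d =
      (∏ j : Fin N, if j.castSucc < p then Int.negOnePow (d (σ j).succ * d 0) else 1) *
        koszulSign σ (fun i => d i.succ) := by
  unfold koszulSign
  rw [Fin.prod_univ_succAbove _ p, Fin.prod_univ_succAbove _ p]
  have h1 : ∀ j : Fin N, (if p < p.succAbove j ∧
      insertPerm p σ (p.succAbove j) < insertPerm p σ p then
      Int.negOnePow (d (insertPerm p σ p) * d (insertPerm p σ (p.succAbove j))) else 1) = 1 := by
    intro j
    rw [if_neg]
    simp
  rw [Finset.prod_congr rfl fun j _ => h1 j]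
  simp only [lt_self_iff_false, false_and, if_false, Finset.prod_const_one, one_mul]
  rw [← Finset.prod_mul_distrib]
  refine Finset.prod_congr rfl fun i _ => ?_
  rw [Fin.prod_univ_succAbove _ p]
  congr 1
  · simp [Fin.succAbove_lt_iff_castSucc_lt]
  · refine Finset.prod_congr rfl fun j _ => ?_
    simp [Fin.succAbove_lt_succAbove_iff]

theorem koszulSign_one {N : ℕ} (d : Fin N → ℤ) : koszulSign (1 : Equiv.Perm (Fin N)) d = 1 := by
  unfold koszulSign
  refine Finset.prod_eq_one fun i _ => Finset.prod_eq_one fun j _ => if_neg ?_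
  simp only [Equiv.Perm.coe_one, id]
  omega

/-- Each inversion contributes -1. Thus Balavoine's sums are Koszul-signed sums with all letters of
degree 1, and one recursion serves both kinds of shuffle sums. -/
theorem koszulSign_one_degree {N : ℕ} (σ : Equiv.Perm (Fin N)) :
    koszulSign σ (fun _ => 1) = Equiv.Perm.sign σ := by
  rw [Equiv.Perm.sign_eq_prod_prod_Ioi]
  unfold koszulSign
  refine Finset.prod_congr rfl fun i _ => ?_
  have : (Finset.Ioi i) = Finset.univ.filter (fun j => i < j) := by ext; simp
  rw [this, Finset.prod_filter]
  refine Finset.prod_congr rfl fun j _ => ?_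
  by_cases h : i < j
  · rcases lt_trichotomy (σ i) (σ j) with h' | h' | h'
    · simp [h, h', h'.le]
    · exact absurd (σ.injective h') h.ne
    · simp [h, h', h'.le.not_gt]
  · simp [h]

theorem ofFn_insertPerm {N : ℕ} {Y : Type*} (x : Fin (N + 1) → Y) (p : Fin (N + 1))
    (σ : Equiv.Perm (Fin N)) :
    List.ofFn (fun i => x (insertPerm p σ i)) =
      (List.ofFn fun j => x (σ j).succ).take p ++ x 0 :: (List.ofFn fun j => x (σ j).succ).drop p := by
  apply List.ext_getElem
  · simp; omega
  · intro i h1 h2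
    simp only [List.length_ofFn] at h1
    rw [List.getElem_ofFn]
    rcases Fin.eq_self_or_eq_succAbove p ⟨i, h1⟩ with h | ⟨j, h⟩
    · have hi : i = p := congrArg Fin.val h
      rw [h, insertPerm_self]
      subst hi
      rw [List.getElem_append_right (by simp)]
      simp [show min p.1 N = p.1 by omega]
    · rw [h, insertPerm_succAbove]
      have hi := congrArg Fin.val h
      rw [val_succAbove] at hi
      change i = _ at hi
      split_ifs at hi with hj
      · have hj' : j.1 < p.1 := hj
        rw [List.getElem_append_left (by simp; omega)]
        simp [hi]
      · have hj' : ¬ j.1 < p.1 := hj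
        rw [List.getElem_append_right (by simp; omega)]
        rw [List.getElem_cons]
        simp only [List.length_take, List.length_ofFn, show min p.1 N = p.1 by omega]
        rw [dif_neg (by omega)]
        simp only [List.getElem_drop, List.getElem_ofFn]
        congr 3
        apply Fin.ext
        simp
        omega

end InsertPerm

/-! ### Sums over shuffles -/

section ShuffleSum

variable {𝕜 : Type*} [Field 𝕜] {Y : Type*} (deg : Y → ℤ) {M : Type*} [AddCommGroup M] [Module 𝕜 M]

theorem isShuffle_insertPerm_zero {N p q : ℕ} (σ : Equiv.Perm (Fin N)) :
    IsShuffle (p + 1) q (insertPerm 0 σ) ↔ IsShuffle p q σ := by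
  constructor
  · rintro ⟨h1, h2, h3⟩
    refine ⟨fun a b hab hb => ?_, fun a b hab ha hb => ?_, fun a ha => ?_⟩
    · simpa using h1 a.succ b.succ (by simpa) (by simp; omega)
    · have := h2 a.succ b.succ (by simpa) (by simp; omega) (by simp; omega)
      simpa using this
    · have := h3 a.succ (by simp; omega)
      simpa using this
  · rintro ⟨h1, h2, h3⟩
    refine ⟨fun a b hab hb => ?_, fun a b hab ha hb => ?_, fun a ha => ?_⟩
    · induction b using Fin.cases with
      | zero => simp at hab
      | succ b =>
        induction a using Fin.cases with
        | zero => simp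
        | succ a => simpa using h1 a b (by simpa using hab) (by simpa using hb)
    · induction a using Fin.cases with
      | zero => simp at ha
      | succ a =>
        induction b using Fin.cases with
        | zero => simp at hab
        | succ b =>
          simpa using h2 a b (by simpa using hab) (by simpa using ha) (by simp at hb; omega)
    · induction a using Fin.cases with
      | zero => simp at ha
      | succ a =>
        have : σ a = a := h3 a (by simp at ha; omega)
        simp [this]

theorem isShuffle_insertPerm_mid {N p q : ℕ} (hp : p < N + 1) (σ : Equiv.Perm (Fin N)) :
    IsShuffle p (q + 1) (insertPerm ⟨p, hp⟩ σ) ↔ IsShuffle p q σ := by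
  have hv : ∀ j : Fin N, ((⟨p, hp⟩ : Fin (N + 1)).succAbove j).1 =
      if j.1 < p then j.1 else j.1 + 1 := fun j => val_succAbove _ j
  constructor
  · rintro ⟨h1, h2, h3⟩
    refine ⟨fun a b hab hb => ?_, fun a b hab ha hb => ?_, fun a ha => ?_⟩
    · have := h1 _ _ (Fin.succAbove_lt_succAbove_iff (p := ⟨p, hp⟩).2 hab)
        (by rw [hv, if_pos hb]; exact hb)
      simpa using this
    · have := h2 _ _ (Fin.succAbove_lt_succAbove_iff (p := ⟨p, hp⟩).2 hab)
        (by rw [hv, if_neg (by omega)]; omega) (by rw [hv, if_neg (by omega)]; omega)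
      simpa using this
    · have := h3 ((⟨p, hp⟩ : Fin (N + 1)).succAbove a) (by rw [hv, if_neg (by omega)]; omega)
      rw [insertPerm_succAbove] at this
      have h4 := congrArg Fin.val this
      rw [hv, if_neg (by omega)] at h4
      exact Fin.ext (by simpa using h4)
  · rintro ⟨h1, h2, h3⟩
    refine ⟨fun a b hab hb => ?_, fun a b hab ha hb => ?_, fun a ha => ?_⟩
    · rcases Fin.eq_self_or_eq_succAbove ⟨p, hp⟩ a with rfl | ⟨a, rfl⟩
      · rw [Fin.lt_def] at hab; simp only at hab; omega
      rcases Fin.eq_self_or_eq_succAbove ⟨p, hp⟩ b with rfl | ⟨b, rfl⟩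
      · simp at hb
      have hab' := Fin.succAbove_lt_succAbove_iff.1 hab
      rw [hv] at hb
      have := h1 a b hab' (by split_ifs at hb <;> omega)
      simpa using this
    · rcases Fin.eq_self_or_eq_succAbove ⟨p, hp⟩ b with rfl | ⟨b, rfl⟩
      · rw [Fin.lt_def] at hab; simp only at hab; omega
      rcases Fin.eq_self_or_eq_succAbove ⟨p, hp⟩ a with rfl | ⟨a, rfl⟩
      · simp
      have hab' := Fin.succAbove_lt_succAbove_iff.1 hab
      rw [hv] at hb ha
      have := h2 a b hab' (by split_ifs at ha <;> omega) (by split_ifs at hb <;> omega)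
      simpa using this
    · rcases Fin.eq_self_or_eq_succAbove ⟨p, hp⟩ a with rfl | ⟨a, rfl⟩
      · simp at ha
      rw [hv] at ha
      have ha' : p ≤ a.1 ∧ p + q ≤ a.1 := by split_ifs at ha <;> omega
      rw [insertPerm_succAbove, h3 a ha'.2]
      apply Fin.ext
      rw [hv, if_neg (by omega)]
      simp

/-- The smallest letter must head one of the two increasing blocks; if it lies in the fixed tail, it
is fixed and stands at position 0. -/
theorem IsShuffle.symm_zero {N p q : ℕ} {σ : Equiv.Perm (Fin (N + 1))} (h : IsShuffle p q σ)
    : (σ.symm 0).1 = 0 ∨ (σ.symm 0).1 = p := by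
  obtain ⟨h1, h2, h3⟩ := h
  by_contra! hc
  by_cases c1 : (σ.symm 0).1 < p
  · have := h1 0 (σ.symm 0) (Fin.pos_iff_ne_zero.2 fun h => hc.1 (by rw [h]; rfl)) c1
    simp at this
  by_cases c2 : (σ.symm 0).1 < p + q
  · have := h2 ⟨p, by omega⟩ (σ.symm 0) (by rw [Fin.lt_def]; simp only; omega) le_rfl c2
    simp at this
  · have := h3 (σ.symm 0) (by omega)
    rw [Equiv.apply_symm_apply] at this
    rw [← this] at hc
    simp at hc

theorem eq_one_of_increasing {N r : ℕ} {σ : Equiv.Perm (Fin N)}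
    (h1 : ∀ a b : Fin N, a < b → b.1 < r → σ a < σ b) (h2 : ∀ a : Fin N, r ≤ a.1 → σ a = a) :
    σ = 1 := by
  have hm : StrictMono σ := by
    intro a b hab
    by_cases hb : b.1 < r
    · exact h1 a b hab hb
    · rw [h2 b (by omega)]
      by_cases ha : a.1 < r
      · by_contra hc
        have h3 := h2 (σ a) (by omega)
        have := σ.injective h3
        omega
      · rwa [h2 a (by omega)]
  ext1 a
  exact congrFun (hm.range_inj (strictMono_id) |>.1 (by simp [σ.surjective.range_eq])) a

theorem shuffles_zero_left (N q : ℕ) : shuffles N 0 q = {1} := by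
  ext σ
  simp only [shuffles, Finset.mem_filter, Finset.mem_univ, true_and, Finset.mem_singleton]
  constructor
  · rintro ⟨-, h2, h3⟩
    exact eq_one_of_increasing (r := q) (fun a b hab hb => h2 a b hab (by simp) (by simpa))
      (fun a ha => h3 a (by simpa))
  · rintro rfl
    exact ⟨by simp, by simp +contextual, by simp⟩

theorem shuffles_zero_right (N p : ℕ) : shuffles N p 0 = {1} := by
  ext σ
  simp only [shuffles, Finset.mem_filter, Finset.mem_univ, true_and, Finset.mem_singleton]
  constructor
  · rintro ⟨h1, -, h3⟩
    exact eq_one_of_increasing (r := p) h1 (fun a ha => h3 a (by simpa))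
  · rintro rfl
    exact ⟨by simp +contextual, by simp +contextual, by simp⟩

/-- The total degree of a list. -/
def listDeg (l : List Y) : ℤ := (l.map deg).sum

@[simp] theorem listDeg_nil : listDeg deg [] = 0 := rfl

@[simp] theorem listDeg_cons (y : Y) (l : List Y) :
    listDeg deg (y :: l) = deg y + listDeg deg l := by simp [listDeg]

variable (𝕜) in
/-- The signed sum of a functional over the rearrangements of a word by shuffles. -/
def shuffleSum (N p q : ℕ) (x : Fin N → Y) (F : List Y → M) : M :=
  ∑ σ ∈ shuffles N p q, ((koszulSign σ (fun i => deg (x i)) : ℤ) : 𝕜) • F (List.ofFn fun i => x (σ i))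

theorem shuffleSum_congr {N p q : ℕ} (x : Fin N → Y) {F F' : List Y → M}
    (h : ∀ l, l.length = N → F l = F' l) :
    shuffleSum 𝕜 deg N p q x F = shuffleSum 𝕜 deg N p q x F' :=
  Finset.sum_congr rfl fun σ _ => by rw [h _ (by simp)]

theorem shuffleSum_zero_left (N q : ℕ) (x : Fin N → Y) (F : List Y → M) :
    shuffleSum 𝕜 deg N 0 q x F = F (List.ofFn x) := by
  simp [shuffleSum, shuffles_zero_left, koszulSign_one]

theorem shuffleSum_zero_right (N p : ℕ) (x : Fin N → Y) (F : List Y → M) :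
    shuffleSum 𝕜 deg N p 0 x F = F (List.ofFn x) := by
  simp [shuffleSum, shuffles_zero_right, koszulSign_one]

theorem koszulSign_insertPerm_sgn {N : ℕ} (p : Fin (N + 1)) (σ : Equiv.Perm (Fin N))
    (x : Fin (N + 1) → Y) :
    ((koszulSign (insertPerm p σ) (fun i => deg (x i)) : ℤ) : 𝕜) =
      ((koszulSign σ (fun i => deg (x i.succ)) : ℤ) : 𝕜) *
      sgn 𝕜 (deg (x 0) * listDeg deg ((List.ofFn fun j => x (σ j).succ).take p)) := by
  rw [koszulSign_insertPerm, mul_comm]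
  push_cast
  congr 1
  have key : ∀ (k : ℕ) (d : Fin N → ℤ) (e : ℤ),
      (((∏ j : Fin N, if j.1 < k then Int.negOnePow (d j * e) else 1 : ℤˣ) : ℤ) : 𝕜) =
        sgn 𝕜 (e * ((List.ofFn d).take k).sum) := by
    intro k d e
    rw [sgn]
    congr 2
    clear x σ p
    induction N generalizing k with
    | zero => simp
    | succ N ih =>
      rcases k with _ | k
      · simp
      · rw [Fin.prod_univ_succ, List.ofFn_succ]
        simp only [Fin.val_succ, add_lt_add_iff_right, List.take_succ_cons, List.sum_cons, ih k]
        rw [mul_add, Int.negOnePow_add]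
        simp [mul_comm]
  have h := key p (fun j => deg (x (σ j).succ)) (deg (x 0))
  push_cast at h
  rw [listDeg, List.map_take, List.map_ofFn]
  exact h

/-- Pascal's rule for shuffles: the first letter heads the first or the second block. In the second
case it has moved past the `p + 1` letters of the first block, which accounts for the sign. -/
theorem shuffleSum_succ {N p q : ℕ} (h : p + 1 < N + 1) (x : Fin (N + 1) → Y) (F : List Y → M) :
    shuffleSum 𝕜 deg (N + 1) (p + 1) (q + 1) x F =
      shuffleSum 𝕜 deg N p (q + 1) (fun i => x i.succ) (fun l => F (x 0 :: l)) +
      shuffleSum 𝕜 deg N (p + 1) q (fun i => x i.succ) (fun l =>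
        sgn 𝕜 (deg (x 0) * listDeg deg (l.take (p + 1))) •
          F (l.take (p + 1) ++ x 0 :: l.drop (p + 1))) := by
  classical
  have hs : shuffles (N + 1) (p + 1) (q + 1) =
      (shuffles N p (q + 1)).image (insertPerm 0) ∪
        (shuffles N (p + 1) q).image (insertPerm ⟨p + 1, h⟩) := by
    ext σ
    simp only [shuffles, Finset.mem_filter, Finset.mem_univ, true_and, Finset.mem_union,
      Finset.mem_image]
    constructor
    · intro hσ
      obtain ⟨σ', hσ'⟩ := exists_insertPerm σ
      rcases hσ.symm_zero with h0 | h0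
      · rw [show σ.symm 0 = 0 from Fin.ext h0] at hσ'
        exact Or.inl ⟨σ', (isShuffle_insertPerm_zero σ').1 (hσ' ▸ hσ), hσ'.symm⟩
      · rw [show σ.symm 0 = ⟨p + 1, h⟩ from Fin.ext h0] at hσ'
        exact Or.inr ⟨σ', (isShuffle_insertPerm_mid h σ').1 (hσ' ▸ hσ), hσ'.symm⟩
    · rintro (⟨σ', hσ', rfl⟩ | ⟨σ', hσ', rfl⟩)
      · exact (isShuffle_insertPerm_zero σ').2 hσ'
      · exact (isShuffle_insertPerm_mid h σ').2 hσ'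
  have hd : Disjoint ((shuffles N p (q + 1)).image (insertPerm 0))
        ((shuffles N (p + 1) q).image (insertPerm ⟨p + 1, h⟩)) := by
    rw [Finset.disjoint_left]
    simp only [Finset.mem_image, not_exists, not_and]
    rintro _ ⟨σ, -, rfl⟩ σ' - h'
    have h0 : insertPerm 0 σ 0 = 0 := insertPerm_self 0 σ
    have h1 : insertPerm ⟨p + 1, h⟩ σ' ⟨p + 1, h⟩ = 0 := insertPerm_self _ σ'
    rw [h', ← h0] at h1
    have := (insertPerm 0 σ).injective h1
    simp [Fin.ext_iff] at this
  rw [shuffleSum, hs, Finset.sum_union hd,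
    Finset.sum_image (fun _ _ _ _ h => insertPerm_injective _ h),
    Finset.sum_image (fun _ _ _ _ h => insertPerm_injective _ h)]
  congr 1
  · refine Finset.sum_congr rfl fun σ _ => ?_
    rw [koszulSign_insertPerm_sgn, ofFn_insertPerm]
    simp
  · refine Finset.sum_congr rfl fun σ _ => ?_
    rw [koszulSign_insertPerm_sgn, ofFn_insertPerm, mul_smul]

variable (𝕜) in
/-- The signed sum of `F` over all ways to split a word into two complementary subwords. -/
def splitSum : (List Y → List Y → M) → List Y → M
  | F, [] => F [] []
  | F, y :: l => splitSum (fun a b => F (y :: a) b) l +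
      splitSum (fun a b => sgn 𝕜 (deg y * listDeg deg a) • F a (y :: b)) l

/-- A shuffle is a choice of the subword that forms the first block. Summing over all block sizes
removes the boundary cases from the recursion, which leaves `splitSum`. -/
theorem sum_shuffleSum (N : ℕ) (x : Fin N → Y) (F : List Y → List Y → M) :
    ∑ pq ∈ Finset.HasAntidiagonal.antidiagonal N,
      shuffleSum 𝕜 deg N pq.1 pq.2 x (fun l => F (l.take pq.1) (l.drop pq.1)) =
        splitSum 𝕜 deg F (List.ofFn x) := by
  induction N generalizing F with
  | zero => simp [shuffleSum_zero_left, splitSum]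
  | succ N ih =>
    rw [List.ofFn_succ, splitSum, ← ih, ← ih]
    -- `A` and `B` are the two terms of Pascal's rule, set to 0 where the block that should receive
    -- the letter is empty.
    let A : ℕ → ℕ → M := fun p q => match p with
      | 0 => 0
      | p + 1 => shuffleSum 𝕜 deg N p q (fun i => x i.succ)
          (fun l => F (x 0 :: l.take p) (l.drop p))
    let B : ℕ → ℕ → M := fun p q => match q with
      | 0 => 0
      | q + 1 => shuffleSum 𝕜 deg N p q (fun i => x i.succ)
          (fun l => sgn 𝕜 (deg (x 0) * listDeg deg (l.take p)) • F (l.take p) (x 0 :: l.drop p))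
    have h : ∀ pq ∈ Finset.HasAntidiagonal.antidiagonal (N + 1),
        shuffleSum 𝕜 deg (N + 1) pq.1 pq.2 x (fun l => F (l.take pq.1) (l.drop pq.1)) =
          A pq.1 pq.2 + B pq.1 pq.2 := by
      rintro ⟨p, q⟩ hpq
      rw [Finset.HasAntidiagonal.mem_antidiagonal] at hpq
      simp only at hpq ⊢
      rcases p with _ | p
      · obtain rfl : q = N + 1 := by omega
        simp [A, B, shuffleSum_zero_left, List.ofFn_succ]
      · rcases q with _ | q
        · simp [A, B, shuffleSum_zero_right, List.ofFn_succ]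
        · rw [shuffleSum_succ _ (by omega)]
          simp only [A, B]
          congr 1
          refine shuffleSum_congr deg _ fun l hl => ?_
          have h' : (l.take (p + 1)).length = p + 1 := by simp; omega
          rw [List.take_left' h', List.drop_left' h']
    rw [Finset.sum_congr rfl h, Finset.sum_add_distrib]
    congr 1
    · rw [Finset.Nat.sum_antidiagonal_succ]
      simp [A]
    · rw [Finset.Nat.sum_antidiagonal_succ']
      simp [B]

theorem move_to_front {G : List Y → M}
    (hG : ∀ a x y b, G (a ++ x :: y :: b) = sgn 𝕜 (deg x * deg y) • G (a ++ y :: x :: b))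
    (x : Y) (a b : List Y) : G (a ++ x :: b) = sgn 𝕜 (deg x * listDeg deg a) • G (x :: (a ++ b)) := by
  induction a generalizing G with
  | nil => simp
  | cons y a ih =>
    rw [List.cons_append, ih (G := fun t => G (y :: t)) (fun a' => hG (y :: a'))]
    have := hG [] y x (a ++ b)
    simp only [List.nil_append] at this
    rw [this, smul_smul, ← sgn_add]
    congr 2
    simp only [listDeg_cons]; ring

/-- Symmetry under adjacent transpositions suffices: the first letter is moved to the front and the
remaining permutation is treated by induction. -/
theorem apply_ofFn_perm {N : ℕ} {G : List Y → M}
    (hG : ∀ a x y b, G (a ++ x :: y :: b) = sgn 𝕜 (deg x * deg y) • G (a ++ y :: x :: b))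
    (σ : Equiv.Perm (Fin N)) (x : Fin N → Y) :
    G (List.ofFn fun i => x (σ i)) =
      ((koszulSign σ (fun i => deg (x i)) : ℤ) : 𝕜) • G (List.ofFn x) := by
  induction N generalizing G with
  | zero =>
    rw [Subsingleton.elim σ 1]
    simp [koszulSign_one]
  | succ N ih =>
    obtain ⟨σ', hσ'⟩ := exists_insertPerm σ
    rw [hσ', ofFn_insertPerm, move_to_front deg hG, List.take_append_drop,
      ih (G := fun t => G (x 0 :: t)) (fun a' => hG (x 0 :: a')) σ' (fun i => x i.succ),
      koszulSign_insertPerm_sgn, smul_smul, List.ofFn_succ, mul_comm]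

end ShuffleSum

/-! ### Multilinear maps as functionals on lists -/

section ListEval

variable {𝕜 : Type*} [Field 𝕜]
variable {A : Type*} [AddCommGroup A] [Module 𝕜 A] {B : Type*} [AddCommGroup B] [Module 𝕜 B]

/-- A multilinear map as a functional on lists, extended by `0` to lists of the wrong length. -/
def listEval {k : ℕ} : MultilinearMap 𝕜 (fun _ : Fin k => A) B →ₗ[𝕜] (List A → B) where
  toFun f l := if h : l.length = k then f (fun i => l[i]) else 0
  map_add' f f' := by funext l; by_cases h : l.length = k <;> simp [h]
  map_smul' c f := by funext l; by_cases h : l.length = k <;> simp [h]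

theorem listEval_of_length {k : ℕ} (f : MultilinearMap 𝕜 (fun _ : Fin k => A) B) {l : List A}
    (h : l.length = k) : listEval f l = f (fun i => l[i]) := dif_pos h

theorem listEval_eq_zero {k : ℕ} (f : MultilinearMap 𝕜 (fun _ : Fin k => A) B) {l : List A}
    (h : l.length ≠ k) : listEval f l = 0 := dif_neg h

@[simp] theorem listEval_ofFn {k : ℕ} (f : MultilinearMap 𝕜 (fun _ : Fin k => A) B)
    (w : Fin k → A) : listEval f (List.ofFn w) = f w := by
  rw [listEval_of_length f (by simp)]
  simp

theorem exists_ofFn {T : Type*} {k : ℕ} {l : List T} (h : l.length = k) :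
    ∃ w : Fin k → T, l = List.ofFn w := by
  subst h
  exact ⟨fun i => l[i], by simp⟩

theorem listEval_map {k : ℕ} (f : MultilinearMap 𝕜 (fun _ : Fin k => A) B) (φ' : A → A)
    (l : List A) (c : B → B) (hc : c 0 = 0) (h : ∀ w, f (fun i => φ' (w i)) = c (f w)) :
    listEval f (l.map φ') = c (listEval f l) := by
  by_cases hl : l.length = k
  · obtain ⟨w, rfl⟩ := exists_ofFn hl
    rw [List.map_ofFn, listEval_ofFn, listEval_ofFn]
    exact h w
  · rw [listEval_eq_zero f hl, hc, listEval_eq_zero f (by simpa)]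

theorem ofFn_update {T : Type*} {k : ℕ} (w : Fin k → T) (i : Fin k) (v : T) :
    List.ofFn (Function.update w i v) =
      (List.ofFn w).take i ++ v :: (List.ofFn w).drop (i + 1) := by
  have h : i.1 < (List.ofFn w).length := by simp
  have hs := List.set_eq_take_append_cons_drop (l := List.ofFn w) (i := i.1) (a := v)
  rw [if_pos h] at hs
  rw [← hs]
  apply List.ext_getElem
  · simp
  · intro j h1 h2
    simp only [List.getElem_ofFn, List.getElem_set]
    by_cases h : i.1 = j
    · subst h; simp
    · rw [if_neg h, Function.update_of_ne (by rw [Ne, Fin.ext_iff]; exact Ne.symm h)]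

theorem append_cons_eq_ofFn_update {T : Type*} {k : ℕ} {a b : List T} {x : T}
    (h : (a ++ x :: b).length = k) :
    ∃ (w : Fin k → T) (i : Fin k), ∀ y, a ++ y :: b = List.ofFn (Function.update w i y) := by
  obtain ⟨w, hw⟩ := exists_ofFn h
  have hi : a.length < k := by rw [← h]; simp
  refine ⟨w, ⟨a.length, hi⟩, fun y => ?_⟩
  rw [ofFn_update, ← hw]
  simp

theorem listEval_additive {k : ℕ} (f : MultilinearMap 𝕜 (fun _ : Fin k => A) B) :
    ListAdditive (listEval f) := by
  intro a x y b
  by_cases h : (a ++ x :: b).length = k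
  · obtain ⟨w, i, hw⟩ := append_cons_eq_ofFn_update h
    simp only [hw, listEval_ofFn, MultilinearMap.map_update_add]
  · have : ∀ z, listEval f (a ++ z :: b) = 0 := fun z => listEval_eq_zero f (by simpa using h)
    simp [this]

theorem listEval_homogeneous {k : ℕ} (f : MultilinearMap 𝕜 (fun _ : Fin k => A) B) (a : List A)
    (c : 𝕜) (x : A) (b : List A) : listEval f (a ++ (c • x) :: b) = c • listEval f (a ++ x :: b) := by
  by_cases h : (a ++ x :: b).length = k
  · obtain ⟨w, i, hw⟩ := append_cons_eq_ofFn_update h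
    simp only [hw, listEval_ofFn, MultilinearMap.map_update_smul]
  · have : ∀ z, listEval f (a ++ z :: b) = 0 := fun z => listEval_eq_zero f (by simpa using h)
    simp [this]

end ListEval

/-! ### The product ⋄ as a recursive insertion. -/

section Diamond

variable {𝕜 : Type*} [Field 𝕜] {H : Type*} [AddCommGroup H] [Module 𝕜 H]

theorem insertion_smul_right (τ : H → H) (k : ℕ) (Q : List H → H) (c : 𝕜) {P : List H → H}
    (hP : ∀ a x b, P (a ++ (c • x) :: b) = c • P (a ++ x :: b)) (l : List H) :
    insertion 𝕜 τ k (fun t => c • Q t) P l = c • insertion 𝕜 τ k Q P l := by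
  induction l generalizing k Q P with
  | nil =>
    cases k with
    | zero => simp only [insertion_zero]; exact hP [] _ _
    | succ k => simp
  | cons x l ih =>
    cases k with
    | zero => simp only [insertion_zero]; exact hP [] _ _
    | succ k =>
      rw [insertion_cons, insertion_cons, ih _ _ hP, ih _ _ (fun a => hP (τ x :: a)), smul_add,
        smul_comm c]

theorem shuffleSum_smul {Y M : Type*} [AddCommGroup M] [Module 𝕜 M] (deg : Y → ℤ) {N p q : ℕ}
    (x : Fin N → Y) (c : 𝕜) (F : List Y → M) :
    shuffleSum 𝕜 deg N p q x (fun l => c • F l) = c • shuffleSum 𝕜 deg N p q x F := by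
  simp only [shuffleSum, Finset.smul_sum, smul_comm c]

/-- The word obtained from `L` by applying `Q` to `n + 1` letters starting at position `i`. -/
def insertWord {H : Type*} (τ : H → H) (Q : List H → H) (n i : ℕ) (L : List H) : List H :=
  (L.take i).map τ ++ Q ((L.drop i).take (n + 1)) :: (L.drop (i + n + 1)).map τ

theorem insertWord_cons {H : Type*} (τ : H → H) (Q : List H → H) (n i : ℕ) (x : H) (L : List H) :
    insertWord τ Q n (i + 1) (x :: L) = τ x :: insertWord τ Q n i L := by
  simp [insertWord, show i + 1 + n + 1 = (i + n + 1) + 1 by ring]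

theorem insertWord_mid {H : Type*} (τ : H → H) (Q : List H → H) (n i : ℕ) (x : H) (L : List H)
    (h : i ≤ L.length) :
    insertWord τ Q (n + 1) i (L.take i ++ x :: L.drop i) =
      insertWord τ (fun t => Q (x :: t)) n i L := by
  have h' : (L.take i).length = i := by simpa using h
  unfold insertWord
  rw [List.take_left' h', List.drop_left' h', show i + (n + 1) + 1 = i + (n + 1 + 1) by ring,
    ← List.drop_drop, List.drop_left' h', List.take_succ_cons, List.drop_succ_cons,
    List.drop_drop, ← add_assoc]

/-- Every shuffle sum is split by the block of the first letter. The letter is then the first entry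
of the outer or of the inner functional, which are the two terms of the recursion for `insertion`.
-/
theorem sum_shuffleSum_insertWord (τ : H → H) (N m n : ℕ) (hN : N = m + n + 1) (x : Fin N → H)
    (P Q : List H → H) :
    ∑ i ∈ Finset.range (m + 1), shuffleSum 𝕜 (fun _ => 1) N i n x
      (fun L => (-1 : 𝕜) ^ (i * n) • P (insertWord τ Q n i L)) =
        insertion 𝕜 τ (n + 1) Q P (List.ofFn x) := by
  induction N generalizing m n P Q with
  | zero => omega
  | succ N ih =>
    rw [List.ofFn_succ, insertion_cons, Finset.sum_range_succ']
    rcases n with _ | n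
    · simp only [shuffleSum_zero_right, mul_zero, pow_zero, one_smul, List.ofFn_succ,
        insertWord_cons, insertion_zero]
      congr 1
      rcases m with _ | m
      · obtain rfl : N = 0 := by omega
        simp
      · rw [← ih m 0 (by omega) (fun i => x i.succ) (fun t => P (τ (x 0) :: t)) Q]
        simp [shuffleSum_zero_right]
    · have h1 : ∀ i ∈ Finset.range m, shuffleSum 𝕜 (fun _ => 1) (N + 1) (i + 1) (n + 1) x
          (fun L => (-1 : 𝕜) ^ ((i + 1) * (n + 1)) • P (insertWord τ Q (n + 1) (i + 1) L)) =
          (-1 : 𝕜) ^ (n + 1) • shuffleSum 𝕜 (fun _ => 1) N i (n + 1) (fun i => x i.succ)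
            (fun L => (-1 : 𝕜) ^ (i * (n + 1)) • P (τ (x 0) :: insertWord τ Q (n + 1) i L)) +
          shuffleSum 𝕜 (fun _ => 1) N (i + 1) n (fun i => x i.succ)
            (fun L => (-1 : 𝕜) ^ ((i + 1) * n) •
              P (insertWord τ (fun t => Q (x 0 :: t)) n (i + 1) L)) := by
        intro i hi
        rw [Finset.mem_range] at hi
        rw [shuffleSum_succ _ (by omega), ← shuffleSum_smul]
        congr 1
        · refine shuffleSum_congr _ _ fun l _ => ?_
          rw [insertWord_cons, smul_smul, ← pow_add]
          congr 2
          ring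
        · refine shuffleSum_congr _ _ fun l hl => ?_
          rw [insertWord_mid _ _ _ _ _ _ (by omega)]
          have hd : listDeg (fun _ : H => (1 : ℤ)) (l.take (i + 1)) = ((i + 1 : ℕ) : ℤ) := by
            simp [listDeg, hl]
            omega
          -- Moving the letter past `i + 1` letters of degree 1 changes the exponent (i+1)(n+1) into
          -- (i+1)n modulo 2, the one that belongs to an inner functional with one variable less.
          rw [hd, one_mul, sgn_natCast, smul_smul, ← pow_add, show i + 1 + (i + 1) * (n + 1) =
            (i + 1) * n + 2 * (i + 1) by ring, pow_add, pow_mul]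
          simp
      rw [Finset.sum_congr rfl h1, Finset.sum_add_distrib, ← Finset.smul_sum, add_assoc]
      congr 1
      · congr 1
        rcases m with _ | m
        · rw [insertion_eq_zero_of_length_lt _ _ _ _ _ (by simp; omega)]
          simp
        · rw [← ih m (n + 1) (by omega) (fun i => x i.succ) (fun t => P (τ (x 0) :: t)) Q]
      · rw [← ih m n (by omega) (fun i => x i.succ) P, Finset.sum_range_succ']
        congr 1
        rw [shuffleSum_zero_left, shuffleSum_zero_left, List.ofFn_succ]
        simp only [zero_mul, pow_zero, one_smul]
        exact congrArg P (insertWord_mid τ Q n 0 (x 0) _ (by simp))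

theorem ofFn_insArgs (γ : H →ₗ[𝕜] H) {m n : ℕ} (Q : MultilinearMap 𝕜 (fun _ : Fin (n + 1) => H) H)
    (i : Fin (m + 1)) (x : Fin (m + n + 1) → H) :
    List.ofFn (insArgs γ Q i x) = insertWord (γ ^ n : H →ₗ[𝕜] H) (listEval Q) n i (List.ofFn x) := by
  unfold insertWord
  apply List.ext_getElem
  · simp; omega
  · intro t h1 h2
    simp only [List.length_ofFn] at h1
    rw [List.getElem_ofFn]
    unfold insArgs
    split_ifs with c1 c2
    · rw [Fin.lt_def] at c1
      rw [List.getElem_append_left (by simp at c1 ⊢; omega)]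
      simp only [List.getElem_map, List.getElem_take, List.getElem_ofFn]
    · have c2' : t = i.1 := congrArg Fin.val c2
      subst c2'
      rw [List.getElem_append_right (by simp)]
      simp only [List.length_map, List.length_take, List.length_ofFn]
      rw [List.getElem_cons, dif_pos (by omega), listEval_of_length]
      · simp only [Fin.getElem_fin, List.getElem_take, List.getElem_drop, List.getElem_ofFn]
      · simp; omega
    · rw [Fin.lt_def] at c1
      rw [Fin.ext_iff] at c2
      simp only at c1 c2
      rw [List.getElem_append_right (by simp; omega)]
      rw [List.getElem_cons, dif_neg (by simp; omega)]
      simp only [List.getElem_map, List.getElem_drop, List.getElem_ofFn, List.length_map,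
        List.length_take, List.length_ofFn]
      congr 3
      omega

theorem listEval_diamond (γ : H →ₗ[𝕜] H) {m n : ℕ}
    (P : MultilinearMap 𝕜 (fun _ : Fin (m + 1) => H) H)
    (Q : MultilinearMap 𝕜 (fun _ : Fin (n + 1) => H) H) :
    listEval (diamond γ P Q) =
      insertion 𝕜 (γ ^ n : H →ₗ[𝕜] H) (n + 1) (listEval Q) (listEval P) := by
  funext l
  by_cases hl : l.length = m + n + 1
  · obtain ⟨x, rfl⟩ := exists_ofFn hl
    rw [listEval_ofFn, diamond_apply, ← sum_shuffleSum_insertWord _ (m + n + 1) m n rfl,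
      ← Fin.sum_univ_eq_sum_range (fun i => shuffleSum 𝕜 (fun _ => 1) (m + n + 1) i n x
      (fun L => (-1 : 𝕜) ^ (i * n) • listEval P (insertWord (γ ^ n : H →ₗ[𝕜] H) (listEval Q) n i L)))]
    refine Finset.sum_congr rfl fun i _ => Finset.sum_congr rfl fun σ _ => ?_
    have h := ofFn_insArgs γ Q i (fun t => x (σ t))
    simp only [koszulSign_one_degree, ← h, listEval_ofFn, smul_smul]
    rw [mul_comm]
  · rw [listEval_eq_zero _ hl, insertion_eq_zero_of_arity _ _ _ _ _ (d := m)
      (fun t ht => listEval_eq_zero _ ht) (by omega)]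

end Diamond

/-! ### Balavoine's bracket as a graded Lie bracket -/

section BalavoineLie

variable {𝕜 : Type*} [Field 𝕜] {H : Type*} [AddCommGroup H] [Module 𝕜 H] {γ : H →ₗ[𝕜] H}

variable (γ) in
/-- A homogeneous cochain as an element of the direct sum. -/
abbrev inDegree (n : ℕ) : CochainSpace γ n →ₗ[𝕜] BalavoineSpace γ :=
  DirectSum.lof 𝕜 ℕ (fun k => CochainSpace γ k) n

theorem inDegree_apply_self (n : ℕ) (f : CochainSpace γ n) : inDegree γ n f n = f :=
  DirectSum.lof_apply 𝕜 n f

theorem inDegree_apply_ne {n k : ℕ} (h : n ≠ k) (f : CochainSpace γ n) : inDegree γ n f k = 0 :=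
  DirectSum.of_eq_of_ne n k f (Ne.symm h)

theorem cochain_induction {p : BalavoineSpace γ → Prop} (x : BalavoineSpace γ) (h0 : p 0)
    (h : ∀ n f, p (inDegree γ n f)) (hadd : ∀ x y, p x → p y → p (x + y)) : p x := by
  induction x using DirectSum.induction_on with
  | zero => exact h0
  | of n f => exact h n f
  | add x y hx hy => exact hadd x y hx hy

theorem mem_of_components {N : Submodule 𝕜 (BalavoineSpace γ)} {x : BalavoineSpace γ}
    (h : ∀ n, inDegree γ n (x n) ∈ N) : x ∈ N := by
  classical
  rw [← DirectSum.sum_support_of x]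
  exact Submodule.sum_mem _ fun n _ => h n

theorem bracket_mem_of_components {N : Submodule 𝕜 (BalavoineSpace γ)} {x y : BalavoineSpace γ}
    (h : ∀ m n, balavoineBracket γ (inDegree γ m (x m)) (inDegree γ n (y n)) ∈ N) :
    balavoineBracket γ x y ∈ N := by
  have h1 : x ∈ N.comap ((balavoineBracket γ).flip y) := by
    refine mem_of_components fun m => ?_
    have h2 : y ∈ N.comap (balavoineBracket γ (inDegree γ m (x m))) := mem_of_components (h m)
    exact h2
  exact h1

/-- An element of the direct sum as a functional on lists. -/
def spaceEval : BalavoineSpace γ →ₗ[𝕜] (List H → H) :=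
  DirectSum.toModule 𝕜 ℕ _ fun _ => listEval ∘ₗ CochainSpace.toMap

theorem spaceEval_inDegree (n : ℕ) (f : CochainSpace γ n) :
    spaceEval (inDegree γ n f) = listEval f.toMap := by
  simp [spaceEval]

theorem spaceEval_ofFn (x : BalavoineSpace γ) (n : ℕ) (w : Fin (n + 1) → H) :
    spaceEval x (List.ofFn w) = (x n).toMap w := by
  induction x using cochain_induction with
  | h0 => simp
  | h k f =>
    rw [spaceEval_inDegree]
    by_cases hk : k = n
    · subst hk
      rw [listEval_ofFn, inDegree_apply_self]
    · rw [inDegree_apply_ne hk, listEval_eq_zero _ (by simpa using Ne.symm hk)]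
      simp
  | hadd x y hx hy =>
    rw [map_add, Pi.add_apply, hx, hy, DirectSum.add_apply, map_add, add_apply]

theorem spaceEval_injective {x y : BalavoineSpace γ} (h : ∀ l, spaceEval x l = spaceEval y l) :
    x = y := by
  refine DFinsupp.ext fun n => CochainSpace.ext fun w => ?_
  rw [← spaceEval_ofFn, ← spaceEval_ofFn, h]

theorem bracket_inDegree (m n : ℕ) (P : CochainSpace γ m) (Q : CochainSpace γ n) :
    balavoineBracket γ (inDegree γ m P) (inDegree γ n Q) =
      inDegree γ (m + n) (diamondHom γ m n P Q) -
        (-1 : 𝕜) ^ (m * n) • inDegree γ (n + m) (diamondHom γ n m Q P) := by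
  simp [balavoineBracket, homogeneousBracket]

theorem listEval_diamondHom (m n : ℕ) (P : CochainSpace γ m) (Q : CochainSpace γ n) :
    listEval (diamondHom γ m n P Q).toMap =
      insertion 𝕜 (γ ^ n : H →ₗ[𝕜] H) (n + 1) (listEval Q.toMap) (listEval P.toMap) :=
  listEval_diamond γ P.toMap Q.toMap

theorem listEval_map_pow (n k : ℕ) (Q : CochainSpace γ n) (l : List H) :
    listEval Q.toMap (l.map (γ ^ k : H →ₗ[𝕜] H)) = (γ ^ k : H →ₗ[𝕜] H) (listEval Q.toMap l) := by
  refine listEval_map _ _ _ _ (map_zero _) fun w => ?_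
  induction k with
  | zero => simp
  | succ k ih =>
    simp only [pow_succ', Module.End.mul_apply, ← ih]
    exact (Q.toMap_mem _).symm

/-- Equivariance of `Q` and `R` supplies the intertwining hypotheses with both primed functionals
equal to the original ones. The arities n+1 and k+1 give the exponent (n+2)(k+2), which has the
parity of nk. -/
theorem diamondHom_associator (m n k : ℕ) (P : CochainSpace γ m) (Q : CochainSpace γ n)
    (R : CochainSpace γ k) (l : List H) :
    listEval (diamondHom γ _ _ (diamondHom γ _ _ P Q) R).toMap l -
        listEval (diamondHom γ _ _ P (diamondHom γ _ _ Q R)).toMap l =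
      (-1 : 𝕜) ^ (n * k) • (listEval (diamondHom γ _ _ (diamondHom γ _ _ P R) Q).toMap l -
        listEval (diamondHom γ _ _ P (diamondHom γ _ _ R Q)).toMap l) := by
  have h := insertion_insertion_symm (𝕜 := 𝕜) (γ ^ n : H →ₗ[𝕜] H) (γ ^ k : H →ₗ[𝕜] H)
    (fun x => by rw [← Module.End.mul_apply, ← Module.End.mul_apply, ← pow_add, ← pow_add, add_comm])
    (n + 1) (k + 1) (by omega) (listEval_additive P.toMap) (listEval_additive Q.toMap)
    (listEval_additive R.toMap) (listEval_map_pow n k Q) (listEval_map_pow k n R) l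
  have e1 : (fun x => (γ ^ n : H →ₗ[𝕜] H) ((γ ^ k : H →ₗ[𝕜] H) x)) = (γ ^ (n + k) : H →ₗ[𝕜] H) := by
    funext x; rw [pow_add, Module.End.mul_apply]
  have e2 : (-1 : 𝕜) ^ ((n + 1 + 1) * (k + 1 + 1)) = (-1) ^ (n * k) := by
    rw [show (n + 1 + 1) * (k + 1 + 1) = n * k + 2 * (n + k + 2) by ring, pow_add, pow_mul (-1) 2]
    simp
  rw [e1, e2, show n + 1 + (k + 1) - 1 = n + k + 1 by omega] at h
  simp only [listEval_diamondHom]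
  rw [add_comm k n]
  exact h

theorem mem_homogeneousPart_cases {i : ℤ} {x : BalavoineSpace γ} (hx : x ∈ homogeneousPart γ i) :
    x = 0 ∨ ∃ (n : ℕ) (f : CochainSpace γ n), (n : ℤ) = i ∧ x = inDegree γ n f := by
  by_cases h : ∃ n : ℕ, (n : ℤ) = i
  · obtain ⟨n, rfl⟩ := h
    refine Or.inr ⟨n, x n, rfl, DFinsupp.ext fun k => ?_⟩
    by_cases hk : n = k
    · subst hk
      exact (inDegree_apply_self _ _).symm
    · exact (hx k (by exact_mod_cast Ne.symm hk)).trans (inDegree_apply_ne hk _).symm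
  · push Not at h
    exact Or.inl (DFinsupp.ext fun k => hx k (h k))

theorem inDegree_mem (n : ℕ) (f : CochainSpace γ n) : inDegree γ n f ∈ homogeneousPart γ n := by
  intro k hk
  exact inDegree_apply_ne (by exact_mod_cast Ne.symm hk) f

theorem bracket_mem {i j : ℤ} {x y : BalavoineSpace γ} (hx : x ∈ homogeneousPart γ i)
    (hy : y ∈ homogeneousPart γ j) : balavoineBracket γ x y ∈ homogeneousPart γ (i + j) := by
  rcases mem_homogeneousPart_cases hx with rfl | ⟨m, f, rfl, rfl⟩
  · simp
  rcases mem_homogeneousPart_cases hy with rfl | ⟨n, f', rfl, rfl⟩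
  · simp
  rw [bracket_inDegree]
  refine sub_mem ?_ (Submodule.smul_mem _ _ ?_)
  · exact_mod_cast inDegree_mem _ _
  · rw [add_comm]
    exact_mod_cast inDegree_mem _ _

theorem bracket_skew {i j : ℤ} {x y : BalavoineSpace γ} (hx : x ∈ homogeneousPart γ i)
    (hy : y ∈ homogeneousPart γ j) :
    balavoineBracket γ x y = -(sgn 𝕜 (i * j) • balavoineBracket γ y x) := by
  rcases mem_homogeneousPart_cases hx with rfl | ⟨m, f, rfl, rfl⟩
  · simp
  rcases mem_homogeneousPart_cases hy with rfl | ⟨n, f', rfl, rfl⟩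
  · simp
  rw [bracket_inDegree, bracket_inDegree, ← Nat.cast_mul, sgn_natCast, smul_sub, smul_smul,
    mul_comm n m, ← mul_pow]
  simp

/-- As for the commutator of a pre-Lie product, the twelve double products are a combination of
three associator identities, one for each choice of the outer map. Fixing the parities of the
degrees makes all signs constants. -/
theorem bracket_jacobi {i j k : ℤ} {x y z : BalavoineSpace γ} (hx : x ∈ homogeneousPart γ i)
    (hy : y ∈ homogeneousPart γ j) (hz : z ∈ homogeneousPart γ k) :
    balavoineBracket γ (balavoineBracket γ x y) z =
      balavoineBracket γ x (balavoineBracket γ y z) +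
        sgn 𝕜 (j * k) • balavoineBracket γ (balavoineBracket γ x z) y := by
  rcases mem_homogeneousPart_cases hx with rfl | ⟨m, P, rfl, rfl⟩
  · simp
  rcases mem_homogeneousPart_cases hy with rfl | ⟨n, Q, rfl, rfl⟩
  · simp
  rcases mem_homogeneousPart_cases hz with rfl | ⟨k, R, rfl, rfl⟩
  · simp
  apply spaceEval_injective
  intro l
  have h1 := diamondHom_associator m n k P Q R l
  have h2 := diamondHom_associator n m k Q P R l
  have h3 := diamondHom_associator k m n R P Q l
  simp only [bracket_inDegree, map_sub, map_smul, LinearMap.sub_apply, LinearMap.smul_apply,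
    map_add, spaceEval_inDegree, Pi.sub_apply, Pi.add_apply, Pi.smul_apply, ← Nat.cast_mul,
    sgn_natCast]
  rcases neg_one_pow_eq_or 𝕜 m with hm | hm <;> rcases neg_one_pow_eq_or 𝕜 n with hn | hn <;>
  rcases neg_one_pow_eq_or 𝕜 k with hk | hk <;>
  simp only [pow_mul, pow_add, add_mul, mul_add, hm, hn, hk, one_pow, one_smul, neg_smul,
    mul_one, mul_neg, neg_neg] at h1 h2 h3 ⊢
  · linear_combination (norm := module) h1 - h2 + h3
  · linear_combination (norm := module) h1 - h2 + h3
  · linear_combination (norm := module) h1 - h2 + h3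
  · linear_combination (norm := module) h1 - h2 - h3
  · linear_combination (norm := module) h1 - h2 + h3
  · linear_combination (norm := module) h1 - h2 - h3
  · linear_combination (norm := module) h1 + h2 + h3
  · linear_combination (norm := module) h1 + h2 + h3

end BalavoineLie

/-! ### The projection onto `a` and the weights of `q` and `a` -/

section Projection

variable {𝕜 : Type*} [Field 𝕜]
variable {g : Type*} [AddCommGroup g] [Module 𝕜 g] {V : Type*} [AddCommGroup V] [Module 𝕜 V]
variable {α : g →ₗ[𝕜] g} {β : V →ₗ[𝕜] V}

variable (𝕜 g V) in
/-- The projection of `g ⊕ V` onto `g`. -/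
def projG : g × V →ₗ[𝕜] g × V := LinearMap.inl 𝕜 g V ∘ₗ LinearMap.fst 𝕜 g V

variable (𝕜 g V) in
/-- The projection of `g ⊕ V` onto `V`. -/
def projV : g × V →ₗ[𝕜] g × V := LinearMap.inr 𝕜 g V ∘ₗ LinearMap.snd 𝕜 g V

@[simp] theorem projG_apply (x : g × V) : projG 𝕜 g V x = (x.1, 0) := rfl

@[simp] theorem projV_apply (x : g × V) : projV 𝕜 g V x = (0, x.2) := rfl

theorem pow_projG (n : ℕ) (x : g × V) :
    ((α.prodMap β) ^ n) (projG 𝕜 g V x) = projG 𝕜 g V (((α.prodMap β) ^ n) x) := by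
  induction n generalizing x with
  | zero => simp
  | succ n ih => rw [pow_succ, Module.End.mul_apply, Module.End.mul_apply, ← ih]; simp

theorem pow_projV (n : ℕ) (x : g × V) :
    ((α.prodMap β) ^ n) (projV 𝕜 g V x) = projV 𝕜 g V (((α.prodMap β) ^ n) x) := by
  induction n generalizing x with
  | zero => simp
  | succ n ih => rw [pow_succ, Module.End.mul_apply, Module.End.mul_apply, ← ih]; simp

theorem projA_inDegree (n : ℕ) (f : CochainSpace (α.prodMap β) n) :
    projA α β (inDegree _ n f) = inDegree _ n (projPart α β n f) :=
  DirectSum.lmap_lof _ n f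

theorem projA_apply (x : LSpace α β) (n : ℕ) : projA α β x n = projPart α β n (x n) := by
  simp [projA, DirectSum.lmap_apply]

theorem projPart_toMap (n : ℕ) (f : CochainSpace (α.prodMap β) n) (w : Fin (n + 1) → g × V) :
    (projPart α β n f).toMap w = projG 𝕜 g V (f.toMap fun i => projV 𝕜 g V (w i)) := rfl

theorem listEval_projPart (n : ℕ) (f : CochainSpace (α.prodMap β) n) (l : List (g × V)) :
    listEval (projPart α β n f).toMap l =
      projG 𝕜 g V (listEval f.toMap (l.map (projV 𝕜 g V))) := by
  by_cases h : l.length = n + 1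
  · obtain ⟨w, rfl⟩ := exists_ofFn h
    rw [List.map_ofFn, listEval_ofFn, listEval_ofFn]
    rfl
  · rw [listEval_eq_zero _ h, listEval_eq_zero _ (by simpa using h), map_zero]

/-- All inputs are in V and the output is taken in 𝔤. The inserted value splits into its two
components: its V-part leaves `P` with inputs in V only, so `P` may be projected; its 𝔤-part is the
projection of `Q`. -/
theorem projPart_diamondHom (m n : ℕ) (P : CochainSpace (α.prodMap β) m)
    (Q : CochainSpace (α.prodMap β) n) (l : List (g × V)) :
    listEval (projPart α β _ (diamondHom _ m n P Q)).toMap l =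
      listEval (projPart α β _ (diamondHom _ m n (projPart α β m P) Q)).toMap l +
        listEval (projPart α β _ (diamondHom _ m n P (projPart α β n Q))).toMap l := by
  have hQ : (fun t : List (g × V) => listEval Q.toMap (t.map (projV 𝕜 g V))) = fun t =>
      projG 𝕜 g V (listEval Q.toMap (t.map (projV 𝕜 g V))) +
        projV 𝕜 g V (listEval Q.toMap (t.map (projV 𝕜 g V))) := by
    funext t; simp
  have hP : ListAdditive fun t => projG 𝕜 g V (listEval P.toMap t) := by
    intro a x y b
    simp only [listEval_additive P.toMap a x y b, map_add]
  simp only [listEval_projPart, listEval_diamondHom, map_insertion, insertion_map]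
  conv_lhs => rw [hQ, insertion_add_right _ _ _ _ hP, add_comm]
  congr 1
  · have hi : ∀ x : g × V, projG 𝕜 g V (projG 𝕜 g V x) = projG 𝕜 g V x := fun x => rfl
    simp only [hi]
    rw [insertion_comp_map_left _ (projV 𝕜 g V) _ _ (fun t => projG 𝕜 g V (listEval P.toMap t))]
    simp only [pow_projV]
    rfl
  · simp only [List.map_map]
    rfl

theorem projA_bracket (x y : LSpace α β) :
    projA α β (balavoineBracket _ x y) =
      projA α β (balavoineBracket _ (projA α β x) y) +
        projA α β (balavoineBracket _ x (projA α β y)) := by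
  induction x using cochain_induction with
  | h0 => simp
  | hadd x x' hx hx' => simp only [map_add, LinearMap.add_apply, hx, hx']; abel
  | h m f =>
    induction y using cochain_induction with
    | h0 => simp
    | hadd y y' hy hy' => simp only [map_add, hy, hy']; abel
    | h n f' =>
      apply spaceEval_injective
      intro l
      simp only [bracket_inDegree, projA_inDegree, map_sub, map_smul, map_add, spaceEval_inDegree,
        Pi.sub_apply, Pi.smul_apply, Pi.add_apply]
      rw [projPart_diamondHom m n, projPart_diamondHom n m]
      module

/-- Maps from powers of V to 𝔤 cannot be composed: the value of the inner one has no V-component. -/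
theorem projA_bracket_projA (x y : LSpace α β) :
    balavoineBracket _ (projA α β x) (projA α β y) = 0 := by
  have key : ∀ (m n : ℕ) (P : CochainSpace (α.prodMap β) m) (Q : CochainSpace (α.prodMap β) n)
      (l : List (g × V)),
      listEval (diamondHom _ m n (projPart α β m P) (projPart α β n Q)).toMap l = 0 := by
    intro m n P Q l
    have e1 : listEval (projPart α β m P).toMap =
        fun l => (fun t => projG 𝕜 g V (listEval P.toMap t)) (l.map (projV 𝕜 g V)) :=
      funext (listEval_projPart m P)
    have e2 : listEval (projPart α β n Q).toMap =
        fun l => projG 𝕜 g V (listEval Q.toMap (l.map (projV 𝕜 g V))) :=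
      funext (listEval_projPart n Q)
    have h0 : ∀ x : g × V, projV 𝕜 g V (projG 𝕜 g V x) = 0 := fun x => rfl
    have hP : ListAdditive fun t => projG 𝕜 g V (listEval P.toMap t) := by
      intro a x y b
      simp only [listEval_additive P.toMap a x y b, map_add]
    rw [listEval_diamondHom, e1, insertion_comp_map_left _ (projV 𝕜 g V) _ _
      (fun t => projG 𝕜 g V (listEval P.toMap t)), e2]
    simp only [h0]
    exact insertion_zero_right _ _ hP _
  induction x using cochain_induction with
  | h0 => simp
  | hadd x x' hx hx' => simp only [map_add, LinearMap.add_apply, hx, hx', add_zero]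
  | h m f =>
    induction y using cochain_induction with
    | h0 => simp
    | hadd y y' hy hy' => simp only [map_add, hy, hy', add_zero]
    | h n f' =>
      apply spaceEval_injective
      intro l
      simp only [bracket_inDegree, projA_inDegree, map_sub, map_smul, spaceEval_inDegree,
        Pi.sub_apply, Pi.smul_apply, key]
      simp

theorem mem_qSpace {x : LSpace α β} : x ∈ qSpace α β ↔ ∀ n, x n ∈ qPart α β n := by
  simp only [qSpace, Submodule.mem_iInf, Submodule.mem_comap]
  rfl

theorem mem_aSpace {x : LSpace α β} : x ∈ aSpace α β ↔ ∀ n, x n ∈ aPart α β n := by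
  simp only [aSpace, Submodule.mem_iInf, Submodule.mem_comap]
  rfl

theorem projPart_mem (n : ℕ) (f : CochainSpace (α.prodMap β) n) :
    projPart α β n f ∈ aPart α β n := by
  refine ⟨(LinearMap.fst 𝕜 g V).compMultilinearMap
    (f.toMap.compLinearMap fun _ => LinearMap.inr 𝕜 g V), ?_, fun w => rfl⟩
  intro x
  have h := congrArg Prod.fst (f.toMap_mem fun i => ((0 : g), x i))
  simp only [LinearMap.prodMap_apply, map_zero] at h
  exact h

theorem projA_mem (x : LSpace α β) : projA α β x ∈ aSpace α β :=
  mem_aSpace.2 fun n => by rw [projA_apply]; exact projPart_mem n _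

theorem projPart_of_mem {n : ℕ} {f : CochainSpace (α.prodMap β) n} (hf : f ∈ aPart α β n) :
    projPart α β n f = f := by
  obtain ⟨T, -, h⟩ := hf
  apply CochainSpace.ext
  intro w
  rw [projPart_toMap, h, h]
  rfl

theorem projA_of_mem {x : LSpace α β} (hx : x ∈ aSpace α β) : projA α β x = x :=
  DFinsupp.ext fun n => by
    have := projA_apply x n
    rw [projPart_of_mem (mem_aSpace.1 hx n)] at this
    exact this

theorem bracket_aSpace {x y : LSpace α β} (hx : x ∈ aSpace α β) (hy : y ∈ aSpace α β) :
    balavoineBracket _ x y = 0 := by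
  rw [← projA_of_mem hx, ← projA_of_mem hy, projA_bracket_projA]

theorem projA_homogeneous {i : ℤ} {x : LSpace α β} (hx : x ∈ homogeneousPart _ i) :
    projA α β x ∈ homogeneousPart _ i := by
  intro n hn
  rw [projA_apply, hx n hn, map_zero]

theorem projPart_qPart {n : ℕ} {f : CochainSpace (α.prodMap β) n} (hf : f ∈ qPart α β n) :
    projPart α β n f = 0 := by
  obtain ⟨f₁, f₂, -, -, h⟩ := hf
  apply CochainSpace.ext
  intro w
  rw [projPart_toMap, h]
  have h0 : f₁ (fun i => (projV 𝕜 g V (w i)).1) = 0 :=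
    f₁.map_coord_zero (i := 0) rfl
  simp only [h0, projG_apply]
  rfl

theorem projA_qSpace {x : LSpace α β} (hx : x ∈ qSpace α β) : projA α β x = 0 :=
  DFinsupp.ext fun n => by
    have := projA_apply x n
    rw [projPart_qPart (mem_qSpace.1 hx n)] at this
    exact this

variable (𝕜) in
/-- The automorphism of `g ⊕ V` that doubles the first component. -/
def doubling (x : g × V) : g × V := ((2 : 𝕜) • x.1, x.2)

/-- The cochains on which conjugation with the doubling automorphism acts as `2^w`: those for which
the number of inputs in `g` exceeds the number of outputs in `g` by `w`. -/
def weightPart (α : g →ₗ[𝕜] g) (β : V →ₗ[𝕜] V) (w : ℤ) : Submodule 𝕜 (LSpace α β) where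
  carrier := {x | ∀ n v, (x n).toMap (fun i => doubling 𝕜 (v i)) =
    (2 : 𝕜) ^ w • doubling 𝕜 ((x n).toMap v)}
  zero_mem' n v := by simp [doubling]; rfl
  add_mem' {x y} hx hy n v := by
    rw [DirectSum.add_apply, map_add, _root_.add_apply, _root_.add_apply, hx n, hy n,
      ← smul_add]
    simp [doubling]
  smul_mem' c x hx n v := by
    rw [DirectSum.smul_apply, map_smul, _root_.smul_apply, _root_.smul_apply, hx n,
      smul_comm]
    congr 1
    simp [doubling, smul_comm c]

theorem inDegree_mem_weightPart {n : ℕ} {f : CochainSpace (α.prodMap β) n} {w : ℤ}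
    (h : ∀ v, f.toMap (fun i => doubling 𝕜 (v i)) = (2 : 𝕜) ^ w • doubling 𝕜 (f.toMap v)) :
    inDegree _ n f ∈ weightPart α β w := by
  intro k v
  by_cases hk : n = k
  · subst hk
    rw [inDegree_apply_self]
    exact h v
  · rw [inDegree_apply_ne hk]
    simp [doubling]
    rfl

theorem listEval_doubling {n : ℕ} {f : CochainSpace (α.prodMap β) n} {w : ℤ}
    (h : ∀ v, f.toMap (fun i => doubling 𝕜 (v i)) = (2 : 𝕜) ^ w • doubling 𝕜 (f.toMap v))
    (l : List (g × V)) :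
    listEval f.toMap (l.map (doubling 𝕜)) = (2 : 𝕜) ^ w • doubling 𝕜 (listEval f.toMap l) :=
  listEval_map f.toMap (doubling 𝕜) l (fun y => (2 : 𝕜) ^ w • doubling 𝕜 y) (by simp [doubling]) h

theorem pow_doubling (n : ℕ) (x : g × V) :
    ((α.prodMap β) ^ n) (doubling 𝕜 x) = doubling 𝕜 (((α.prodMap β) ^ n) x) := by
  induction n generalizing x with
  | zero => simp
  | succ n ih =>
    rw [pow_succ, Module.End.mul_apply, Module.End.mul_apply, ← ih]
    simp [doubling]

/-- Doubling is a linear automorphism that commutes with γ, so conjugation by it respects insertion,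
and the two scalars multiply. -/
theorem diamondHom_doubling [CharZero 𝕜] {m n : ℕ} {P : CochainSpace (α.prodMap β) m}
    {Q : CochainSpace (α.prodMap β) n} {w w' : ℤ}
    (hP : ∀ v, P.toMap (fun i => doubling 𝕜 (v i)) = (2 : 𝕜) ^ w • doubling 𝕜 (P.toMap v))
    (hQ : ∀ v, Q.toMap (fun i => doubling 𝕜 (v i)) = (2 : 𝕜) ^ w' • doubling 𝕜 (Q.toMap v)) :
    inDegree _ (m + n) (diamondHom _ m n P Q) ∈ weightPart α β (w + w') := by
  apply inDegree_mem_weightPart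
  intro v
  let D : g × V →ₗ[𝕜] g × V :=
    LinearMap.prodMap ((2 : 𝕜) • LinearMap.id) LinearMap.id
  have hD : (doubling 𝕜 : g × V → g × V) = D := by
    funext x; simp [D, doubling]
  have h := insertion_map (𝕜 := 𝕜) (((α.prodMap β) ^ n : g × V →ₗ[𝕜] g × V)) (doubling 𝕜) (n + 1)
    (listEval Q.toMap) (listEval P.toMap) (List.ofFn v)
  rw [← listEval_diamondHom, List.map_ofFn, listEval_ofFn] at h
  rw [show (fun i => doubling 𝕜 (v i)) = doubling 𝕜 ∘ v from rfl, h]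
  have hQ' : (fun t : List (g × V) => listEval Q.toMap (t.map (doubling 𝕜))) =
      fun t => (2 : 𝕜) ^ w' • doubling 𝕜 (listEval Q.toMap t) := funext (listEval_doubling hQ)
  rw [hQ', insertion_smul_right _ _ _ _ (fun a => listEval_homogeneous P.toMap a _)]
  simp only [pow_doubling]
  rw [← insertion_comp_map_left]
  have hP' : (fun t : List (g × V) => listEval P.toMap (t.map (doubling 𝕜))) =
      fun t => (2 : 𝕜) ^ w • doubling 𝕜 (listEval P.toMap t) := funext (listEval_doubling hP)
  rw [hP', insertion_smul_left, hD, ← map_insertion, ← listEval_diamondHom, listEval_ofFn, smul_smul,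
    zpow_add₀ (by norm_num), mul_comm]

theorem bracket_weight [CharZero 𝕜] {w w' : ℤ} {x y : LSpace α β} (hx : x ∈ weightPart α β w)
    (hy : y ∈ weightPart α β w') : balavoineBracket _ x y ∈ weightPart α β (w + w') := by
  refine bracket_mem_of_components fun m n => ?_
  rw [bracket_inDegree]
  refine sub_mem (diamondHom_doubling (hx m) (hy n)) (Submodule.smul_mem _ _ ?_)
  rw [add_comm w]
  exact diamondHom_doubling (hy n) (hx m)

/-- On inputs in V doubling is the identity, so a 𝔤-valued component y satisfies y = 2^{w+1} y. -/
theorem projA_weight [CharZero 𝕜] {w : ℤ} (hw : w ≠ -1) {x : LSpace α β} (hx : x ∈ weightPart α β w) :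
    projA α β x = 0 := by
  refine DFinsupp.ext fun n => ?_
  refine (projA_apply x n).trans (CochainSpace.ext fun v => ?_)
  rw [projPart_toMap]
  have h := congrArg Prod.fst (hx n (fun i => projV 𝕜 g V (v i)))
  have hv : (fun i => doubling 𝕜 (projV 𝕜 g V (v i))) = fun i => projV 𝕜 g V (v i) := by
    funext i; simp [doubling]
  rw [hv] at h
  simp only [doubling, Prod.smul_fst, smul_smul] at h
  rw [← zpow_add_one₀ (by norm_num : (2 : 𝕜) ≠ 0)] at h
  -- Characteristic 0 enters here: powers of 2 are distinguished inside the copy of ℚ.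
  have h2 : (2 : 𝕜) ^ (w + 1) ≠ 1 := by
    intro hc
    have h3 : (((2 : ℚ) ^ (w + 1) : ℚ) : 𝕜) = ((1 : ℚ) : 𝕜) := by push_cast; exact hc
    have h4 : (2 : ℚ) ^ (w + 1) = 1 := Rat.cast_injective h3
    rw [zpow_eq_one_iff_right₀ (by norm_num) (by norm_num)] at h4
    omega
  have h5 : (1 - (2 : 𝕜) ^ (w + 1)) • ((x n).toMap fun i => projV 𝕜 g V (v i)).1 = 0 := by
    rw [sub_smul, one_smul, ← h, sub_self]
  have h6 := (smul_eq_zero.1 h5).resolve_left (sub_ne_zero.2 (Ne.symm h2))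
  rw [projG_apply, h6]
  rfl

/-- Both components have the same weight: n+1 inputs and one output in 𝔤 for the first, n inputs and
no output in 𝔤 for the second. -/
theorem qPart_weight {n : ℕ} {f : CochainSpace (α.prodMap β) n} (hf : f ∈ qPart α β n) :
    inDegree _ n f ∈ weightPart α β n := by
  obtain ⟨f₁, f₂, -, -, h⟩ := hf
  apply inDegree_mem_weightPart
  intro v
  rw [h, h]
  have e1 := f₁.map_smul_univ (fun _ => (2 : 𝕜)) (fun i => (v i).1)
  have e2 := f₂.map_smul_univ (fun _ => (2 : 𝕜)) (fun i => (v i.castSucc).1)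
  simp only [Finset.prod_const, Finset.card_univ, Fintype.card_fin] at e1 e2
  simp only [doubling, e1, e2, zpow_natCast, Prod.smul_mk, smul_smul, LinearMap.smul_apply, pow_succ]

theorem aPart_weight [CharZero 𝕜] {n : ℕ} {f : CochainSpace (α.prodMap β) n} (hf : f ∈ aPart α β n) :
    inDegree _ n f ∈ weightPart α β (-1) := by
  obtain ⟨T, -, h⟩ := hf
  apply inDegree_mem_weightPart
  intro v
  rw [h, h]
  simp [doubling, smul_smul]

end Projection

/-! ### `q` is closed under the bracket -/

section QClosed

variable {𝕜 : Type*} [Field 𝕜]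
variable {g : Type*} [AddCommGroup g] [Module 𝕜 g] {V : Type*} [AddCommGroup V] [Module 𝕜 V]
variable {α : g →ₗ[𝕜] g} {β : V →ₗ[𝕜] V}

variable (𝕜) in
/-- The functionals on lists that come from elements of `q`: all entries but the last one enter
through their component in `g`, they enter alternatingly, and the output lies in `g` or `V` if the
last entry does. -/
structure IsQFunctional (P : List (g × V) → g × V) : Prop where
  inner : ∀ a x b, b ≠ [] → P (a ++ x :: b) = P (a ++ projG 𝕜 g V x :: b)
  alternating : ∀ a x b, P (a ++ projG 𝕜 g V x :: projG 𝕜 g V x :: b) = 0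
  last : ∀ a x, P (a ++ [projG 𝕜 g V x]) = projG 𝕜 g V (P (a ++ [x]))

theorem IsQFunctional.cons {P : List (g × V) → g × V} (hP : IsQFunctional 𝕜 P) (z : g × V) :
    IsQFunctional 𝕜 fun t => P (z :: t) :=
  ⟨fun a => hP.inner (z :: a), fun a => hP.alternating (z :: a), fun a => hP.last (z :: a)⟩

theorem eq_neg_of_alternating {T M : Type*} [AddCommGroup T] [AddCommGroup M] {P : List T → M}
    (hP : ListAdditive P) {a b : List T} {x y : T} (hx : P (a ++ x :: x :: b) = 0)
    (hy : P (a ++ y :: y :: b) = 0) (hxy : P (a ++ (x + y) :: (x + y) :: b) = 0) :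
    P (a ++ x :: y :: b) = -P (a ++ y :: x :: b) := by
  have e : ∀ u : T, P (a ++ u :: (x + y) :: b) = P (a ++ u :: x :: b) + P (a ++ u :: y :: b) := by
    intro u
    have := hP (a ++ [u]) x y b
    simpa using this
  rw [hP a, e, e, hx, hy, zero_add, add_zero] at hxy
  exact eq_neg_of_add_eq_zero_left hxy

theorem IsQFunctional.antisymm {P : List (g × V) → g × V} (hP : IsQFunctional 𝕜 P)
    (ha : ListAdditive P) (a : List (g × V)) (x y : g × V) (b : List (g × V)) :
    P (a ++ projG 𝕜 g V x :: projG 𝕜 g V y :: b) =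
      -P (a ++ projG 𝕜 g V y :: projG 𝕜 g V x :: b) :=
  eq_neg_of_alternating ha (hP.alternating a x b) (hP.alternating a y b)
    (by rw [← map_add]; exact hP.alternating a (x + y) b)

variable {τ : g × V →ₗ[𝕜] g × V}

theorem insertion_inner (hτ : ∀ x, τ (projG 𝕜 g V x) = projG 𝕜 g V (τ x)) (k : ℕ)
    {P Q : List (g × V) → g × V} (hP : IsQFunctional 𝕜 P) (hQ : IsQFunctional 𝕜 Q)
    (a : List (g × V)) (x : g × V) (b : List (g × V)) (hb : b ≠ []) :
    insertion 𝕜 τ k Q P (a ++ x :: b) = insertion 𝕜 τ k Q P (a ++ projG 𝕜 g V x :: b) := by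
  induction a generalizing k P Q with
  | nil =>
    simp only [List.nil_append]
    rcases k with _ | k
    · rw [insertion_zero, insertion_zero, List.map_cons, List.map_cons, hτ]
      exact hP.inner [Q []] _ _ (by simpa)
    · rw [insertion_cons, insertion_cons]
      congr 1
      · congr 1
        refine insertion_congr_left _ _ _ (fun t ht => ?_) _
        rw [hτ]
        exact hP.inner [] _ _ ht
      -- If `Q` needs only this letter, the letter is its last entry: `last` carries the projection
      -- to the value of `Q`, which is then an inner entry of `P`.
      · rcases k with _ | k
        · rw [insertion_zero, insertion_zero, show Q [projG 𝕜 g V x] = projG 𝕜 g V (Q [x]) from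
            hQ.last [] x]
          exact hP.inner [] _ _ (by simpa)
        · refine insertion_congr_right _ _ _ (fun t ht => ?_) _
          exact hQ.inner [] _ _ (by rintro rfl; simp at ht)
  | cons y a ih =>
    rcases k with _ | k
    · simp only [insertion_zero, List.map_append, List.map_cons]
      rw [hτ]
      exact hP.inner (Q [] :: (y :: a).map τ) _ _ (by simpa)
    · simp only [List.cons_append, insertion_cons]
      rw [ih _ (hP.cons _) hQ, ih _ hP (hQ.cons _)]

/-- If both equal letters go to the same functional, its alternation applies. The two ways to send
one to each cancel, by antisymmetry of `P` if `Q` needs one more letter and by the signs of the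
recursion if it needs several. -/
theorem insertion_alternating (hτ : ∀ x, τ (projG 𝕜 g V x) = projG 𝕜 g V (τ x)) (k : ℕ)
    {P Q : List (g × V) → g × V} (hP : IsQFunctional 𝕜 P) (hQ : IsQFunctional 𝕜 Q)
    (ha : ListAdditive P) (a : List (g × V)) (x : g × V) (b : List (g × V)) :
    insertion 𝕜 τ k Q P (a ++ projG 𝕜 g V x :: projG 𝕜 g V x :: b) = 0 := by
  induction a generalizing k P Q with
  | nil =>
    simp only [List.nil_append]
    have hz : (fun t => P (τ (projG 𝕜 g V x) :: τ (projG 𝕜 g V x) :: t)) = fun _ => 0 := by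
      funext t
      rw [hτ]
      exact hP.alternating [] _ _
    rcases k with _ | _ | k
    · rw [insertion_zero, List.map_cons, List.map_cons, hτ]
      exact hP.alternating [Q []] _ _
    · simp only [insertion_cons, insertion_zero, hz, insertion_zero_left, List.map_cons]
      have h1 : Q [projG 𝕜 g V x] = projG 𝕜 g V (Q [x]) := hQ.last [] x
      have h2 := hP.antisymm ha [] (τ x) (Q [x]) (b.map τ)
      simp only [List.nil_append] at h2
      rw [h1, hτ, h2]
      simp
    · simp only [insertion_cons, hz, insertion_zero_left]
      have hz' : (fun t => Q (projG 𝕜 g V x :: projG 𝕜 g V x :: t)) = fun _ => 0 :=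
        funext fun t => hQ.alternating [] _ _
      rw [hz', insertion_zero_right _ _ ha, pow_succ]
      simp
  | cons y a ih =>
    rcases k with _ | k
    · simp only [insertion_zero, List.map_append, List.map_cons]
      rw [hτ]
      exact hP.alternating (Q [] :: (y :: a).map τ) _ _
    · simp only [List.cons_append, insertion_cons]
      rw [ih _ (hP.cons _) hQ (ha.cons _), ih _ hP (hQ.cons _) ha]
      simp

theorem insertion_last (hτ : ∀ x, τ (projG 𝕜 g V x) = projG 𝕜 g V (τ x)) (k : ℕ)
    {P Q : List (g × V) → g × V} (hP : IsQFunctional 𝕜 P) (hQ : IsQFunctional 𝕜 Q)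
    (a : List (g × V)) (x : g × V) :
    insertion 𝕜 τ k Q P (a ++ [projG 𝕜 g V x]) =
      projG 𝕜 g V (insertion 𝕜 τ k Q P (a ++ [x])) := by
  induction a generalizing k P Q with
  | nil =>
    simp only [List.nil_append]
    rcases k with _ | _ | k
    · simp only [insertion_zero, List.map_cons, List.map_nil, hτ]
      exact hP.last [Q []] _
    · simp only [insertion_cons, insertion_zero, insertion_nil, List.map_nil]
      rw [show Q [projG 𝕜 g V x] = projG 𝕜 g V (Q [x]) from hQ.last [] x, smul_zero, zero_add,
        zero_add]
      exact hP.last [] _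
    · simp only [insertion_cons, insertion_nil, smul_zero, add_zero, map_zero]
  | cons y a ih =>
    rcases k with _ | k
    · simp only [insertion_zero, List.map_append, List.map_cons, List.map_nil, hτ]
      exact hP.last (Q [] :: (y :: a).map τ) _
    · simp only [List.cons_append, insertion_cons]
      rw [ih _ (hP.cons _) hQ, ih _ hP (hQ.cons _), map_add, map_smul]

theorem isQFunctional_of_mem {n : ℕ} {f : CochainSpace (α.prodMap β) n} (hf : f ∈ qPart α β n) :
    IsQFunctional 𝕜 (listEval f.toMap) := by
  obtain ⟨f₁, f₂, -, -, h⟩ := hf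
  constructor
  · intro a x b hb
    by_cases hl : (a ++ x :: b).length = n + 1
    · have hl' : (a ++ projG 𝕜 g V x :: b).length = n + 1 := by simpa using hl
      rw [listEval_of_length _ hl, listEval_of_length _ hl', h, h]
      have e : ∀ i : Fin (n + 1), ((a ++ projG 𝕜 g V x :: b)[i]).1 = ((a ++ x :: b)[i]).1 := by
        intro i
        simp only [Fin.getElem_fin, List.getElem_append, List.getElem_cons]
        split_ifs <;> rfl
      have hb' : b.length ≠ 0 := by simpa using hb
      have e' : (a ++ projG 𝕜 g V x :: b)[Fin.last n] = (a ++ x :: b)[Fin.last n] := by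
        simp only [List.length_append, List.length_cons] at hl
        simp only [Fin.getElem_fin, List.getElem_append, List.getElem_cons, Fin.val_last]
        rw [dif_neg (by omega), dif_neg (by omega), dif_neg (by omega), dif_neg (by omega)]
      simp only [e, e']
    · rw [listEval_eq_zero _ hl, listEval_eq_zero _ (by simpa using hl)]
  · intro a x b
    by_cases hl : (a ++ projG 𝕜 g V x :: projG 𝕜 g V x :: b).length = n + 1
    · rw [listEval_of_length _ hl, h]
      simp only [List.length_append, List.length_cons] at hl
      have e1 : (a ++ projG 𝕜 g V x :: projG 𝕜 g V x :: b)[a.length]'(by simp) = projG 𝕜 g V x := by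
        simp
      have e2 : (a ++ projG 𝕜 g V x :: projG 𝕜 g V x :: b)[a.length + 1]'(by simp) =
          projG 𝕜 g V x := by
        simp
      apply Prod.ext
      · refine f₁.map_eq_zero_of_eq _ (i := ⟨a.length, by omega⟩) (j := ⟨a.length + 1, by omega⟩) ?_ ?_
        · simp only [Fin.getElem_fin, e1, e2]
        · simp
      -- With `b` empty, the second equal entry is the last one and its V-component is 0; otherwise
      -- both entries are arguments of the alternating map `f₂`.
      · by_cases hb : b = []
        · subst hb
          have hn : n = a.length + 1 := by simpa using hl.symm
          have e3 : ((a ++ [projG 𝕜 g V x, projG 𝕜 g V x])[Fin.last n]'(by simp; omega)).2 = 0 := by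
            simp only [Fin.getElem_fin, Fin.val_last, hn, e2]
            rfl
          simp only [e3, map_zero]
          rfl
        · have hb' : b.length ≠ 0 := by simpa using hb
          have : f₂ (fun i => ((a ++ projG 𝕜 g V x :: projG 𝕜 g V x :: b)[i.castSucc]'(by
              simp; omega)).1) = 0 := by
            refine f₂.map_eq_zero_of_eq _ (i := ⟨a.length, by omega⟩)
              (j := ⟨a.length + 1, by omega⟩) ?_ ?_
            · simp only [Fin.getElem_fin, Fin.val_castSucc, e1, e2]
            · simp
          simp only [this]
          rfl
    · exact listEval_eq_zero _ hl
  · intro a x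
    by_cases hl : (a ++ [x]).length = n + 1
    · have hl' : (a ++ [projG 𝕜 g V x]).length = n + 1 := by simpa using hl
      rw [listEval_of_length _ hl, listEval_of_length _ hl', h, h]
      have e : ∀ i : Fin (n + 1), ((a ++ [projG 𝕜 g V x])[i]).1 = ((a ++ [x])[i]).1 := by
        intro i
        simp only [Fin.getElem_fin, List.getElem_append, List.getElem_cons]
        split_ifs <;> rfl
      have hn : n = a.length := by simpa using hl.symm
      have e' : ((a ++ [projG 𝕜 g V x])[Fin.last n]).2 = 0 := by
        simp [hn]
      rw [e', map_zero]
      exact Prod.ext (by simp only [e]; rfl) rfl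
    · rw [listEval_eq_zero _ hl, listEval_eq_zero _ (by simpa using hl), map_zero]

theorem exists_append_cons_of_lt {T : Type*} {k : ℕ} (w : Fin k → T) {i j : Fin k} (h : i < j) :
    ∃ a m b, List.ofFn w = a ++ w i :: (m ++ w j :: b) ∧ ∀ y ∈ a ++ m, ∃ k < j, y = w k := by
  refine ⟨(List.ofFn w).take i, ((List.ofFn w).drop (i + 1)).take (j - i - 1),
    (List.ofFn w).drop (j + 1), ?_, fun y hy => ?_⟩
  all_goals rw [Fin.lt_def] at h
  swap
  · rw [List.mem_append, List.mem_iff_getElem, List.mem_iff_getElem] at hy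
    rcases hy with ⟨t, ht, rfl⟩ | ⟨t, ht, rfl⟩
    · simp only [List.length_take, List.length_ofFn] at ht
      exact ⟨⟨t, by omega⟩, by rw [Fin.lt_def]; simp only; omega, by simp⟩
    · simp only [List.length_take, List.length_drop, List.length_ofFn] at ht
      exact ⟨⟨i + 1 + t, by omega⟩, by rw [Fin.lt_def]; simp only; omega, by simp⟩
  have e1 : w j :: (List.ofFn w).drop (j + 1) = (List.ofFn w).drop j := by
    rw [List.drop_eq_getElem_cons (by simp : j.1 < (List.ofFn w).length)]
    simp
  have e2 : w i :: (List.ofFn w).drop (i + 1) = (List.ofFn w).drop i := by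
    rw [List.drop_eq_getElem_cons (by simp : i.1 < (List.ofFn w).length)]
    simp
  have e3 : (List.ofFn w).drop j = ((List.ofFn w).drop (i + 1)).drop (j - i - 1) := by
    rw [List.drop_drop]; congr 1; omega
  rw [e1, e3, List.take_append_drop, e2, List.take_append_drop]

/-- Alternation is only assumed for neighbours. Antisymmetry moves the first equal entry through
`m`, which is possible because the entries of `m` lie in 𝔤. -/
theorem IsQFunctional.eq_zero_of_eq {P : List (g × V) → g × V} (hP : IsQFunctional 𝕜 P)
    (ha : ListAdditive P) (a m b : List (g × V)) (x : g × V) (hm : ∀ y ∈ m, projG 𝕜 g V y = y) :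
    P (a ++ projG 𝕜 g V x :: (m ++ projG 𝕜 g V x :: b)) = 0 := by
  induction m generalizing a with
  | nil => exact hP.alternating a x b
  | cons y m ih =>
    have hy := hm y (by simp)
    have h := hP.antisymm ha a x y (m ++ projG 𝕜 g V x :: b)
    rw [hy] at h
    have h2 := ih (a ++ [y]) (fun z hz => hm z (by simp [hz]))
    simp only [List.append_assoc, List.cons_append, List.nil_append] at h2 ⊢
    rw [h, h2, neg_zero]

theorem IsQFunctional.map_inner {P : List (g × V) → g × V} (hP : IsQFunctional 𝕜 P)
    (a c b : List (g × V)) (hb : b ≠ []) : P (a ++ c ++ b) = P (a ++ c.map (projG 𝕜 g V) ++ b) := by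
  induction c generalizing a with
  | nil => simp
  | cons y c ih =>
    have h1 := hP.inner a y (c ++ b) (by simp [hb])
    have h2 := ih (a ++ [projG 𝕜 g V y])
    simp only [List.append_assoc, List.cons_append, List.nil_append, List.map_cons] at h1 h2 ⊢
    rw [h1, h2]

/-- The two components are the restrictions to 𝔤^{n+1} and to 𝔤^n × V. Since inner entries count
only through 𝔤, splitting the last entry into its components recovers the whole map. With this
criterion, closure of 𝔮 becomes a statement about `insertion`. -/
theorem mem_qPart_of_isQFunctional {n : ℕ} {f : CochainSpace (α.prodMap β) n}
    (hf : IsQFunctional 𝕜 (listEval f.toMap)) : f ∈ qPart α β n := by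
  have e : ∀ (c : Fin n → g × V) (y : g × V), List.ofFn (Fin.snoc (α := fun _ => g × V) c y) =
      List.ofFn c ++ [y] := by
    intro c y
    rw [List.ofFn_succ_last]
    simp [Fin.snoc]
  have hinner : ∀ (c : Fin n → g × V) (y : g × V), f.toMap (Fin.snoc (α := fun _ => g × V) c y) =
      f.toMap (Fin.snoc (α := fun _ => g × V) (fun i => projG 𝕜 g V (c i)) y) := by
    intro c y
    have h := hf.map_inner [] (List.ofFn c) [y] (by simp)
    rw [List.nil_append, List.nil_append, List.map_ofFn, ← e, ← e, listEval_ofFn, listEval_ofFn] at h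
    exact h
  have hlast : ∀ (c : Fin n → g × V) (y : g × V),
      f.toMap (Fin.snoc (α := fun _ => g × V) c (projG 𝕜 g V y)) =
      projG 𝕜 g V (f.toMap (Fin.snoc (α := fun _ => g × V) c y)) := by
    intro c y
    have h := hf.last (List.ofFn c) y
    rwa [← e, ← e, listEval_ofFn, listEval_ofFn] at h
  have hzero : ∀ (w : Fin (n + 1) → g × V) (i j : Fin (n + 1)), (∀ k, k ≠ Fin.last n →
      projG 𝕜 g V (w k) = w k) → i < j → w i = w j → projG 𝕜 g V (w j) = w j → f.toMap w = 0 := by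
    intro w i j hw hij h hj
    obtain ⟨a, m, b, hl, hm⟩ := exists_append_cons_of_lt w hij
    have h2 := hf.eq_zero_of_eq (listEval_additive _) a m b (w j) (fun y hy => by
      obtain ⟨k, hk, rfl⟩ := hm y (by simp [hy])
      exact hw k (Fin.ne_last_of_lt hk))
    rw [hj] at h2
    rw [← listEval_ofFn, hl, h, h2]
  let res : ((g × V) →ₗ[𝕜] g × V) →ₗ[𝕜] V →ₗ[𝕜] V :=
    { toFun := fun ψ => LinearMap.snd 𝕜 g V ∘ₗ ψ ∘ₗ LinearMap.inr 𝕜 g V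
      map_add' := fun ψ ψ' => by ext; simp
      map_smul' := fun c ψ => by ext; simp }
  let f₁ : g [⋀^Fin (n + 1)]→ₗ[𝕜] g :=
    { (LinearMap.fst 𝕜 g V).compMultilinearMap
        (f.toMap.compLinearMap fun _ => LinearMap.inl 𝕜 g V) with
      map_eq_zero_of_eq' := by
        intro v i j hv hij
        have key : f.toMap (fun k => (v k, (0 : V))) = 0 := by
          rcases lt_or_gt_of_ne hij with h | h
          · exact hzero _ i j (fun _ _ => rfl) h (by simp [hv]) rfl
          · exact hzero _ j i (fun _ _ => rfl) h (by simp [hv]) rfl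
        exact congrArg Prod.fst key }
  let f₂ : g [⋀^Fin n]→ₗ[𝕜] (V →ₗ[𝕜] V) :=
    { res.compMultilinearMap (f.toMap.curryRight.compLinearMap fun _ => LinearMap.inl 𝕜 g V) with
      map_eq_zero_of_eq' := by
        intro v i j hv hij
        ext u
        have key : f.toMap (Fin.snoc (α := fun _ => g × V) (fun k => (v k, (0 : V))) (0, u)) = 0 := by
          have hs : ∀ k : Fin (n + 1), k ≠ Fin.last n → projG 𝕜 g V
              (Fin.snoc (α := fun _ => g × V) (fun k => (v k, (0 : V))) (0, u) k) =
              Fin.snoc (α := fun _ => g × V) (fun k => (v k, (0 : V))) (0, u) k := by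
            intro k hk
            obtain ⟨k, rfl⟩ := Fin.exists_castSucc_eq.2 hk
            simp
          rcases lt_or_gt_of_ne hij with h | h
          · exact hzero _ i.castSucc j.castSucc hs (by simpa) (by simp [hv])
              (hs _ (Fin.castSucc_ne_last _))
          · exact hzero _ j.castSucc i.castSucc hs (by simpa) (by simp [hv])
              (hs _ (Fin.castSucc_ne_last _))
        exact congrArg Prod.snd key }
  have hf₁ : ∀ x, f₁ x = (f.toMap fun i => (x i, (0 : V))).1 := fun x => rfl
  have hf₂ : ∀ x u, f₂ x u =
      (f.toMap (Fin.snoc (α := fun _ => g × V) (fun i => (x i, (0 : V))) (0, u))).2 :=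
    fun x u => rfl
  refine ⟨f₁, f₂, fun x => ?_, fun x u => ?_, fun w => ?_⟩
  · have h := congrArg Prod.fst (f.toMap_mem fun i => (x i, (0 : V)))
    simpa [hf₁] using h
  · have h := congrArg Prod.snd
      (f.toMap_mem (Fin.snoc (α := fun _ => g × V) (fun i => (x i, (0 : V))) (0, u)))
    rw [hf₂, hf₂]
    refine h.trans ?_
    congr 2
    funext k
    rcases Fin.eq_castSucc_or_eq_last k with ⟨k, rfl⟩ | rfl <;> simp
  · rw [hf₁, hf₂]
    obtain ⟨c, y, rfl⟩ : ∃ (c : Fin n → g × V) (y : g × V), w = Fin.snoc (α := fun _ => g × V) c y :=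
      ⟨Fin.init w, w (Fin.last n), (Fin.snoc_init_self w).symm⟩
    have h1 : (fun i => ((Fin.snoc (α := fun _ => g × V) c y i).1, (0 : V))) =
        Fin.snoc (α := fun _ => g × V) (fun i => projG 𝕜 g V (c i)) (projG 𝕜 g V y) := by
      funext k
      rcases Fin.eq_castSucc_or_eq_last k with ⟨k, rfl⟩ | rfl <;> simp
    have h2 : f.toMap (Fin.snoc (α := fun _ => g × V) (fun i => projG 𝕜 g V (c i)) y) =
        f.toMap (Fin.snoc (α := fun _ => g × V) (fun i => projG 𝕜 g V (c i)) (projG 𝕜 g V y)) +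
        f.toMap (Fin.snoc (α := fun _ => g × V) (fun i => projG 𝕜 g V (c i)) (projV 𝕜 g V y)) := by
      have h := f.toMap.map_update_add
        (Fin.snoc (α := fun _ => g × V) (fun i => projG 𝕜 g V (c i)) y) (Fin.last n)
        (projG 𝕜 g V y) (projV 𝕜 g V y)
      simp only [Fin.update_snoc_last] at h
      rw [← h]
      congr 2
      simp
    rw [hinner, h1, hlast]
    simp only [Fin.snoc_castSucc, Fin.snoc_last]
    refine Prod.ext rfl ?_
    rw [h2, hlast]
    simp

theorem diamondHom_mem_qPart {m n : ℕ} {P : CochainSpace (α.prodMap β) m}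
    {Q : CochainSpace (α.prodMap β) n} (hP : P ∈ qPart α β m) (hQ : Q ∈ qPart α β n) :
    diamondHom _ m n P Q ∈ qPart α β (m + n) := by
  apply mem_qPart_of_isQFunctional
  rw [listEval_diamondHom]
  have hP' := isQFunctional_of_mem hP
  have hQ' := isQFunctional_of_mem hQ
  exact ⟨insertion_inner (pow_projG n) _ hP' hQ',
    insertion_alternating (pow_projG n) _ hP' hQ' (listEval_additive _),
    insertion_last (pow_projG n) _ hP' hQ'⟩

theorem bracket_qSpace {x y : LSpace α β} (hx : x ∈ qSpace α β) (hy : y ∈ qSpace α β) :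
    balavoineBracket _ x y ∈ qSpace α β := by
  refine bracket_mem_of_components fun m n => ?_
  rw [bracket_inDegree]
  have hx' := mem_qSpace.1 hx m
  have hy' := mem_qSpace.1 hy n
  exact sub_mem (lof_mem_of_mem (qPart α β) _ (diamondHom_mem_qPart hx' hy'))
    (Submodule.smul_mem _ _ (lof_mem_of_mem (qPart α β) _ (diamondHom_mem_qPart hy' hx')))

end QClosed

/-! ### Sums over splittings of a word -/

section SplitSum

variable {𝕜 : Type*} [Field 𝕜] {Y : Type*} (deg : Y → ℤ)
variable {M : Type*} [AddCommGroup M] [Module 𝕜 M] {M' : Type*} [AddCommGroup M'] [Module 𝕜 M']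

theorem splitSum_add (F G : List Y → List Y → M) (l : List Y) :
    splitSum 𝕜 deg (fun a b => F a b + G a b) l = splitSum 𝕜 deg F l + splitSum 𝕜 deg G l := by
  induction l generalizing F G with
  | nil => rfl
  | cons y l ih =>
    simp only [splitSum, smul_add, ih]
    abel

theorem map_splitSum (f : M →ₗ[𝕜] M') (F : List Y → List Y → M) (l : List Y) :
    f (splitSum 𝕜 deg F l) = splitSum 𝕜 deg (fun a b => f (F a b)) l := by
  induction l generalizing F with
  | nil => rfl
  | cons y l ih => simp only [splitSum, map_add, ih, map_smul]

theorem splitSum_smul (c : 𝕜) (F : List Y → List Y → M) (l : List Y) :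
    splitSum 𝕜 deg (fun a b => c • F a b) l = c • splitSum 𝕜 deg F l :=
  (map_splitSum deg (c • LinearMap.id : M →ₗ[𝕜] M) F l).symm

theorem splitSum_eq_zero {F : List Y → List Y → M} {l : List Y}
    (h : ∀ a b, a.length + b.length = l.length → F a b = 0) : splitSum 𝕜 deg F l = 0 := by
  induction l generalizing F with
  | nil => exact h [] [] rfl
  | cons y l ih =>
    rw [splitSum, ih, ih, add_zero]
    · intro a b hab
      rw [h, smul_zero]
      simp only [List.length_cons]; omega
    · intro a b hab
      apply h
      simp only [List.length_cons]; omega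

theorem splitSum_nil_left {F : List Y → List Y → M} (h : ∀ a b, a ≠ [] → F a b = 0) (l : List Y) :
    splitSum 𝕜 deg F l = F [] l := by
  induction l generalizing F with
  | nil => rfl
  | cons y l ih =>
    rw [splitSum, splitSum_eq_zero deg (fun a b _ => h _ _ (by simp)), ih, zero_add]
    · simp
    · intro a b ha
      rw [h _ _ ha, smul_zero]

/-- Exchanging the two subwords costs the Koszul sign of moving one past the other. It is used to
symmetrize sums of brackets. -/
theorem splitSum_symm (F : List Y → List Y → M) (l : List Y) :
    splitSum 𝕜 deg (fun a b => sgn 𝕜 (listDeg deg a * listDeg deg b) • F b a) l =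
      splitSum 𝕜 deg F l := by
  induction l generalizing F with
  | nil => simp [splitSum]
  | cons y l ih =>
    simp only [splitSum]
    rw [add_comm, ← ih (fun a b => F (y :: a) b),
      ← ih (fun a b => sgn 𝕜 (deg y * listDeg deg a) • F a (y :: b))]
    congr 2
    · funext a b
      rw [smul_smul, ← sgn_add]
      congr 1
      refine sgn_eq_of_even_sub _ ⟨deg y * listDeg deg a, ?_⟩
      simp only [listDeg_cons]; ring
    · funext a b
      rw [smul_smul, ← sgn_add]
      congr 1
      refine sgn_eq_of_even_sub _ ⟨0, ?_⟩
      simp only [listDeg_cons]; ring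

end SplitSum

/-! ### `L_∞`-algebras given by functionals on lists -/

section ListLInfinity

variable {𝕜 : Type*} [Field 𝕜] {T : Type*} [AddCommGroup T] [Module 𝕜 T]

/-- The homogeneous elements of a graded vector space, together with their degree. -/
abbrev Homog (𝒜 : ℤ → Submodule 𝕜 T) : Type _ := Σ d : ℤ, 𝒜 d

/-- Forgetting the degree. -/
def Homog.val {𝒜 : ℤ → Submodule 𝕜 T} (y : Homog 𝒜) : T := y.2

/-- The total degree of a list of homogeneous elements. -/
abbrev Homog.degree {𝒜 : ℤ → Submodule 𝕜 T} (l : List (Homog 𝒜)) : ℤ := listDeg Sigma.fst l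

/-- An `L_∞`-algebra whose operations are given by one functional on lists. -/
structure IsListLInfinity (𝒜 : ℤ → Submodule 𝕜 T) (F : List T → T) : Prop where
  internal : DirectSum.IsInternal 𝒜
  additive : ListAdditive F
  homogeneous : ∀ a (c : 𝕜) x b, F (a ++ (c • x) :: b) = c • F (a ++ x :: b)
  degree_one : ∀ l : List (Homog 𝒜), F (l.map Homog.val) ∈ 𝒜 (Homog.degree l + 1)
  symmetric : ∀ (a : List (Homog 𝒜)) (x y : Homog 𝒜) (b : List (Homog 𝒜)),
    F ((a ++ x :: y :: b).map Homog.val) =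
      sgn 𝕜 (x.1 * y.1) • F ((a ++ y :: x :: b).map Homog.val)
  -- No curvature: this removes the splittings with an empty inner word, which do not occur in the
  -- L_∞-relations. For a twisted functional it is the Maurer–Cartan equation.
  nil : F [] = 0
  jacobi : ∀ l : List (Homog 𝒜), splitSum 𝕜 Sigma.fst
    (fun a b => F (F (a.map Homog.val) :: b.map Homog.val)) l = 0

theorem exists_multilinear {M : Type*} [AddCommGroup M] [Module 𝕜 M] {F : List T → M}
    (h : ListAdditive F) (h' : ∀ a (c : 𝕜) x b, F (a ++ (c • x) :: b) = c • F (a ++ x :: b))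
    (k : ℕ) : ∃ N : MultilinearMap 𝕜 (fun _ : Fin k => T) M, ∀ x, N x = F (List.ofFn x) := by
  refine ⟨MultilinearMap.mk' (fun x => F (List.ofFn x)) ?_ ?_, fun x => rfl⟩
  · intro x i u v
    rw [ofFn_update, ofFn_update, ofFn_update, h]
  · intro x i c v
    rw [ofFn_update, ofFn_update, h']

theorem ofFn_take {Y : Type*} {N : ℕ} (x : Fin N → Y) (p : ℕ) (hp : p ≤ N) :
    (List.ofFn x).take p = List.ofFn fun a : Fin p => x ⟨a.1, by omega⟩ := by
  apply List.ext_getElem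
  · simpa
  · intro i h1 h2; simp

theorem ofFn_drop {Y : Type*} {N : ℕ} (x : Fin N → Y) (p q : ℕ) (hp : p + q = N) :
    (List.ofFn x).drop p = List.ofFn fun b : Fin q => x ⟨p + b.1, by omega⟩ := by
  apply List.ext_getElem
  · simp; omega
  · intro i h1 h2; simp

/-- `sum_shuffleSum` translates the relation on splittings into shuffles. Antidiagonal indices start
with an empty inner word, whose term is 0; the others match the sizes `i + 1` and `m - i`. -/
theorem IsListLInfinity.isLInfinity {𝒜 : ℤ → Submodule 𝕜 T} {F : List T → T}
    (h : IsListLInfinity 𝒜 F) : IsLInfinity 𝒜 (fun k x => F (List.ofFn (n := k) x)) where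
  internal := h.internal
  multilinear k _ := exists_multilinear h.additive h.homogeneous k
  degree_one k _ d x hx := by
    let y : Fin k → Homog 𝒜 := fun i => ⟨d i, x i, hx i⟩
    have := h.degree_one (List.ofFn y)
    rwa [List.map_ofFn, Homog.degree, listDeg, List.map_ofFn, List.sum_ofFn] at this
  symmetric k _ σ d x hx := by
    let y : Fin k → Homog 𝒜 := fun i => ⟨d i, x i, hx i⟩
    have := apply_ofFn_perm (𝕜 := 𝕜) Sigma.fst (G := fun l => F (l.map (Homog.val (𝒜 := 𝒜))))
      h.symmetric σ y
    rw [List.map_ofFn, List.map_ofFn] at this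
    rw [units_smul_eq (𝕜 := 𝕜)]
    exact this
  jacobi m d x hx := by
    let y : Fin (m + 1) → Homog 𝒜 := fun i => ⟨d i, x i, hx i⟩
    have h0 : ∀ b, F (0 :: b) = 0 := fun b => h.additive.map_zero [] b
    have hj := h.jacobi (List.ofFn y)
    rw [← sum_shuffleSum, Finset.Nat.sum_antidiagonal_succ,
      Finset.Nat.sum_antidiagonal_eq_sum_range_succ (fun p q =>
        shuffleSum 𝕜 Sigma.fst (m + 1) (p + 1) q y fun l =>
          F (F ((l.take (p + 1)).map Homog.val) :: (l.drop (p + 1)).map Homog.val)),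
      Finset.sum_range] at hj
    simp only [List.take_zero, List.map_nil, h.nil, h0] at hj
    rw [show shuffleSum 𝕜 Sigma.fst (m + 1) 0 (m + 1) y (fun _ => (0 : T)) = 0 by
      simp [shuffleSum], zero_add] at hj
    rw [← hj]
    refine Finset.sum_congr rfl fun i _ => Finset.sum_congr rfl fun σ _ => ?_
    rw [units_smul_eq (𝕜 := 𝕜)]
    congr 1
    beta_reduce
    rw [ofFn_take _ _ (by omega), ofFn_drop _ _ (m - i.1) (by omega), List.map_ofFn, List.map_ofFn,
      List.ofFn_cons]
    rfl

end ListLInfinity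

/-! ### Higher derived brackets -/

/-- A graded Lie algebra with bracket `br` and grading `gr`, two graded subalgebras `q` and `a`
with `a` abelian, and a projection `P` onto `a` whose kernel is a subalgebra. The involution `E` is
`(-1)^i` in degree `i`. -/
structure VoronovData (𝕜 L : Type*) [Field 𝕜] [AddCommGroup L] [Module 𝕜 L] where
  br : L →ₗ[𝕜] L →ₗ[𝕜] L
  gr : ℤ → Submodule 𝕜 L
  E : L →ₗ[𝕜] L
  P : L →ₗ[𝕜] L
  q : Submodule 𝕜 L
  a : Submodule 𝕜 L
  br_mem : ∀ {i j x y}, x ∈ gr i → y ∈ gr j → br x y ∈ gr (i + j)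
  skew : ∀ {i j x y}, x ∈ gr i → y ∈ gr j → br x y = -(sgn 𝕜 (i * j) • br y x)
  jac : ∀ {i j k x y z}, x ∈ gr i → y ∈ gr j → z ∈ gr k →
    br (br x y) z = br x (br y z) + sgn 𝕜 (j * k) • br (br x z) y
  E_apply : ∀ {i x}, x ∈ gr i → E x = sgn 𝕜 i • x
  br_q : ∀ {x y}, x ∈ q → y ∈ q → br x y ∈ q
  E_q : ∀ {x}, x ∈ q → E x ∈ q
  br_a : ∀ {x y}, x ∈ a → y ∈ a → br x y = 0
  P_mem : ∀ x, P x ∈ a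
  P_gr : ∀ {i x}, x ∈ gr i → P x ∈ gr i
  P_br : ∀ x y, P (br x y) = P (br (P x) y) + P (br x (P y))

namespace VoronovData

variable {𝕜 L : Type*} [Field 𝕜] [AddCommGroup L] [Module 𝕜 L] (D : VoronovData 𝕜 L)

/-- The graded space `s⁻¹q ⊕ a`. -/
abbrev Space : Type _ := D.q × D.a

/-- The grading of `s⁻¹q ⊕ a`. -/
def grading (i : ℤ) : Submodule 𝕜 D.Space :=
  ((D.gr (i + 1)).comap D.q.subtype).prod ((D.gr i).comap D.a.subtype)

/-- The homogeneous elements of `s⁻¹q ⊕ a`. -/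
abbrev Letter : Type _ := Homog D.grading

/-- The component in `q` of a letter. -/
abbrev qc (w : D.Letter) : L := w.2.1.1

/-- The component in `a` of a letter. -/
abbrev ac (w : D.Letter) : L := w.2.1.2

variable {D} in
theorem qc_mem (w : D.Letter) : D.qc w ∈ D.gr (w.1 + 1) := w.2.2.1

variable {D} in
theorem ac_mem (w : D.Letter) : D.ac w ∈ D.gr w.1 := w.2.2.2

/-- The iterated bracket `[⋯[u, p_1], ⋯, p_k]` with the components in `a` of a word. -/
def nest : List D.Space → L →ₗ[𝕜] L
  | [] => LinearMap.id
  | w :: l => nest l ∘ₗ D.br.flip w.2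

@[simp] theorem nest_nil (u : L) : D.nest [] u = u := rfl

@[simp] theorem nest_cons (w : D.Space) (l : List D.Space) (u : L) :
    D.nest (w :: l) u = D.nest l (D.br u w.2) := rfl

/-- The bracket with `p` on the left, with the sign for which it is a derivation that moves past
the desuspended elements. -/
def lam (p : L) : L →ₗ[𝕜] L := -D.br (D.E p)

/-- The sum over the letters of a word of the iterated brackets of the component in `q` of this
letter with the components in `a` of the others. -/
def derived : List D.Space → L
  | [] => 0
  | w :: l => D.nest l w.1 + D.lam w.2 (derived l)

/-- The binary operation on `s⁻¹q`, as a functional on words. -/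
def qBracket : List D.Space → L
  | [x, y] => D.br (D.E x.1) y.1
  | _ => 0

theorem qBracket_mem (l : List D.Space) : D.qBracket l ∈ D.q := by
  unfold qBracket
  split
  · exact D.br_q (D.E_q (Subtype.property _)) (Subtype.property _)
  · exact zero_mem _

theorem qBracket_eq_zero {l : List D.Space} (h : l.length ≠ 2) : D.qBracket l = 0 := by
  unfold qBracket
  split
  · simp at h
  · rfl

/-- The higher derived brackets, as a functional on words. -/
def op (l : List D.Space) : D.Space :=
  (⟨D.qBracket l, D.qBracket_mem l⟩, ⟨D.P (D.derived l), D.P_mem _⟩)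

/-! #### Linearity -/

theorem lam_add (p p' : L) : D.lam (p + p') = D.lam p + D.lam p' := by
  simp only [lam, map_add]; abel

theorem lam_smul (c : 𝕜) (p : L) : D.lam (c • p) = c • D.lam p := by
  simp only [lam, map_smul, smul_neg]

theorem nest_additive (u : L) : ListAdditive fun l => D.nest l u := by
  intro a x y b
  induction a generalizing u with
  | nil => simp
  | cons w a ih => exact ih _

theorem nest_homogeneous (a : List D.Space) (c : 𝕜) (x : D.Space) (b : List D.Space) (u : L) :
    D.nest (a ++ (c • x) :: b) u = c • D.nest (a ++ x :: b) u := by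
  induction a generalizing u with
  | nil => simp
  | cons w a ih => exact ih _

theorem derived_additive : ListAdditive D.derived := by
  intro a x y b
  induction a with
  | nil => simp [derived, lam_add]; abel
  | cons w a ih =>
    simp only [List.cons_append, derived, ih, map_add, D.nest_additive _ a x y b]
    abel

theorem derived_homogeneous (a : List D.Space) (c : 𝕜) (x : D.Space) (b : List D.Space) :
    D.derived (a ++ (c • x) :: b) = c • D.derived (a ++ x :: b) := by
  induction a with
  | nil => simp [derived, lam_smul]
  | cons w a ih =>
    simp only [List.cons_append, derived, ih, map_smul, D.nest_homogeneous, smul_add]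

theorem qBracket_additive : ListAdditive D.qBracket := by
  intro a x y b
  rcases a with _ | ⟨w, _ | ⟨w', a⟩⟩ <;> rcases b with _ | ⟨v, _ | ⟨v', b⟩⟩ <;> simp [qBracket]

theorem qBracket_homogeneous (a : List D.Space) (c : 𝕜) (x : D.Space) (b : List D.Space) :
    D.qBracket (a ++ (c • x) :: b) = c • D.qBracket (a ++ x :: b) := by
  rcases a with _ | ⟨w, _ | ⟨w', a⟩⟩ <;> rcases b with _ | ⟨v, _ | ⟨v', b⟩⟩ <;> simp [qBracket]

variable {D} in
theorem space_ext {x y : D.Space} (h : (x.1 : L) = y.1) (h' : (x.2 : L) = y.2) : x = y :=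
  Prod.ext (Subtype.ext h) (Subtype.ext h')

theorem op_additive : ListAdditive D.op := fun a x y b =>
  space_ext (D.qBracket_additive a x y b) (by simp [op, D.derived_additive a x y b])

theorem op_homogeneous (a : List D.Space) (c : 𝕜) (x : D.Space) (b : List D.Space) :
    D.op (a ++ (c • x) :: b) = c • D.op (a ++ x :: b) :=
  space_ext (D.qBracket_homogeneous a c x b) (by simp [op, D.derived_homogeneous a c x b])

/-! #### Degrees and signs -/

variable {D}

theorem mem_congr {i j : ℤ} {x : L} (hx : x ∈ D.gr i) (h : i = j) : x ∈ D.gr j := h ▸ hx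

theorem lam_apply {d : ℤ} {p : L} (hp : p ∈ D.gr d) (u : L) :
    D.lam p u = sgn 𝕜 (d + 1) • D.br p u := by
  simp [lam, D.E_apply hp, sgn_add]

theorem lam_mem {d e : ℤ} {p u : L} (hp : p ∈ D.gr d) (hu : u ∈ D.gr e) :
    D.lam p u ∈ D.gr (d + e) := by
  rw [lam_apply hp]
  exact Submodule.smul_mem _ _ (D.br_mem hp hu)

theorem br_eq_lam {d e : ℤ} {p u : L} (hp : p ∈ D.gr d) (hu : u ∈ D.gr e) :
    D.br u p = sgn 𝕜 ((e + 1) * d) • D.lam p u := by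
  rw [lam_apply hp, D.skew hu hp, smul_smul, ← sgn_add, ← neg_one_smul 𝕜 (_ • _), smul_smul,
    ← sgn_one, ← sgn_add]
  congr 1
  exact sgn_eq_of_even_sub _ ⟨-d, by ring⟩

theorem lam_eq_br {d e : ℤ} {p u : L} (hp : p ∈ D.gr d) (hu : u ∈ D.gr e) :
    D.lam p u = sgn 𝕜 ((e + 1) * d) • D.br u p := by
  rw [br_eq_lam hp hu, smul_smul, sgn_mul_self, one_smul]

/-- This is the graded Jacobi identity with `p` in front: up to a sign depending only on its degree,
`lam p` is the adjoint action, hence a derivation. -/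
theorem lam_br {d i j : ℤ} {p u v : L} (hp : p ∈ D.gr d) (hu : u ∈ D.gr i) (hv : v ∈ D.gr j) :
    D.lam p (D.br u v) = D.br (D.lam p u) v + sgn 𝕜 (d * i) • D.br u (D.lam p v) := by
  rw [lam_apply hp, lam_apply hp, lam_apply hp, map_smul, map_smul, LinearMap.smul_apply,
    D.jac hp hu hv, D.skew (D.br_mem hp hv) hu, smul_add, smul_neg, smul_neg, smul_smul, smul_smul,
    smul_smul, ← sgn_add, ← sgn_add, ← sgn_add]
  rw [sgn_eq_of_even_sub 𝕜 (d := d + 1 + i * j + (d + j) * i) (e := d * i + (d + 1))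
    ⟨i * j, by ring⟩]
  abel

theorem nest_mem {e : ℤ} {u : L} (hu : u ∈ D.gr e) (l : List D.Letter) :
    D.nest (l.map Homog.val) u ∈ D.gr (e + Homog.degree l) := by
  induction l generalizing e u with
  | nil => simpa using hu
  | cons w l ih =>
    exact mem_congr (ih (D.br_mem hu (ac_mem w))) (by simp only [listDeg_cons]; ring)

theorem derived_mem (l : List D.Letter) :
    D.derived (l.map Homog.val) ∈ D.gr (Homog.degree l + 1) := by
  induction l with
  | nil => exact zero_mem _
  | cons w l ih =>
    refine add_mem (mem_congr (nest_mem (qc_mem w) l) ?_) (mem_congr (lam_mem (ac_mem w) ih) ?_) <;>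
    simp only [listDeg_cons] <;> ring

/-- All entries bracketed in lie in the abelian subalgebra 𝔞, so `lam p` passes each of them; the
sign in `lam` absorbs the Koszul sign. -/
theorem lam_nest {d e : ℤ} {p u : L} (hp : p ∈ D.gr d) (hpa : p ∈ D.a) (hu : u ∈ D.gr e)
    (l : List D.Letter) :
    D.lam p (D.nest (l.map Homog.val) u) = D.nest (l.map Homog.val) (D.lam p u) := by
  induction l generalizing e u with
  | nil => rfl
  | cons w l ih =>
    have h0 : D.br p (D.ac w) = 0 := D.br_a hpa (Subtype.property _)
    change D.lam p (D.nest (l.map Homog.val) (D.br u (D.ac w))) =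
      D.nest (l.map Homog.val) (D.br (D.lam p u) (D.ac w))
    rw [ih (D.br_mem hu (ac_mem w)), lam_br hp hu (ac_mem w),
      lam_apply hp (D.ac w), h0, smul_zero, map_zero, smul_zero, add_zero]

theorem lam_lam {d d' e : ℤ} {p p' u : L} (hp : p ∈ D.gr d) (hpa : p ∈ D.a) (hp' : p' ∈ D.gr d')
    (hpa' : p' ∈ D.a) (hu : u ∈ D.gr e) :
    D.lam p (D.lam p' u) = sgn 𝕜 (d * d') • D.lam p' (D.lam p u) := by
  rw [lam_apply hp' u, map_smul, lam_br hp hp' hu, lam_apply hp p', D.br_a hpa hpa', smul_zero,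
    map_zero, LinearMap.zero_apply, zero_add, lam_apply hp' (D.lam p u), smul_comm]

theorem nest_swap {e : ℤ} {u : L} (hu : u ∈ D.gr e) (a : List D.Letter) (x y : D.Letter)
    (b : List D.Letter) :
    D.nest ((a ++ x :: y :: b).map Homog.val) u =
      sgn 𝕜 (x.1 * y.1) • D.nest ((a ++ y :: x :: b).map Homog.val) u := by
  induction a generalizing e u with
  | nil =>
    have h0 : D.br (D.ac x) (D.ac y) = 0 := D.br_a (Subtype.property _) (Subtype.property _)
    have h := D.jac hu (ac_mem x) (ac_mem y)
    rw [h0, map_zero, zero_add] at h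
    exact (congrArg (D.nest (b.map Homog.val)) h).trans (map_smul _ _ _)
  | cons w a ih => exact ih (D.br_mem hu (ac_mem w))

/-- When `x` and `y` come first, the terms whose 𝔮-entry is from `x` and from `y` trade places,
because left and right brackets with 𝔞 agree up to sign. The terms with a later 𝔮-entry are compared
by `lam_lam`. -/
theorem derived_swap (a : List D.Letter) (x y : D.Letter) (b : List D.Letter) :
    D.derived ((a ++ x :: y :: b).map Homog.val) =
      sgn 𝕜 (x.1 * y.1) • D.derived ((a ++ y :: x :: b).map Homog.val) := by
  induction a with
  | nil =>
    change D.nest (b.map Homog.val) (D.br (D.qc x) (D.ac y)) + D.lam (D.ac x)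
        (D.nest (b.map Homog.val) (D.qc y) + D.lam (D.ac y) (D.derived (b.map Homog.val))) =
      sgn 𝕜 (x.1 * y.1) • (D.nest (b.map Homog.val) (D.br (D.qc y) (D.ac x)) + D.lam (D.ac y)
        (D.nest (b.map Homog.val) (D.qc x) + D.lam (D.ac x) (D.derived (b.map Homog.val))))
    rw [map_add, map_add, lam_nest (ac_mem x) (Subtype.property _) (qc_mem y),
      lam_nest (ac_mem y) (Subtype.property _) (qc_mem x),
      lam_lam (ac_mem x) (Subtype.property _) (ac_mem y) (Subtype.property _) (derived_mem b),
      br_eq_lam (ac_mem y) (qc_mem x), br_eq_lam (ac_mem x) (qc_mem y), map_smul, map_smul,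
      smul_add, smul_add, smul_smul, ← sgn_add,
      sgn_eq_of_even_sub 𝕜 (d := (x.1 + 1 + 1) * y.1) (e := x.1 * y.1) ⟨y.1, by ring⟩,
      sgn_eq_of_even_sub 𝕜 (d := x.1 * y.1 + (y.1 + 1 + 1) * x.1) (e := 0)
        ⟨x.1 + x.1 * y.1, by ring⟩, sgn_zero, one_smul]
    abel
  | cons w a ih =>
    have h := nest_swap (qc_mem w) a x y b
    simp only [List.cons_append, List.map_cons, derived] at ih ⊢
    rw [ih, map_smul, smul_add]
    exact congrArg (· + _) h

/-- The sign (-1)^{|q|} in the definition of l_2 turns graded skew-symmetry into graded symmetry for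
the desuspended degrees. -/
theorem qBracket_swap (a : List D.Letter) (x y : D.Letter) (b : List D.Letter) :
    D.qBracket ((a ++ x :: y :: b).map Homog.val) =
      sgn 𝕜 (x.1 * y.1) • D.qBracket ((a ++ y :: x :: b).map Homog.val) := by
  rcases a with _ | ⟨w, a⟩
  · rcases b with _ | ⟨w, b⟩
    · change D.br (D.E (D.qc x)) (D.qc y) = sgn 𝕜 (x.1 * y.1) • D.br (D.E (D.qc y)) (D.qc x)
      rw [D.E_apply (qc_mem x), D.E_apply (qc_mem y), map_smul, map_smul, LinearMap.smul_apply,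
        LinearMap.smul_apply, D.skew (qc_mem x) (qc_mem y), ← neg_one_smul 𝕜 (_ • _), smul_smul,
        smul_smul, smul_smul, ← sgn_one, ← sgn_add, ← sgn_add, ← sgn_add]
      congr 1
      exact sgn_eq_of_even_sub _ ⟨x.1 + 1, by ring⟩
    · rw [qBracket_eq_zero, qBracket_eq_zero, smul_zero] <;> simp
  · rw [qBracket_eq_zero, qBracket_eq_zero, smul_zero] <;> simp <;> omega

theorem op_swap (a : List D.Letter) (x y : D.Letter) (b : List D.Letter) :
    D.op ((a ++ x :: y :: b).map Homog.val) =
      sgn 𝕜 (x.1 * y.1) • D.op ((a ++ y :: x :: b).map Homog.val) := by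
  apply space_ext
  · exact qBracket_swap a x y b
  · change D.P _ = sgn 𝕜 (x.1 * y.1) • D.P _
    rw [derived_swap, map_smul]

theorem qBracket_degree (l : List D.Letter) :
    D.qBracket (l.map Homog.val) ∈ D.gr (Homog.degree l + 1 + 1) := by
  by_cases h : l.length = 2
  · obtain ⟨x, y, rfl⟩ := List.length_eq_two.1 h
    change D.br (D.E (D.qc x)) (D.qc y) ∈ _
    rw [D.E_apply (qc_mem x), map_smul, LinearMap.smul_apply]
    exact Submodule.smul_mem _ _ (mem_congr (D.br_mem (qc_mem x) (qc_mem y))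
      (by simp only [listDeg_cons, listDeg_nil]; ring))
  · rw [qBracket_eq_zero _ (by simpa)]
    exact zero_mem _

theorem op_degree (l : List D.Letter) : D.op (l.map Homog.val) ∈ D.grading (Homog.degree l + 1) :=
  ⟨qBracket_degree l, D.P_gr (derived_mem l)⟩

end VoronovData

namespace VoronovData

variable {𝕜 L : Type*} [Field 𝕜] [AddCommGroup L] [Module 𝕜 L] {D : VoronovData 𝕜 L}

/-! #### The higher Jacobi identities -/

/-- Sums over the splittings of a word of letters. -/
abbrev split {M : Type*} [AddCommGroup M] [Module 𝕜 M]
    (F : List D.Letter → List D.Letter → M) (l : List D.Letter) : M :=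
  splitSum 𝕜 Sigma.fst F l

/-- Polarized form of [e u, e v] = e[u,v]: each bracket with an element of 𝔞 is a derivation, so a
word of them is distributed over the two factors in all ways. -/
theorem split_nest_nest {i j : ℤ} {u v : L} (hu : u ∈ D.gr i) (hv : v ∈ D.gr j)
    (l : List D.Letter) :
    split (fun a b => sgn 𝕜 (Homog.degree a * j) •
      D.br (D.nest (a.map Homog.val) u) (D.nest (b.map Homog.val) v)) l =
        D.nest (l.map Homog.val) (D.br u v) := by
  induction l generalizing i j u v with
  | nil => simp [split, splitSum]
  | cons w l ih =>
    have h1 := ih (D.br_mem hu (ac_mem w)) hv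
    have h2 := ih hu (D.br_mem hv (ac_mem w))
    have h3 := congrArg (D.nest (l.map Homog.val)) (D.jac hu hv (ac_mem w))
    rw [map_add, map_smul, ← h1, ← h2] at h3
    refine Eq.trans ?_ h3.symm
    rw [split, splitSum, add_comm, split, split, ← splitSum_smul]
    congr 2
    · funext a b
      rw [smul_smul, ← sgn_add]
      congr 1
      exact sgn_eq_of_even_sub _ ⟨0, by ring⟩
    · funext a b
      rw [smul_smul, ← sgn_add]
      congr 1
      exact sgn_eq_of_even_sub _ ⟨0, by simp only [listDeg_cons]; ring⟩

/-- The sum over the letters of a word of the iterated brackets of `[u, x]`, where `x` is the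
component in `q` of this letter, with the components in `a` of the others. -/
def derivedBracket (e : ℤ) (u : L) : List D.Letter → L
  | [] => 0
  | w :: l => D.nest (l.map Homog.val) (D.br u (D.qc w)) +
      sgn 𝕜 (w.1 * e) • D.lam (D.ac w) (derivedBracket e u l)

/-- Polarized form of [e u, e q] = e[u,q] with q summed over the letters. The first letter acts on
`u`, supplies q, or acts on the second factor; `split_nest_nest` handles the middle case and
`lam_br` joins the outer ones. -/
theorem split_nest_derived {e : ℤ} {u : L} (hu : u ∈ D.gr e) (l : List D.Letter) :
    split (fun a b => sgn 𝕜 (Homog.degree a) •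
      D.br (D.nest (a.map Homog.val) u) (D.derived (b.map Homog.val))) l =
        derivedBracket e u l := by
  induction l with
  | nil => simp [split, splitSum, derivedBracket, derived]
  | cons w l ih =>
    rw [derivedBracket, ← ih, ← split_nest_nest hu (qc_mem w), split, split, split, map_splitSum,
      ← splitSum_smul, ← splitSum_add, splitSum, ← splitSum_add]
    congr 1
    funext a b
    have h := lam_br (ac_mem w) (nest_mem hu a) (derived_mem b)
    rw [lam_nest (ac_mem w) (Subtype.property _) hu, lam_eq_br (ac_mem w) hu] at h
    simp only [List.map_cons, nest_cons, derived, map_add, map_smul, h]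
    change _ • D.br (D.nest _ (D.br u (D.ac w))) _ +
      _ • _ • (D.br _ (D.nest _ (D.qc w)) + D.br _ (D.lam (D.ac w) _)) = _
    simp only [LinearMap.smul_apply, smul_add, smul_smul, ← sgn_add, listDeg_cons]
    rw [sgn_eq_of_even_sub 𝕜 (d := w.1 * e + (listDeg Sigma.fst a + (e + 1) * w.1))
        (e := w.1 + listDeg Sigma.fst a) ⟨w.1 * e, by ring⟩,
      sgn_eq_of_even_sub 𝕜 (d := w.1 * e + (listDeg Sigma.fst a + w.1 * (e + listDeg Sigma.fst a)))
        (e := w.1 * listDeg Sigma.fst a + listDeg Sigma.fst a) ⟨w.1 * e, by ring⟩,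
      sgn_eq_of_even_sub 𝕜 (d := listDeg Sigma.fst a * (w.1 + 1))
        (e := w.1 * listDeg Sigma.fst a + listDeg Sigma.fst a) ⟨0, by ring⟩]
    abel

/-- The same sum, organized by the one-letter subword that supplies the 𝔮-entry. This is the form in
which it appears when the first letter enters the binary bracket. -/
theorem split_unary {e : ℤ} {u : L} (hu : u ∈ D.gr e) (l : List D.Letter) :
    split (fun a b => D.nest (b.map Homog.val)
      (match a with
      | [x] => D.br u (D.qc x)
      | _ => 0)) l = derivedBracket e u l := by
  induction l with
  | nil => simp [split, splitSum, derivedBracket]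
  | cons w l ih =>
    rw [split, splitSum, derivedBracket, ← ih, splitSum_nil_left, split, map_splitSum,
      ← splitSum_smul]
    · congr 2
      funext a b
      rcases a with _ | ⟨x, _ | ⟨y, a⟩⟩
      · simp
      · have hx := D.br_mem hu (qc_mem x)
        change _ • D.nest _ (D.br (D.br u (D.qc x)) (D.ac w)) = _ • D.lam _ (D.nest _ _)
        rw [lam_nest (ac_mem w) (Subtype.property _) hx, br_eq_lam (ac_mem w) hx, map_smul,
          smul_smul, ← sgn_add]
        congr 1
        exact sgn_eq_of_even_sub _ ⟨(x.1 + 1) * w.1, by simp only [listDeg_cons, listDeg_nil]; ring⟩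
      · simp
    · intro a b ha
      rcases a with _ | ⟨x, a⟩
      · exact absurd rfl ha
      · simp

/-- The first letter is either an argument of the binary bracket, necessarily the first one, or it
acts through its 𝔞-component, and then its action can be moved to the outside. -/
theorem split_binary (w : D.Letter) (l : List D.Letter) :
    split (fun a b => D.nest (b.map Homog.val) (D.qBracket (a.map Homog.val))) (w :: l) =
      sgn 𝕜 (w.1 + 1) • derivedBracket (w.1 + 1) (D.qc w) l + sgn 𝕜 w.1 • D.lam (D.ac w)
        (split (fun a b => D.nest (b.map Homog.val) (D.qBracket (a.map Homog.val))) l) := by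
  rw [split, splitSum, ← split_unary (qc_mem w), split, split, map_splitSum, ← splitSum_smul,
    ← splitSum_smul]
  congr 2
  · funext a b
    rcases a with _ | ⟨x, _ | ⟨y, a⟩⟩
    · simp [qBracket]
    · change D.nest _ (D.br (D.E (D.qc w)) (D.qc x)) = _
      rw [D.E_apply (qc_mem w), map_smul, LinearMap.smul_apply, map_smul]
    · simp [qBracket]
  · funext a b
    have ha := qBracket_degree a
    change _ • D.nest _ (D.br _ (D.ac w)) = _
    rw [lam_nest (ac_mem w) (Subtype.property _) ha, br_eq_lam (ac_mem w) ha, map_smul,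
      smul_smul, ← sgn_add]
    congr 1
    exact sgn_eq_of_even_sub _ ⟨(listDeg Sigma.fst a + 1) * w.1, by ring⟩

/-- Polarized form of [e q, e q] = e[q,q]. The factor 2 appears because each pair of 𝔮-entries
occurs on the left in both orders, but is counted once on the right. -/
theorem split_derived (l : List D.Letter) :
    split (fun a b => sgn 𝕜 (Homog.degree a + 1) •
      D.br (D.derived (a.map Homog.val)) (D.derived (b.map Homog.val))) l =
    (2 : 𝕜) • split (fun a b => D.nest (b.map Homog.val) (D.qBracket (a.map Homog.val))) l := by
  induction l with
  | nil => simp [split, splitSum, derived, qBracket]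
  | cons w l ih =>
    have hZ := (split_nest_derived (qc_mem w) l).symm
    -- One of the two copies of the term with the 𝔮-entry of `w` is reflected, so that this entry
    -- stands in the second factor.
    have hZ' := hZ.trans (splitSum_symm _ _ l).symm
    rw [split_binary, smul_add, smul_comm _ (sgn 𝕜 w.1), ← map_smul, ← ih, two_smul,
      congrArg₂ (fun x y => sgn 𝕜 (w.1 + 1) • x + sgn 𝕜 (w.1 + 1) • y) hZ hZ',
      split, split, splitSum, map_splitSum, ← splitSum_smul, ← splitSum_smul,
      ← splitSum_smul, ← splitSum_add, ← splitSum_add, ← splitSum_add]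
    congr 1
    funext a b
    have h := lam_br (ac_mem w) (derived_mem a) (derived_mem b)
    have h' := D.skew (derived_mem a) (nest_mem (qc_mem w) b)
    simp only [List.map_cons, derived, map_add, LinearMap.add_apply, map_smul, smul_add]
    change _ • D.br (D.nest _ (D.qc w)) _ + _ • D.br (D.lam (D.ac w) _) _ +
      (_ • _ • D.br _ (D.nest _ (D.qc w)) + _ • _ • D.br _ (D.lam (D.ac w) _)) = _
    rw [h, h', smul_add, smul_add]
    simp only [smul_neg, smul_smul, ← sgn_add, listDeg_cons]
    have e1 : sgn 𝕜 (w.1 + 1 + (listDeg Sigma.fst a * listDeg Sigma.fst b + listDeg Sigma.fst b)) =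
        -sgn 𝕜 (w.1 * listDeg Sigma.fst a + (listDeg Sigma.fst a + 1 +
          (listDeg Sigma.fst a + 1) * (w.1 + 1 + listDeg Sigma.fst b))) := by
      rw [← neg_one_mul, ← sgn_one, ← sgn_add]
      exact sgn_eq_of_even_sub _
        ⟨-1 - listDeg Sigma.fst a - listDeg Sigma.fst a * w.1, by ring⟩
    rw [sgn_eq_of_even_sub 𝕜 (d := w.1 + (listDeg Sigma.fst a + 1 + w.1 * (listDeg Sigma.fst a + 1)))
        (e := w.1 * listDeg Sigma.fst a + (listDeg Sigma.fst a + 1)) ⟨w.1, by ring⟩, e1,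
      add_right_comm w.1 1 (listDeg Sigma.fst a), ← add_assoc w.1 _ (1 : ℤ)]
    module

/-- Applying P to `split_derived`, the compatibility of P with the bracket gives two halves, equal
after exchanging the subwords. Division by 2 shows that the terms through the binary bracket cancel
those through the 𝔞-component. -/
theorem split_projection [CharZero 𝕜] (l : List D.Letter) :
    D.P (split (fun a b => D.derived (D.op (a.map Homog.val) :: b.map Homog.val)) l) = 0 := by
  have hX := congrArg D.P (split_derived l)
  have h2 : D.P (split (fun a b => sgn 𝕜 (Homog.degree a + 1) •
      D.br (D.derived (a.map Homog.val)) (D.derived (b.map Homog.val))) l) =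
      (2 : 𝕜) • split (fun a b => sgn 𝕜 (Homog.degree a + 1) •
        D.P (D.br (D.P (D.derived (a.map Homog.val))) (D.derived (b.map Homog.val)))) l := by
    rw [two_smul]
    nth_rewrite 3 [split]
    rw [← splitSum_symm, split, split, map_splitSum, ← splitSum_add]
    congr 1
    funext a b
    rw [map_smul, D.P_br, smul_add, D.skew (derived_mem a) (D.P_gr (derived_mem b)), map_neg,
      map_smul, smul_neg, smul_smul, smul_smul, ← neg_smul, ← sgn_add, ← sgn_add,
      ← neg_one_mul, ← sgn_one, ← sgn_add]
    congr 2
    exact sgn_eq_of_even_sub _ ⟨listDeg Sigma.fst a + 1, by ring⟩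
  rw [h2, map_smul] at hX
  have hX' := smul_right_injective L (two_ne_zero (α := 𝕜)) hX
  have h3 : (fun a b : List D.Letter => D.derived (D.op (a.map Homog.val) :: b.map Homog.val)) =
      fun a b => D.nest (b.map Homog.val) (D.qBracket (a.map Homog.val)) +
        (-1 : 𝕜) • sgn 𝕜 (Homog.degree a + 1) •
          D.br (D.P (D.derived (a.map Homog.val))) (D.derived (b.map Homog.val)) := by
    funext a b
    rw [derived]
    congr 1
    change D.lam (D.P _) _ = _
    rw [lam_apply (D.P_gr (derived_mem a)), smul_smul]
    congr 1
    rw [← sgn_one, ← sgn_add, add_comm]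
  rw [h3, split, splitSum_add, splitSum_smul, map_add, map_smul, ← split, ← hX', split,
    map_splitSum]
  simp only [map_smul]
  rw [neg_one_smul, add_neg_cancel]

/-- Only words of three letters can contribute, and for them the sum is the graded Jacobi identity
on 𝔮 up to the desuspension signs. -/
theorem split_qBracket (l : List D.Letter) :
    split (fun a b => D.qBracket (D.op (a.map Homog.val) :: b.map Homog.val)) l = 0 := by
  by_cases h : l.length = 3
  · obtain ⟨x, y, z, rfl⟩ := List.length_eq_three.1 h
    have hx := qc_mem x
    have hy := qc_mem y
    have hz := qc_mem z
    have e1 : ∀ a b c : D.Letter, D.qBracket [D.op [a.val, b.val], c.val] =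
      (sgn 𝕜 (a.1 + 1) * sgn 𝕜 (a.1 + 1 + (b.1 + 1))) • D.br (D.br (D.qc a) (D.qc b)) (D.qc c) := by
      intro a b c
      change D.br (D.E (D.br (D.E (D.qc a)) (D.qc b))) (D.qc c) = _
      rw [D.E_apply (qc_mem a), map_smul, LinearMap.smul_apply, map_smul,
        D.E_apply (D.br_mem (qc_mem a) (qc_mem b))]
      simp only [map_smul, LinearMap.smul_apply, smul_smul]
    have hj := D.jac hx hy hz
    have hs := D.skew hx (D.br_mem hy hz)
    simp only [split, splitSum, List.map_cons, List.map_nil, e1]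
    simp only [qBracket, listDeg_cons, listDeg_nil]
    rw [hs] at hj
    rw [hj]
    simp only [mul_zero, sgn_zero, smul_zero, add_zero, zero_add, smul_add, smul_neg,
      smul_smul, ← sgn_add]
    have e4 : sgn 𝕜 (x.1 * (y.1 + z.1) + (y.1 + 1 + (y.1 + 1 + (z.1 + 1)))) =
        sgn 𝕜 (x.1 + 1 + (x.1 + 1 + (y.1 + 1)) + (x.1 + 1) * (y.1 + 1 + (z.1 + 1))) :=
      sgn_eq_of_even_sub _ ⟨-2 * x.1 - 1, by ring⟩
    have e5 : sgn 𝕜 (y.1 * z.1 + (x.1 + 1 + (x.1 + 1 + (z.1 + 1)))) =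
        -sgn 𝕜 (x.1 + 1 + (x.1 + 1 + (y.1 + 1)) + (y.1 + 1) * (z.1 + 1)) := by
      rw [← neg_one_mul, ← sgn_one, ← sgn_add]
      exact sgn_eq_of_even_sub _ ⟨-y.1 - 1, by ring⟩
    rw [e4, e5]
    module
  · refine splitSum_eq_zero _ fun a b hab => ?_
    by_cases ha : a.length = 2
    · rw [qBracket_eq_zero]
      simp; omega
    · by_cases hb : b.length = 1
      · obtain ⟨z, rfl⟩ := List.length_eq_one_iff.1 hb
        change D.br (D.E (D.qBracket (a.map Homog.val))) _ = 0
        rw [qBracket_eq_zero _ (by simpa), map_zero, map_zero, LinearMap.zero_apply]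
      · rw [qBracket_eq_zero]
        simpa

end VoronovData

theorem VoronovData.op_isListLInfinity {𝕜 L : Type*} [Field 𝕜] [CharZero 𝕜] [AddCommGroup L]
    [Module 𝕜 L] (D : VoronovData 𝕜 L) (h : DirectSum.IsInternal D.grading) :
    IsListLInfinity D.grading D.op where
  internal := h
  additive := D.op_additive
  homogeneous := D.op_homogeneous
  degree_one := op_degree
  symmetric := op_swap
  nil := space_ext rfl (map_zero D.P)
  jacobi l := by
    apply space_ext
    · exact (map_splitSum _ (D.q.subtype ∘ₗ LinearMap.fst 𝕜 D.q D.a) _ l).trans (split_qBracket l)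
    · refine (map_splitSum _ (D.a.subtype ∘ₗ LinearMap.snd 𝕜 D.q D.a) _ l).trans ?_
      exact (map_splitSum _ D.P _ l).symm.trans (split_projection l)

/-! ### Twisting -/

section Twist

variable {𝕜 : Type*} [Field 𝕜] {T : Type*} [AddCommGroup T] [Module 𝕜 T]

theorem splitSum_finsum {Y ι M : Type*} [AddCommGroup M] [Module 𝕜 M] (deg : Y → ℤ)
    {G : ι → List Y → List Y → M} (h : ∀ a b, (Function.support fun i => G i a b).Finite)
    (l : List Y) : (Function.support fun i => splitSum 𝕜 deg (G i) l).Finite ∧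
      splitSum 𝕜 deg (fun a b => ∑ᶠ i, G i a b) l = ∑ᶠ i, splitSum 𝕜 deg (G i) l := by
  induction l generalizing G with
  | nil => exact ⟨h [] [], rfl⟩
  | cons y l ih =>
    obtain ⟨h1, h1'⟩ := ih (G := fun i a b => G i (y :: a) b) fun a b => h _ _
    obtain ⟨h2, h2'⟩ := ih (G := fun i a b => sgn 𝕜 (deg y * listDeg deg a) • G i a (y :: b))
      fun a b => (h a (y :: b)).subset (Function.support_const_smul_subset _ _)
    refine ⟨(h1.union h2).subset (Function.support_add _ _), ?_⟩
    simp only [splitSum]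
    rw [finsum_add_distrib h1 h2, h1', ← h2']
    simp only [smul_finsum]

/-- Letters of degree 0 move without sign, so only the number of copies sent to each side matters;
hence the binomial coefficient. -/
theorem splitSum_replicate {Y M : Type*} [AddCommGroup M] [Module 𝕜 M] (deg : Y → ℤ) {z : Y}
    (hz : deg z = 0) (n : ℕ) (G : List Y → List Y → M) (l : List Y) :
    splitSum 𝕜 deg G (List.replicate n z ++ l) =
      ∑ p ∈ Finset.HasAntidiagonal.antidiagonal n, n.choose p.1 •
        splitSum 𝕜 deg (fun a b => G (List.replicate p.1 z ++ a) (List.replicate p.2 z ++ b)) l := by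
  induction n generalizing G with
  | zero => simp
  | succ n ih =>
    rw [Finset.sum_antidiagonal_choose_succ_nsmul
      (fun r s => splitSum 𝕜 deg (fun a b => G (List.replicate r z ++ a) (List.replicate s z ++ b)) l),
      List.replicate_succ, List.cons_append, splitSum, ih, add_comm]
    simp only [hz, zero_mul, sgn_zero, one_smul]
    rw [ih]
    refine congrArg (_ + ·) (Finset.sum_congr rfl fun p hp => ?_)
    rw [Nat.choose_symm_of_eq_add (Finset.HasAntidiagonal.mem_antidiagonal.1 hp).symm]
    rfl

theorem finsum_eq_zero_of_antidiagonal {M : Type*} [AddCommGroup M] {f : ℕ × ℕ → M}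
    (hf : (Function.support f).Finite)
    (h : ∀ n, ∑ p ∈ Finset.HasAntidiagonal.antidiagonal n, f p = 0) : ∑ᶠ p, f p = 0 := by
  classical
  rw [finsum_eq_sum f hf, ← Finset.sum_fiberwise_of_maps_to (g := fun p => p.1 + p.2)
    (fun p hp => Finset.mem_image_of_mem _ hp)]
  refine Finset.sum_eq_zero fun n _ => ?_
  rw [← h n]
  refine Finset.sum_subset (fun p hp => ?_) fun p hp hp' => ?_
  · simpa using (Finset.mem_filter.1 hp).2
  · by_contra h0
    refine hp' (Finset.mem_filter.2 ⟨?_, by simpa using hp⟩)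
    simpa using h0

/-- The functional on lists that gives the operations twisted by `θ`. -/
def listTwist (𝕜 : Type*) [Field 𝕜] {T : Type*} [AddCommGroup T] [Module 𝕜 T] (F : List T → T)
    (θ : T) (l : List T) : T :=
  ∑ᶠ n : ℕ, ((n ! : ℕ) : 𝕜)⁻¹ • F (List.replicate n θ ++ l)

theorem twist_eq_listTwist (F : List T → T) (θ : T) :
    twist 𝕜 (fun k x => F (List.ofFn (n := k) x)) θ =
      fun k x => listTwist 𝕜 F θ (List.ofFn (n := k) x) := by
  funext k x
  simp only [twist, listTwist, List.ofFn_fin_append, List.ofFn_const]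

variable {𝒜 : ℤ → Submodule 𝕜 T} {F : List T → T} {θ : T}

theorem support_term (hf : ∀ l, {n : ℕ | F (List.replicate n θ ++ l) ≠ 0}.Finite) (l : List T) :
    (Function.support fun n : ℕ => ((n ! : ℕ) : 𝕜)⁻¹ • F (List.replicate n θ ++ l)).Finite :=
  (hf l).subset fun n hn h0 => hn (by simp only [h0, smul_zero])

theorem listTwist_additive (hF : ListAdditive F)
    (hf : ∀ l, {n : ℕ | F (List.replicate n θ ++ l) ≠ 0}.Finite) :
    ListAdditive (listTwist 𝕜 F θ) := by
  intro a x y b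
  rw [listTwist, listTwist, listTwist, ← finsum_add_distrib (support_term hf _) (support_term hf _)]
  refine finsum_congr fun n => ?_
  rw [← List.append_assoc, hF, smul_add, List.append_assoc, List.append_assoc]

theorem listTwist_homogeneous (hF : ∀ a (c : 𝕜) x b, F (a ++ (c • x) :: b) = c • F (a ++ x :: b))
    (a : List T) (c : 𝕜) (x : T) (b : List T) :
    listTwist 𝕜 F θ (a ++ (c • x) :: b) = c • listTwist 𝕜 F θ (a ++ x :: b) := by
  rw [listTwist, listTwist, smul_finsum]
  refine finsum_congr fun n => ?_
  rw [← List.append_assoc, hF, smul_comm, List.append_assoc]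

namespace IsListLInfinity

theorem listTwist_degree (h : IsListLInfinity 𝒜 F) (hθ : θ ∈ 𝒜 0) (l : List (Homog 𝒜)) :
    listTwist 𝕜 F θ (l.map Homog.val) ∈ 𝒜 (Homog.degree l + 1) := by
  refine finsum_induction (p := fun x => x ∈ 𝒜 (Homog.degree l + 1)) (zero_mem _)
    (fun _ _ => add_mem) fun n => Submodule.smul_mem _ _ ?_
  have := h.degree_one (List.replicate n ⟨0, θ, hθ⟩ ++ l)
  rw [List.map_append, List.map_replicate] at this
  simpa [Homog.degree, listDeg, Homog.val] using this

/-- Twisting inserts the copies of `θ` at the front, while the Jacobi identity wants the inner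
operation there. Degree 0 makes the exchange free of signs. -/
theorem move_replicate (h : IsListLInfinity 𝒜 F) (hθ : θ ∈ 𝒜 0) (n : ℕ) (x : Homog 𝒜)
    (b : List (Homog 𝒜)) : F (List.replicate n θ ++ x.val :: b.map Homog.val) =
      F (x.val :: (List.replicate n θ ++ b.map Homog.val)) := by
  have := move_to_front (𝕜 := 𝕜) Sigma.fst (G := fun l => F (l.map (Homog.val (𝒜 := 𝒜))))
    h.symmetric x (List.replicate n ⟨0, θ, hθ⟩) b
  simpa [listDeg, Homog.val] using this

/-- The twist of an `L_∞`-algebra by a Maurer–Cartan element, if all series are finite. -/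
theorem listTwist [CharZero 𝕜] (h : IsListLInfinity 𝒜 F) (hθ : θ ∈ 𝒜 0)
    (hf : ∀ l, {n : ℕ | F (List.replicate n θ ++ l) ≠ 0}.Finite)
    (h0 : listTwist 𝕜 F θ [] = 0) : IsListLInfinity 𝒜 (listTwist 𝕜 F θ) where
  internal := h.internal
  additive := listTwist_additive h.additive hf
  homogeneous := listTwist_homogeneous h.homogeneous
  degree_one := h.listTwist_degree hθ
  symmetric a x y b := by
    rw [HomLL.listTwist, HomLL.listTwist, smul_finsum]
    refine finsum_congr fun n => ?_
    have := h.symmetric (List.replicate n ⟨0, θ, hθ⟩ ++ a) x y b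
    rw [List.append_assoc, List.append_assoc, List.map_append (l₂ := a ++ x :: y :: b),
      List.map_append (l₂ := a ++ y :: x :: b), List.map_replicate] at this
    rw [smul_comm]
    exact congrArg _ this
  nil := h0
  jacobi l := by
    let z : Homog 𝒜 := ⟨0, θ, hθ⟩
    let c : ℕ → 𝕜 := fun n => ((n ! : ℕ) : 𝕜)⁻¹
    -- The terms of the double series, with `p.1` copies of `θ` in the inner and `p.2` copies in the
    -- outer operation.
    let G : ℕ × ℕ → List (Homog 𝒜) → List (Homog 𝒜) → T := fun p a b =>
      (c p.1 * c p.2) • F (F (List.replicate p.1 θ ++ a.map Homog.val) ::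
        (List.replicate p.2 θ ++ b.map Homog.val))
    have hx : ∀ r (a : List (Homog 𝒜)), F (List.replicate r θ ++ a.map Homog.val) ∈
        𝒜 (Homog.degree a + 1) := fun r a => by
      have := h.degree_one (List.replicate r ⟨0, θ, hθ⟩ ++ a)
      rw [List.map_append, List.map_replicate] at this
      simpa [Homog.degree, listDeg, Homog.val] using this
    have hm : ∀ r s (a b : List (Homog 𝒜)), F (List.replicate s θ ++
        F (List.replicate r θ ++ a.map Homog.val) :: b.map Homog.val) =
        F (F (List.replicate r θ ++ a.map Homog.val) ::
          (List.replicate s θ ++ b.map Homog.val)) := fun r s a b =>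
      h.move_replicate hθ s ⟨_, _, hx r a⟩ b
    have hG : ∀ a b, (Function.support fun p => G p a b).Finite := by
      intro a b
      refine ((hf (a.map Homog.val)).biUnion fun r _ =>
        (Set.finite_singleton r).prod (hf (F (List.replicate r θ ++ a.map Homog.val) ::
          b.map Homog.val))).subset ?_
      rintro ⟨r, s⟩ hp
      have hr : F (List.replicate r θ ++ a.map Homog.val) ≠ 0 := fun h0 => hp (by
        simp only [G, h0]
        rw [show F (0 :: _) = 0 from h.additive.map_zero [] _, smul_zero])
      refine Set.mem_biUnion hr ⟨rfl, fun h0 => hp ?_⟩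
      simp only [G]
      rw [← hm, h0, smul_zero]
    have e : ∀ a b : List (Homog 𝒜), HomLL.listTwist 𝕜 F θ (HomLL.listTwist 𝕜 F θ (a.map Homog.val) ::
        b.map Homog.val) = ∑ᶠ p, G p a b := by
      intro a b
      let f : T →ₗ[𝕜] T :=
        { toFun := fun x => HomLL.listTwist 𝕜 F θ (x :: b.map Homog.val)
          map_add' := fun x y => listTwist_additive h.additive hf [] x y _
          map_smul' := fun k x => listTwist_homogeneous h.homogeneous [] k x _ }
      rw [finsum_curry _ (hG a b)]
      change f (∑ᶠ n : ℕ, c n • F (List.replicate n θ ++ a.map Homog.val)) = _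
      rw [map_finsum f (support_term hf _)]
      refine finsum_congr fun r => ?_
      rw [map_smul]
      change c r • ∑ᶠ s : ℕ, c s • _ = _
      rw [smul_finsum]
      refine finsum_congr fun s => ?_
      rw [hm, smul_smul]
    simp only [e]
    obtain ⟨h1, h2⟩ := splitSum_finsum (𝕜 := 𝕜) Sigma.fst hG l
    rw [h2]
    refine finsum_eq_zero_of_antidiagonal h1 fun n => ?_
    -- The terms with n copies of `θ` in total form 1/n! times the untwisted Jacobi identity on n
    -- copies of `θ` followed by `l`, since 1/(r!s!) = binom(n,r)/n! for r + s = n.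
    have hj := h.jacobi (List.replicate n z ++ l)
    rw [splitSum_replicate Sigma.fst rfl] at hj
    have hc : c n ≠ 0 := inv_ne_zero (Nat.cast_ne_zero.2 n.factorial_ne_zero)
    rw [← smul_zero (c n), ← hj, Finset.smul_sum]
    refine Finset.sum_congr rfl fun p hp => ?_
    rw [Finset.HasAntidiagonal.mem_antidiagonal] at hp
    have hk : c p.1 * c p.2 = c n * (n.choose p.1 : 𝕜) := by
      simp only [c]
      rw [← hp, Nat.choose_symm_add, Nat.add_choose, Nat.cast_div (Nat.factorial_mul_factorial_dvd_factorial_add _ _)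
        (by simp [Nat.factorial_ne_zero])]
      have := Nat.cast_ne_zero (R := 𝕜).2 (Nat.factorial_ne_zero p.1)
      have := Nat.cast_ne_zero (R := 𝕜).2 (Nat.factorial_ne_zero p.2)
      have := Nat.cast_ne_zero (R := 𝕜).2 (Nat.factorial_ne_zero (p.1 + p.2))
      push_cast
      field_simp
    rw [← Nat.cast_smul_eq_nsmul 𝕜, smul_smul, ← hk, ← splitSum_smul]
    simp only [G, List.map_append, List.map_replicate]
    rfl

end IsListLInfinity

end Twist

/-! ### The higher derived brackets on `s⁻¹q ⊕ a` -/

section TripleSpace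

variable {𝕜 : Type*} [Field 𝕜]
variable {g : Type*} [AddCommGroup g] [Module 𝕜 g] {V : Type*} [AddCommGroup V] [Module 𝕜 V]
variable {α : g →ₗ[𝕜] g} {β : V →ₗ[𝕜] V}

variable (α β) in
/-- The involution of `𝔩` that is `(-1)^n` in degree `n`. -/
def degreeInvolution : LSpace α β →ₗ[𝕜] LSpace α β :=
  DirectSum.lmap (fun n => ((-1 : 𝕜) ^ n) • LinearMap.id)

theorem degreeInvolution_apply (x : LSpace α β) (n : ℕ) :
    degreeInvolution α β x n = ((-1 : 𝕜) ^ n) • x n := by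
  simp [degreeInvolution, DirectSum.lmap_apply]

variable (α β) in
/-- Balavoine's bracket with the data that define the higher derived brackets. -/
def voronovData : VoronovData 𝕜 (LSpace α β) where
  br := balavoineBracket _
  gr := homogeneousPart _
  E := degreeInvolution α β
  P := projA α β
  q := qSpace α β
  a := aSpace α β
  br_mem := bracket_mem
  skew := bracket_skew
  jac := bracket_jacobi
  E_apply {i x} hx := DFinsupp.ext fun n => by
    refine (degreeInvolution_apply x n).trans ?_
    by_cases h : (n : ℤ) = i
    · rw [← h, sgn_natCast]; rfl
    · have h1 : (sgn 𝕜 i • x) n = sgn 𝕜 i • x n := DirectSum.smul_apply _ _ _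
      rw [hx n h, smul_zero]
      exact ((h1.trans (by rw [hx n h, smul_zero])).symm : _)
  br_q := bracket_qSpace
  E_q hx := mem_qSpace.2 fun n => by
    rw [degreeInvolution_apply]
    exact Submodule.smul_mem _ _ (mem_qSpace.1 hx n)
  br_a := bracket_aSpace
  P_mem := projA_mem
  P_gr := projA_homogeneous
  P_br := projA_bracket

theorem degreeInvolution_aSpace {x : LSpace α β} (hx : x ∈ aSpace α β) :
    degreeInvolution α β x ∈ aSpace α β := mem_aSpace.2 fun n => by
  rw [degreeInvolution_apply]
  exact Submodule.smul_mem _ _ (mem_aSpace.1 hx n)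

/-- The element of `q` given by an element of one degree. -/
def qElement {n : ℕ} {f : CochainSpace (α.prodMap β) n} (hf : f ∈ qPart α β n) : qSpace α β :=
  ⟨inDegree _ n f, lof_mem_of_mem (qPart α β) n hf⟩

/-- The element of `a` given by an element of one degree. -/
def aElement {n : ℕ} {f : CochainSpace (α.prodMap β) n} (hf : f ∈ aPart α β n) : aSpace α β :=
  ⟨inDegree _ n f, lof_mem_of_mem (aPart α β) n hf⟩

theorem eq_top_of_elements {N : Submodule 𝕜 (TripleSpace α β)}
    (hq : ∀ n (f : CochainSpace (α.prodMap β) n) (hf : f ∈ qPart α β n), (qElement hf, 0) ∈ N)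
    (ha : ∀ n (f : CochainSpace (α.prodMap β) n) (hf : f ∈ aPart α β n), (0, aElement hf) ∈ N) :
    N = ⊤ := by
  rw [eq_top_iff]
  rintro ⟨x, p⟩ -
  have h1 : (x : LSpace α β) ∈
      (N.comap (LinearMap.inl 𝕜 (qSpace α β) (aSpace α β))).map (qSpace α β).subtype :=
    mem_of_components fun n => ⟨_, hq n _ (mem_qSpace.1 x.2 n), rfl⟩
  have h2 : (p : LSpace α β) ∈
      (N.comap (LinearMap.inr 𝕜 (qSpace α β) (aSpace α β))).map (aSpace α β).subtype :=
    mem_of_components fun n => ⟨_, ha n _ (mem_aSpace.1 p.2 n), rfl⟩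
  obtain ⟨x', hx', h⟩ := h1
  obtain ⟨p', hp', h'⟩ := h2
  obtain rfl : x' = x := Subtype.ext h
  obtain rfl : p' = p := Subtype.ext h'
  have h1 : ((x', 0) : TripleSpace α β) + (0, p') ∈ N := N.add_mem hx' hp'
  simpa using h1

theorem qElement_mem {n : ℕ} {f : CochainSpace (α.prodMap β) n} (hf : f ∈ qPart α β n) :
    ((qElement hf, 0) : TripleSpace α β) ∈ tripleGrading α β (n - 1) := by
  refine ⟨?_, zero_mem (homogeneousPart (α.prodMap β) _)⟩
  change inDegree _ n f ∈ homogeneousPart _ _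
  rw [sub_add_cancel]
  exact inDegree_mem n f

theorem aElement_mem {n : ℕ} {f : CochainSpace (α.prodMap β) n} (hf : f ∈ aPart α β n) :
    ((0, aElement hf) : TripleSpace α β) ∈ tripleGrading α β n :=
  ⟨zero_mem (homogeneousPart (α.prodMap β) _), inDegree_mem n f⟩

/-- A linear map that vanishes outside degree `j` reads off the component of degree `j` from a sum.
This yields injectivity of the summation map. -/
theorem eval_eq_of_mem {M : Type*} [AddCommGroup M] [Module 𝕜 M] {𝒜 : ℤ → Submodule 𝕜 M}
    {N : Type*} [AddCommGroup N] [Module 𝕜 N] (f : M →ₗ[𝕜] N) {j : ℤ}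
    (h : ∀ i, i ≠ j → ∀ x ∈ 𝒜 i, f x = 0) (x : ⨁ i, 𝒜 i) :
    f (DirectSum.coeLinearMap 𝒜 x) = f (x j) := by
  classical
  induction x using DirectSum.induction_on with
  | zero => simp
  | of i x =>
    rw [DirectSum.coeLinearMap_of]
    by_cases hi : i = j
    · subst hi; rw [DirectSum.of_eq_same]
    · rw [DirectSum.of_eq_of_ne _ _ _ (Ne.symm hi), h i hi _ x.2]; simp
  | add x y hx hy => rw [map_add, map_add, hx, hy, DirectSum.add_apply]; simp

theorem tripleGrading_isInternal : DirectSum.IsInternal (tripleGrading α β) := by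
  classical
  constructor
  · change Function.Injective (DirectSum.coeLinearMap (tripleGrading α β))
    intro x y hxy
    refine DFinsupp.ext fun j => Subtype.ext (Prod.ext (Subtype.ext ?_) (Subtype.ext ?_))
    · refine DFinsupp.ext fun n => ?_
      by_cases hn : (n : ℤ) = j + 1
      · have h := eval_eq_of_mem (𝒜 := tripleGrading α β) (DirectSum.component 𝕜 ℕ _ n ∘ₗ
          (qSpace α β).subtype ∘ₗ LinearMap.fst 𝕜 _ _) (j := j)
          (fun i hi y hy => hy.1 n (by omega))
        exact (h x).symm.trans ((congrArg _ hxy).trans (h y))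
      · exact ((x j).2.1 n hn).trans ((y j).2.1 n hn).symm
    · refine DFinsupp.ext fun n => ?_
      by_cases hn : (n : ℤ) = j
      · have h := eval_eq_of_mem (𝒜 := tripleGrading α β) (DirectSum.component 𝕜 ℕ _ n ∘ₗ
          (aSpace α β).subtype ∘ₗ LinearMap.snd 𝕜 _ _) (j := j)
          (fun i hi y hy => hy.2 n (by omega))
        exact (h x).symm.trans ((congrArg _ hxy).trans (h y))
      · exact ((x j).2.2 n hn).trans ((y j).2.2 n hn).symm
  · change Function.Surjective (DirectSum.coeLinearMap (tripleGrading α β))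
    rw [← LinearMap.range_eq_top]
    refine eq_top_of_elements (fun n f hf => ?_) fun n f hf => ?_
    · exact ⟨DirectSum.of (fun i => tripleGrading α β i) _ ⟨_, qElement_mem hf⟩,
        DirectSum.coeLinearMap_of _ _ _⟩
    · exact ⟨DirectSum.of (fun i => tripleGrading α β i) _ ⟨_, aElement_mem hf⟩,
        DirectSum.coeLinearMap_of _ _ _⟩

variable (α β) in
/-- The higher derived brackets on `s⁻¹q ⊕ a`, as a functional on lists. -/
def derivedOp : List (TripleSpace α β) → TripleSpace α β := (voronovData α β).op

variable (α β) in
theorem derivedOp_isListLInfinity [CharZero 𝕜] :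
    IsListLInfinity (tripleGrading α β) (derivedOp α β) :=
  (voronovData α β).op_isListLInfinity tripleGrading_isInternal

/-! #### Finiteness -/

/-- Each term starts from one 𝔮-component and takes one bracket with 𝔞 for every other letter, hence
length minus one drops. The families used for `M` are the weight spaces and the filtration by weight
at most w. -/
theorem derived_mem_filtration {M : ℤ → Submodule 𝕜 (LSpace α β)}
    (h : ∀ w, ∀ u ∈ M w, ∀ p ∈ aSpace α β, balavoineBracket _ u p ∈ M (w - 1))
    (h' : ∀ w, ∀ u ∈ M w, ∀ p ∈ aSpace α β, balavoineBracket _ p u ∈ M (w - 1)) {w : ℤ}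
    {l : List (TripleSpace α β)} (hl : ∀ x ∈ l, (x.1 : LSpace α β) ∈ M w) :
    (voronovData α β).derived l ∈ M (w + 1 - l.length) := by
  have hn : ∀ (l : List (TripleSpace α β)) (w : ℤ) (u : LSpace α β), u ∈ M w →
      (voronovData α β).nest l u ∈ M (w - l.length) := by
    intro l
    induction l with
    | nil =>
      intro w u hu
      rw [List.length_nil, Nat.cast_zero, sub_zero]
      exact hu
    | cons x l ih =>
      intro w u hu
      have := ih _ _ (h w u hu _ x.2.2)
      rwa [sub_sub, add_comm, ← Nat.cast_succ] at this
  induction l with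
  | nil => exact zero_mem _
  | cons x l ih =>
    have h1 := hn l w _ (hl x (by simp))
    have h2 := h' _ _ (ih fun y hy => hl y (by simp [hy])) _ (degreeInvolution_aSpace x.2.2)
    have e : w + 1 - (x :: l).length = w - l.length := by push_cast [List.length_cons]; ring
    have e' : w + 1 - l.length - 1 = w - l.length := by ring
    rw [e]
    rw [e'] at h2
    exact add_mem h1 (neg_mem h2)

theorem aSpace_weight [CharZero 𝕜] {x : LSpace α β} (hx : x ∈ aSpace α β) :
    x ∈ weightPart α β (-1) :=
  mem_of_components fun n => aPart_weight (mem_aSpace.1 hx n)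

/-- If all components in `q` have weight `w`, only the operations with `2` or `w + 2` inputs can
be nonzero. -/
theorem derivedOp_eq_zero_of_weight [CharZero 𝕜] {w : ℤ} {l : List (TripleSpace α β)}
    (hl : ∀ x ∈ l, (x.1 : LSpace α β) ∈ weightPart α β w) (h2 : l.length ≠ 2)
    (hw : (l.length : ℤ) ≠ w + 2) : derivedOp α β l = 0 := by
  refine VoronovData.space_ext ((voronovData α β).qBracket_eq_zero h2) ?_
  refine projA_weight (w := w + 1 - l.length) (by omega)
    (derived_mem_filtration (fun w u hu p hp => ?_) (fun w u hu p hp => ?_) hl)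
  · exact bracket_weight hu (aSpace_weight hp)
  · rw [sub_eq_neg_add]
    exact bracket_weight (aSpace_weight hp) hu

variable (α β) in
/-- The sum of the parts of weight at most `w`. -/
def weightLE (w : ℤ) : Submodule 𝕜 (LSpace α β) := ⨆ i : Set.Iic w, weightPart α β i

theorem weightPart_le {i w : ℤ} (h : i ≤ w) : weightPart α β i ≤ weightLE α β w :=
  le_iSup (fun i : Set.Iic w => weightPart α β i) ⟨i, h⟩

theorem weightLE_le {w : ℤ} {N : Submodule 𝕜 (LSpace α β)} (h : ∀ i ≤ w, weightPart α β i ≤ N) :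
    weightLE α β w ≤ N := iSup_le fun i => h i.1 i.2

/-- Inhomogeneous elements of 𝔮 mix several weights, but an upper bound suffices: enough brackets
bring every weight below -1. -/
theorem derivedOp_eq_zero_of_weightLE [CharZero 𝕜] {w : ℤ} {l : List (TripleSpace α β)}
    (hl : ∀ x ∈ l, (x.1 : LSpace α β) ∈ weightLE α β w) (h2 : 2 < l.length)
    (hw : w + 2 < l.length) : derivedOp α β l = 0 := by
  refine VoronovData.space_ext ((voronovData α β).qBracket_eq_zero h2.ne') ?_
  have h := derived_mem_filtration (M := weightLE α β) (fun w u hu p hp => ?_)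
    (fun w u hu p hp => ?_) hl
  · refine (weightLE_le (N := LinearMap.ker (projA α β)) fun i hi x hx => ?_) h
    exact projA_weight (by omega) hx
  · refine (weightLE_le (N := (weightLE α β (w - 1)).comap ((balavoineBracket _).flip p))
      fun i hi x hx => ?_) hu
    exact weightPart_le (by omega) (bracket_weight hx (aSpace_weight hp))
  · refine (weightLE_le (N := (weightLE α β (w - 1)).comap (balavoineBracket _ p))
      fun i hi x hx => ?_) hu
    exact weightPart_le (by omega) (bracket_weight (aSpace_weight hp) hx)

theorem exists_weightLE {x : LSpace α β} (hx : x ∈ qSpace α β) :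
    ∃ N : ℕ, ∀ w : ℤ, N ≤ w → x ∈ weightLE α β w := by
  classical
  refine ⟨x.support.sup id, fun w hw => mem_of_components fun n => ?_⟩
  by_cases hn : x n = 0
  · rw [hn, map_zero]; exact zero_mem _
  · have h1 : n ≤ x.support.sup id := Finset.le_sup (f := id) (DFinsupp.mem_support_iff.2 hn)
    exact weightPart_le (le_trans (by exact_mod_cast h1) hw) (qPart_weight (mem_qSpace.1 hx n))

/-- On words in finitely many elements, the operations with many inputs vanish. -/
theorem exists_derivedOp_eq_zero [CharZero 𝕜] (s : List (TripleSpace α β)) :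
    ∃ N : ℕ, ∀ l : List (TripleSpace α β), (∀ x ∈ l, x ∈ s) → N ≤ l.length →
      derivedOp α β l = 0 := by
  have h : ∃ N : ℕ, ∀ w : ℤ, N ≤ w → ∀ x ∈ s, (x.1 : LSpace α β) ∈ weightLE α β w := by
    induction s with
    | nil => exact ⟨0, by simp⟩
    | cons x s ih =>
      obtain ⟨N, hN⟩ := ih
      obtain ⟨N', hN'⟩ := exists_weightLE x.1.2
      refine ⟨max N N', fun w hw => ?_⟩
      rw [Nat.cast_max] at hw
      simp only [List.mem_cons, forall_eq_or_imp]
      exact ⟨hN' w (le_trans (le_max_right _ _) hw), hN w (le_trans (le_max_left _ _) hw)⟩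
  obtain ⟨N, hN⟩ := h
  -- Length at least `N + 3` exceeds both 2, where the binary bracket lives, and `N + 2`.
  refine ⟨N + 3, fun l hl hlen => ?_⟩
  exact derivedOp_eq_zero_of_weightLE (w := N) (fun x hx => hN _ le_rfl x (hl x hx)) (by omega)
    (by omega)

theorem derivedOp_finite [CharZero 𝕜] (θ : TripleSpace α β) (l : List (TripleSpace α β)) :
    {n : ℕ | derivedOp α β (List.replicate n θ ++ l) ≠ 0}.Finite := by
  obtain ⟨N, hN⟩ := exists_derivedOp_eq_zero (θ :: l)
  refine (Set.finite_Iio N).subset fun n hn => ?_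
  by_contra hlt
  rw [Set.mem_Iio, not_lt] at hlt
  refine hn (hN _ (fun x hx => ?_) (by simp; omega))
  rcases List.mem_append.1 hx with h | h
  · rw [List.eq_of_mem_replicate h]; simp
  · simp [h]

theorem mcSeriesFinite_derivedOp [CharZero 𝕜] (θ : TripleSpace α β) :
    MCSeriesFinite (fun k x => derivedOp α β (List.ofFn (n := k) x)) θ := by
  refine (derivedOp_finite θ []).subset fun k hk => ?_
  have := hk.2
  beta_reduce at this
  rwa [List.ofFn_const, ← List.append_nil (List.replicate k θ)] at this

theorem twistSeriesFinite_derivedOp [CharZero 𝕜] (θ : TripleSpace α β) :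
    TwistSeriesFinite (fun k x => derivedOp α β (List.ofFn (n := k) x)) θ := by
  intro k _ x
  refine (derivedOp_finite θ (List.ofFn x)).subset fun n hn => ?_
  simp only [Set.mem_ofPred_eq, List.ofFn_fin_append, List.ofFn_const] at hn
  exact hn

/-- Every twisted operation is itself a series in `θ`, so a bound uniform in the number of copies is
needed; it holds for all words in `θ` and `θ'`. -/
theorem listTwist_derivedOp_finite [CharZero 𝕜] (θ θ' : TripleSpace α β) :
    {k : ℕ | listTwist 𝕜 (derivedOp α β) θ (List.replicate k θ') ≠ 0}.Finite := by
  obtain ⟨N, hN⟩ := exists_derivedOp_eq_zero [θ, θ']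
  refine (Set.finite_Iio N).subset fun k hk => ?_
  by_contra hlt
  rw [Set.mem_Iio, not_lt] at hlt
  refine hk ?_
  rw [listTwist]
  refine finsum_eq_zero_of_forall_eq_zero fun n => ?_
  rw [hN _ (fun x hx => ?_) (by simp; omega), smul_zero]
  rcases List.mem_append.1 hx with h | h <;> rw [List.eq_of_mem_replicate h] <;> simp

end TripleSpace

/-! ### Characterization of the higher derived brackets -/

theorem multilinear_ext_of_span {R ι M N : Type*} [Field R] [Fintype ι] [AddCommGroup M]
    [Module R M] [AddCommGroup N] [Module R N] {S : Set M} (hS : Submodule.span R S = ⊤)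
    {f f' : MultilinearMap R (fun _ : ι => M) N} (h : ∀ x, (∀ i, x i ∈ S) → f x = f' x) :
    f = f' := by
  classical
  -- Induction on the set of positions where the entry is no longer required to lie in the spanning
  -- set.
  have key : ∀ (s : Finset ι) (x : ι → M), (∀ i ∉ s, x i ∈ S) → f x = f' x := by
    intro s
    induction s using Finset.induction_on with
    | empty => exact fun x hx => h x fun i => hx i (by simp)
    | insert i s hi ih =>
      intro x hx
      have h1 : Submodule.span R S ≤ LinearMap.eqLocus (f.toLinearMap x i) (f'.toLinearMap x i) := by
        rw [Submodule.span_le]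
        intro v hv
        refine ih _ fun j hj => ?_
        by_cases hji : j = i
        · subst hji; rwa [Function.update_self]
        · rw [Function.update_of_ne hji]
          exact hx j (by simp [hji, hj])
      rw [hS] at h1
      have h2 : f (Function.update x i (x i)) = f' (Function.update x i (x i)) :=
        h1 (Submodule.mem_top (x := x i))
      rwa [Function.update_eq_self] at h2
  exact MultilinearMap.ext fun x => key Finset.univ x (by simp)

namespace VoronovData

variable {𝕜 L : Type*} [Field 𝕜] [AddCommGroup L] [Module 𝕜 L] (D : VoronovData 𝕜 L)

theorem nest_eq_zero {l : List D.Space} {w : D.Space} (hw : w ∈ l) (h : w.2 = 0) (u : L) :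
    D.nest l u = 0 := by
  induction l generalizing u with
  | nil => simp at hw
  | cons x l ih =>
    rcases List.mem_cons.1 hw with rfl | hw
    · simp [h]
    · exact ih hw _

theorem nest_eq_foldl (l : List D.Space) (u : L) :
    D.nest l u = (l.map fun w => (w.2 : L)).foldl (fun y a => D.br y a) u := by
  induction l generalizing u with
  | nil => rfl
  | cons x l ih => exact ih _

theorem derived_eq_zero_of_left {l : List D.Space} (h : ∀ w ∈ l, w.1 = 0) : D.derived l = 0 := by
  induction l with
  | nil => rfl
  | cons x l ih =>
    rw [derived, ih fun w hw => h w (List.mem_cons_of_mem _ hw), h x List.mem_cons_self]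
    simp

/-- Each term uses the 𝔮-component of a single letter, so with two vanishing 𝔞-components some
bracket is with 0. The second conclusion kills the term in which the head supplies the 𝔮-component.
-/
theorem derived_eq_zero_of_right {l : List D.Space}
    (h : ¬ l.Pairwise fun x y => ¬ (x.2 = 0 ∧ y.2 = 0)) :
    D.derived l = 0 ∧ ∃ w ∈ l, w.2 = 0 := by
  induction l with
  | nil => exact absurd List.Pairwise.nil h
  | cons x l ih =>
    by_cases hl : ∀ y ∈ l, ¬ (x.2 = 0 ∧ y.2 = 0)
    · obtain ⟨h0, w, hw, hw0⟩ := ih fun h' => h (List.Pairwise.cons hl h')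
      refine ⟨?_, w, List.mem_cons_of_mem _ hw, hw0⟩
      rw [derived, D.nest_eq_zero hw hw0, h0, map_zero, add_zero]
    · push Not at hl
      obtain ⟨y, hy, hx0, hy0⟩ := hl
      refine ⟨?_, x, List.mem_cons_self, hx0⟩
      rw [derived, D.nest_eq_zero hy hy0, hx0]
      simp [lam]

end VoronovData

section Characterization

variable {𝕜 : Type*} [Field 𝕜]
variable {g : Type*} [AddCommGroup g] [Module 𝕜 g] {V : Type*} [AddCommGroup V] [Module 𝕜 V]
variable (α : g →ₗ[𝕜] g) (β : V →ₗ[𝕜] V)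

theorem derivedOp_fst {l : List (TripleSpace α β)} (h : l.length ≠ 2) : (derivedOp α β l).1 = 0 :=
  Subtype.ext ((voronovData α β).qBracket_eq_zero h)

theorem derivedOp_snd {l : List (TripleSpace α β)} (h : (voronovData α β).derived l = 0) :
    (derivedOp α β l).2 = 0 :=
  Subtype.ext ((congrArg (projA α β) h).trans (map_zero _))

theorem derivedOp_isHigherDerivedBracket [CharZero 𝕜] :
    IsHigherDerivedBracket α β fun k x => derivedOp α β (List.ofFn (n := k) x) where
  multilinear := (derivedOp_isListLInfinity α β).isLInfinity.multilinear
  symmetric := (derivedOp_isListLInfinity α β).isLInfinity.symmetric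
  two d e x y hx hy := by
    constructor
    · change balavoineBracket _ ((voronovData α β).E x) (y : LSpace α β) = _
      rw [(voronovData α β).E_apply hx, map_smul, LinearMap.smul_apply,
        negOnePow_smul_eq (𝕜 := 𝕜)]
    · refine Subtype.ext ?_
      change projA α β (balavoineBracket _ (x : LSpace α β) 0 + (voronovData α β).lam 0 _) = 0
      rw [map_zero, zero_add, VoronovData.lam, map_zero, map_zero, neg_zero, LinearMap.zero_apply,
        map_zero]
  mixed k hk d e x p hx hp := by
    rw [List.ofFn_cons]
    constructor
    · by_cases h : k = 1
      · subst h
        refine Subtype.ext ?_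
        change balavoineBracket _ _ (0 : LSpace α β) = 0
        rw [map_zero]
      · exact derivedOp_fst α β (by simpa)
    · change projA α β ((voronovData α β).nest _ (x : LSpace α β) +
        (voronovData α β).lam 0 _) = _
      rw [VoronovData.lam, map_zero, map_zero, neg_zero, LinearMap.zero_apply, add_zero]
      refine congrArg _ (((voronovData α β).nest_eq_foldl _ _).trans ?_)
      exact congrArg (List.foldl _ _) List.map_ofFn
  vanish k hk S w hS hS' h2 h1 := by
    -- The unary operation vanishes because P is zero on 𝔮.
    by_cases hk1 : k = 1
    · subst hk1
      refine VoronovData.space_ext rfl ?_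
      change projA α β ((w 0).1 + (voronovData α β).lam _ 0) = 0
      rw [map_zero, add_zero, projA_qSpace (w 0).1.2]
    have hcard : S.card ≤ k := by simpa using S.card_le_univ
    by_cases h0 : S = ∅
    · subst h0
      have hw : ∀ v ∈ List.ofFn w, v.1 = 0 := by
        intro v hv
        obtain ⟨i, rfl⟩ := (List.mem_ofFn' _ _).1 hv
        exact hS' i (by simp)
      refine Prod.ext ?_ (derivedOp_snd α β ((voronovData α β).derived_eq_zero_of_left hw))
      by_cases hk2 : k = 2
      · subst hk2
        refine Subtype.ext ?_
        change balavoineBracket _ (degreeInvolution α β ((w 0).1 : LSpace α β)) _ = 0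
        rw [hS' 0 (by simp), Submodule.coe_zero, map_zero, map_zero, LinearMap.zero_apply]
      · exact derivedOp_fst α β (by simpa)
    -- What remains has at least two inputs from s⁻¹𝔮 and k ≥ 3, so both components vanish.
    · have hpos : 0 < S.card := Finset.card_pos.2 (Finset.nonempty_iff_ne_empty.2 h0)
      have hlt : 1 < S.card := by omega
      have hk3 : k ≠ 2 := by omega
      obtain ⟨i, hi, j, hj, hij⟩ := Finset.one_lt_card.1 hlt
      refine Prod.ext (derivedOp_fst α β (by simpa)) (derivedOp_snd α β
        ((voronovData α β).derived_eq_zero_of_right fun hp => ?_).1)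
      replace hp := List.pairwise_ofFn.1 hp
      rcases lt_or_gt_of_ne hij with h | h
      · exact hp h ⟨hS i hi, hS j hj⟩
      · exact hp h ⟨hS j hj, hS i hi⟩

variable {α β}

theorem span_elements : Submodule.span 𝕜 ({w : TripleSpace α β |
    (∃ n, ∃ (f : CochainSpace (α.prodMap β) n) (hf : f ∈ qPart α β n), w = (qElement hf, 0)) ∨
      ∃ n, ∃ (f : CochainSpace (α.prodMap β) n) (hf : f ∈ aPart α β n), w = (0, aElement hf)}) =
    ⊤ :=
  eq_top_of_elements (fun n f hf => Submodule.subset_span (Or.inl ⟨n, f, hf, rfl⟩))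
    fun n f hf => Submodule.subset_span (Or.inr ⟨n, f, hf, rfl⟩)

/-- By multilinearity it suffices to compare on one-degree elements of s⁻¹𝔮 and 𝔞, where the number
of inputs from s⁻¹𝔮 selects the applicable clause. -/
theorem IsHigherDerivedBracket.unique {l l' : (k : ℕ) → (Fin k → TripleSpace α β) → TripleSpace α β}
    (h : IsHigherDerivedBracket α β l) (h' : IsHigherDerivedBracket α β l') (k : ℕ) (hk : 1 ≤ k) :
    l k = l' k := by
  classical
  obtain ⟨M, hM⟩ := h.multilinear k hk
  obtain ⟨M', hM'⟩ := h'.multilinear k hk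
  have hMM : M = M' := by
    refine multilinear_ext_of_span span_elements fun w hw => ?_
    rw [hM, hM']
    -- The inputs from s⁻¹𝔮 are recognized by a vanishing 𝔞-component. A zero input from 𝔞 is
    -- counted too, which is harmless because it also lies in s⁻¹𝔮.
    have hS : ∀ i ∈ Finset.univ.filter fun i => (w i).2 = 0, (w i).2 = 0 := by simp
    have hS' : ∀ i ∉ Finset.univ.filter fun i => (w i).2 = 0, (w i).1 = 0 := by
      intro i hi
      rcases hw i with ⟨n, f, hf, he⟩ | ⟨n, f, hf, he⟩
      · simp [he] at hi
      · rw [he]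
    have hdeg : ∀ i, ∃ d, w i ∈ tripleGrading α β d := by
      intro i
      rcases hw i with ⟨n, f, hf, he⟩ | ⟨n, f, hf, he⟩
      · exact ⟨_, he ▸ qElement_mem hf⟩
      · exact ⟨_, he ▸ aElement_mem hf⟩
    choose d hd using hdeg
    by_cases h2 : (Finset.univ.filter fun i => (w i).2 = 0).card = 2 ∧ k = 2
    · obtain ⟨hc, rfl⟩ := h2
      have hu : (Finset.univ.filter fun i => (w i).2 = 0) = Finset.univ :=
        Finset.eq_univ_of_card _ (by simpa using hc)
      have e : w = ![((w 0).1, 0), ((w 1).1, 0)] := by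
        funext i
        have h0 : (w i).2 = 0 := hS i (by rw [hu]; simp)
        fin_cases i
        · exact Prod.ext rfl h0
        · exact Prod.ext rfl h0
      have e1 := h.two _ _ (w 0).1 (w 1).1 (hd 0).1 (hd 1).1
      have e2 := h'.two _ _ (w 0).1 (w 1).1 (hd 0).1 (hd 1).1
      rw [e]
      exact Prod.ext (Subtype.ext (e1.1.trans e2.1.symm)) (e1.2.trans e2.2.symm)
    by_cases h1 : (Finset.univ.filter fun i => (w i).2 = 0).card = 1 ∧ 2 ≤ k
    · obtain ⟨hc, hk2⟩ := h1
      obtain ⟨k, rfl⟩ : ∃ m, k = m + 1 := ⟨k - 1, by omega⟩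
      obtain ⟨i, hi⟩ := Finset.card_eq_one.1 hc
      -- The only input from s⁻¹𝔮 is brought to the front; the Koszul sign is the same for both
      -- families and cancels.
      let τ : Equiv.Perm (Fin (k + 1)) := Equiv.swap 0 i
      have e : (fun j => w (τ j)) = Fin.cons ((w i).1, 0) fun j => (0, (w (τ j.succ)).2) := by
        funext j
        refine Fin.cases ?_ (fun j => ?_) j
        · have : (w i).2 = 0 := hS i (by rw [hi]; simp)
          simp only [τ, Equiv.swap_apply_left, Fin.cons_zero]
          exact Prod.ext rfl this
        · refine Prod.ext (hS' _ ?_) rfl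
          rw [hi, Finset.mem_singleton]
          intro hji
          have := congrArg τ hji
          simp only [τ, Equiv.swap_apply_self, Equiv.swap_apply_right] at this
          exact Fin.succ_ne_zero _ this
      have e1 := h.mixed k (by omega) _ _ (w i).1 (fun j => (w (τ j.succ)).2) (hd i).1
        fun j => (hd _).2
      have e2 := h'.mixed k (by omega) _ _ (w i).1 (fun j => (w (τ j.succ)).2) (hd i).1
        fun j => (hd _).2
      have e3 : l (k + 1) (fun j => w (τ j)) = l' (k + 1) (fun j => w (τ j)) := by
        rw [e]
        exact Prod.ext (e1.1.trans e2.1.symm) (Subtype.ext (e1.2.trans e2.2.symm))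
      rw [h.symmetric _ hk τ d w hd, h'.symmetric _ hk τ d w hd] at e3
      exact smul_left_cancel _ e3
    · rw [h.vanish k hk _ w hS hS' h2 h1, h'.vanish k hk _ w hS hS' h2 h1]
  funext w
  rw [← hM, ← hM', hMM]

end Characterization

/-! ### Elements of degree `0` and Maurer–Cartan elements -/

section MaurerCartan

variable {𝕜 : Type*} [Field 𝕜]
variable {g : Type*} [AddCommGroup g] [Module 𝕜 g] {V : Type*} [AddCommGroup V] [Module 𝕜 V]
variable {α : g →ₗ[𝕜] g} {β : V →ₗ[𝕜] V}

theorem boxPlusCochain_apply (μ : WedgeTwoHom α) (ρ : ActionHom α β) (w : Fin 2 → g × V) :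
    (boxPlusCochain μ ρ).toMap w = (μ.1 (w 0).1 (w 1).1, ρ.1 (w 0).1 (w 1).2) := rfl

theorem tensorCochain_apply (T : TwistHom α β) (w : Fin 1 → g × V) :
    (tensorCochain T).toMap w = (T.1 (w 0).2, 0) := rfl

theorem listEval_boxPlusCochain (μ : WedgeTwoHom α) (ρ : ActionHom α β) (x y : g × V) :
    listEval (boxPlusCochain μ ρ).toMap [x, y] = (μ.1 x.1 y.1, ρ.1 x.1 y.2) :=
  listEval_of_length _ rfl

theorem listEval_tensorCochain (T : TwistHom α β) (x : g × V) :
    listEval (tensorCochain T).toMap [x] = (T.1 x.2, 0) :=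
  listEval_of_length _ rfl

theorem tripleElement_mem (μ : WedgeTwoHom α) (ρ : ActionHom α β) (T : TwistHom α β) :
    tripleElement μ ρ T ∈ tripleGrading α β 0 := by
  refine ⟨?_, ?_⟩
  · exact inDegree_mem (γ := α.prodMap β) 1 _
  · exact inDegree_mem (γ := α.prodMap β) 0 _

theorem tripleElement_add (μ μ' : WedgeTwoHom α) (ρ ρ' : ActionHom α β) (T T' : TwistHom α β) :
    tripleElement (μ + μ') (ρ + ρ') (T + T') = tripleElement μ ρ T + tripleElement μ' ρ' T' := by
  have h1 : boxPlusCochain (μ + μ') (ρ + ρ') = boxPlusCochain μ ρ + boxPlusCochain μ' ρ' :=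
    CochainSpace.ext fun w => by
      rw [map_add, _root_.add_apply]
      rfl
  have h2 : tensorCochain (T + T') = tensorCochain T + tensorCochain T' :=
    CochainSpace.ext fun w => by
      rw [map_add, _root_.add_apply, tensorCochain_apply, tensorCochain_apply, tensorCochain_apply,
        Prod.mk_add_mk, add_zero]
      rfl
  refine Prod.ext (Subtype.ext ?_) (Subtype.ext ?_)
  · exact (congrArg (inDegree _ 1) h1).trans (map_add _ _ _)
  · exact (congrArg (inDegree _ 0) h2).trans (map_add _ _ _)

theorem tripleElement_injective {μ μ' : WedgeTwoHom α} {ρ ρ' : ActionHom α β}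
    {T T' : TwistHom α β} (h : tripleElement μ ρ T = tripleElement μ' ρ' T') :
    μ = μ' ∧ ρ = ρ' ∧ T = T' := by
  have h1 : inDegree _ 1 (boxPlusCochain μ ρ) = inDegree _ 1 (boxPlusCochain μ' ρ') :=
    congrArg (fun t => (t.1 : LSpace α β)) h
  have h2 : inDegree _ 0 (tensorCochain T) = inDegree _ 0 (tensorCochain T') :=
    congrArg (fun t => (t.2 : LSpace α β)) h
  replace h1 := congrArg (fun t => t 1) h1
  replace h2 := congrArg (fun t => t 0) h2
  simp only [inDegree_apply_self] at h1 h2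
  refine ⟨?_, ?_, ?_⟩
  · refine Subtype.ext (LinearMap.ext₂ fun x y => ?_)
    exact congrArg (fun f => (f.toMap ![(x, 0), (y, 0)]).1) h1
  · refine Subtype.ext (LinearMap.ext₂ fun x v => ?_)
    exact congrArg (fun f => (f.toMap ![(x, 0), (0, v)]).2) h1
  · refine Subtype.ext (LinearMap.ext fun v => ?_)
    exact congrArg (fun f => (f.toMap ![(0, v)]).1) h2

theorem eq_inDegree {n : ℕ} {x : LSpace α β} (hx : x ∈ homogeneousPart (α.prodMap β) n) :
    x = inDegree _ n (x n) := DFinsupp.ext fun k => by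
  by_cases h : k = n
  · subst h; exact (inDegree_apply_self _ _).symm
  · exact (hx k (by exact_mod_cast h)).trans (inDegree_apply_ne (Ne.symm h) _).symm

theorem exists_boxPlusCochain {f : CochainSpace (α.prodMap β) 1} (hf : f ∈ qPart α β 1) :
    ∃ (μ : WedgeTwoHom α) (ρ : ActionHom α β), boxPlusCochain μ ρ = f := by
  obtain ⟨f₁, f₂, h₁, h₂, h⟩ := hf
  have e : ∀ x y : g, (fun i => α ((![x, y] : Fin 2 → g) i)) = ![α x, α y] := by
    intro x y; funext i; fin_cases i <;> rfl
  have e' : ∀ x : g, (fun i => α ((![x] : Fin 1 → g) i)) = ![α x] := by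
    intro x; funext i; fin_cases i; rfl
  have u₀ : ∀ x y z : g, Function.update ![x, y] 0 z = ![z, y] := by
    intro x y z; funext i; fin_cases i <;> rfl
  have u₁ : ∀ x y z : g, Function.update ![x, y] 1 z = ![x, z] := by
    intro x y z; funext i; fin_cases i <;> rfl
  have u : ∀ x z : g, Function.update ![x] 0 z = ![z] := by
    intro x z; funext i; fin_cases i; rfl
  let μ : g →ₗ[𝕜] g →ₗ[𝕜] g := LinearMap.mk₂ 𝕜 (fun x y => f₁ ![x, y])
    (fun x x' y => by simpa only [u₀] using f₁.map_update_add ![x, y] 0 x x')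
    (fun c x y => by simpa only [u₀] using f₁.map_update_smul ![x, y] 0 c x)
    (fun x y y' => by simpa only [u₁] using f₁.map_update_add ![x, y] 1 y y')
    (fun c x y => by simpa only [u₁] using f₁.map_update_smul ![x, y] 1 c y)
  let ρ : g →ₗ[𝕜] V →ₗ[𝕜] V :=
    { toFun := fun x => f₂ ![x]
      map_add' := fun x x' => by simpa only [u] using f₂.map_update_add ![x] 0 x x'
      map_smul' := fun c x => by simpa only [u, RingHom.id_apply] using f₂.map_update_smul ![x] 0 c x }
  refine ⟨⟨μ, fun x => f₁.map_eq_zero_of_eq ![x, x] (i := 0) (j := 1) rfl (by simp), fun x y => ?_⟩,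
    ⟨ρ, fun x v => ?_⟩, CochainSpace.ext fun w => ?_⟩
  · exact (h₁ ![x, y]).trans (congrArg f₁ (e x y))
  · exact (h₂ ![x] v).trans (congrArg (fun t => f₂ t (β v)) (e' x))
  · rw [boxPlusCochain_apply, h]
    refine Prod.ext (congrArg f₁ ?_) (congrArg (fun t => f₂ t (w 1).2) ?_)
    · funext i; fin_cases i <;> rfl
    · funext i; fin_cases i; rfl

theorem exists_tensorCochain {f : CochainSpace (α.prodMap β) 0} (hf : f ∈ aPart α β 0) :
    ∃ T : TwistHom α β, tensorCochain T = f := by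
  obtain ⟨F, hF, h⟩ := hf
  let T : V →ₗ[𝕜] g := F.toLinearMap 0 0
  have hT : ∀ v, T v = F fun _ => v := fun v => by
    change F (Function.update 0 0 v) = _
    congr 1
    funext i
    fin_cases i
    simp
  refine ⟨⟨T, fun v => ?_⟩, CochainSpace.ext fun w => ?_⟩
  · rw [hT, hT]
    exact hF _
  · rw [tensorCochain_apply, h]
    refine Prod.ext ((hT _).trans (congrArg F ?_)) rfl
    funext i; fin_cases i; rfl

theorem existsUnique_tripleElement {θ : TripleSpace α β} (hθ : θ ∈ tripleGrading α β 0) :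
    ∃! t : WedgeTwoHom α × ActionHom α β × TwistHom α β, tripleElement t.1 t.2.1 t.2.2 = θ := by
  obtain ⟨h1, h2⟩ := hθ
  obtain ⟨μ, ρ, hq⟩ := exists_boxPlusCochain (mem_qSpace.1 θ.1.2 1)
  obtain ⟨T, ha⟩ := exists_tensorCochain (mem_aSpace.1 θ.2.2 0)
  have h : tripleElement μ ρ T = θ := by
    refine Prod.ext (Subtype.ext ?_) (Subtype.ext ?_)
    · exact (congrArg (inDegree _ 1) hq).trans (eq_inDegree (n := 1) h1).symm
    · exact (congrArg (inDegree _ 0) ha).trans (eq_inDegree (n := 0) h2).symm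
  refine ⟨(μ, ρ, T), h, ?_⟩
  rintro ⟨μ', ρ', T'⟩ h'
  obtain ⟨rfl, rfl, rfl⟩ := tripleElement_injective (h'.trans h.symm)
  rfl

/-! #### The brackets of the element of a triple -/

theorem spaceEval_projA (x : LSpace α β) (l : List (g × V)) :
    spaceEval (projA α β x) l = projG 𝕜 g V (spaceEval x (l.map (projV 𝕜 g V))) := by
  induction x using cochain_induction with
  | h0 => simp; rfl
  | h n f => rw [projA_inDegree, spaceEval_inDegree, spaceEval_inDegree, listEval_projPart]
  | hadd x y hx hy => simp only [map_add, Pi.add_apply, hx, hy]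

/-- In degree 1 the bracket of an element with itself is twice its ⋄-square. The components are, up
to sign, the defects of the Hom-Jacobi and the representation identity. -/
theorem bracket_boxPlus (μ : WedgeTwoHom α) (ρ : ActionHom α β) (x y z : g × V) :
    spaceEval (balavoineBracket _ (inDegree _ 1 (boxPlusCochain μ ρ))
      (inDegree _ 1 (boxPlusCochain μ ρ))) [x, y, z] =
    (2 : 𝕜) • (μ.1 (μ.1 x.1 y.1) (α z.1) - μ.1 (α x.1) (μ.1 y.1 z.1) + μ.1 (α y.1) (μ.1 x.1 z.1),
      ρ.1 (μ.1 x.1 y.1) (β z.2) - ρ.1 (α x.1) (ρ.1 y.1 z.2) + ρ.1 (α y.1) (ρ.1 x.1 z.2)) := by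
  simp only [bracket_inDegree, map_sub, map_smul, spaceEval_inDegree, Pi.sub_apply, Pi.smul_apply,
    listEval_diamondHom, insertion_cons, insertion_nil, insertion_zero, List.map_cons, List.map_nil,
    listEval_boxPlusCochain, pow_one, LinearMap.prodMap_apply]
  ext <;> simp <;> module

/-- T has degree 0, so no power of γ appears. A general X permits iteration, with X = [μ ⊞ ρ, T] in
the second step. -/
theorem spaceEval_bracket_tensor (X : LSpace α β) (T : TwistHom α β) (x y : g × V) :
    spaceEval (balavoineBracket _ X (inDegree _ 0 (tensorCochain T))) [x, y] =
      spaceEval X [(T.1 x.2, 0), y] + spaceEval X [x, (T.1 y.2, 0)] -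
        (T.1 (spaceEval X [x, y]).2, 0) := by
  induction X using cochain_induction with
  | h0 => simp; rfl
  | hadd X Y hX hY =>
    simp only [map_add, LinearMap.add_apply, Pi.add_apply, hX, hY, Prod.snd_add]
    rw [← add_zero (0 : V), ← Prod.mk_add_mk, add_zero]
    abel
  | h n f =>
    simp only [bracket_inDegree, map_sub, spaceEval_inDegree, Pi.sub_apply,
      listEval_diamondHom, mul_zero, pow_zero, one_smul]
    congr 1
    · refine (congrFun (listEval_diamondHom n 0 f (tensorCochain T)) [x, y]).trans ?_
      simp [insertion_cons, insertion_zero, listEval_tensorCochain, add_comm]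
    · by_cases hn : n = 1
      · subst hn
        simp [insertion_cons, insertion_zero, listEval_tensorCochain]
      · rw [insertion_eq_zero_of_arity (d := 0) _ _ _ _ _
          (fun t ht => listEval_eq_zero _ (by simpa using ht)) (by simp; omega),
          listEval_eq_zero _ (by simp; omega)]
        simp; rfl

/-- P restricts to inputs in V, where applying T twice to one entry gives 0. The surviving terms
come in equal pairs, whence the factor 2. -/
theorem bracket_tensor (μ : WedgeTwoHom α) (ρ : ActionHom α β) (T : TwistHom α β) (x y : g × V) :
    spaceEval (projA α β (balavoineBracket _ (balavoineBracket _
      (inDegree _ 1 (boxPlusCochain μ ρ)) (inDegree _ 0 (tensorCochain T)))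
      (inDegree _ 0 (tensorCochain T)))) [x, y] =
    (2 : 𝕜) • (μ.1 (T.1 x.2) (T.1 y.2) - T.1 (ρ.1 (T.1 x.2) y.2), 0) := by
  simp only [spaceEval_projA, spaceEval_bracket_tensor, spaceEval_inDegree, List.map_cons,
    List.map_nil, listEval_boxPlusCochain, projV_apply, projG_apply]
  ext <;> simp
  module

end MaurerCartan

/-! ### The Maurer–Cartan series -/

section Series

variable {𝕜 : Type*} [Field 𝕜] {T : Type*} [AddCommGroup T] [Module 𝕜 T]

variable (𝕜) in
/-- The Maurer–Cartan series, when only the operations with `2` and `3` inputs contribute. -/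
def mcCubic (F : List T → T) (θ : T) : T := (2 : 𝕜)⁻¹ • F [θ, θ] + (6 : 𝕜)⁻¹ • F [θ, θ, θ]

variable {F : List T → T} {θ θ' : T}

theorem finsum_mc (h : ∀ n, n ≠ 2 → n ≠ 3 → F (List.replicate n θ) = 0) :
    ∑ᶠ k : ℕ, (((k + 1)! : ℕ) : 𝕜)⁻¹ • F (List.replicate (k + 1) θ) = mcCubic 𝕜 F θ := by
  -- The series is indexed from 0, so `{1, 2}` stands for the operations with 2 and 3 inputs.
  rw [finsum_eq_sum_of_support_subset (s := {1, 2})]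
  · simp [mcCubic, Nat.factorial, List.replicate_succ]
    norm_num
    rw [← mul_inv]; norm_num
  · intro k hk
    by_contra hk'
    simp only [Finset.coe_insert, Finset.coe_singleton, Set.mem_insert_iff,
      Set.mem_singleton_iff] at hk'
    exact hk (by beta_reduce; rw [h _ (by omega) (by omega), smul_zero])

/-- The twisted functional at the empty word is the curvature of the twist; it must vanish for the
twisted operations to satisfy the relations. -/
theorem listTwist_nil (h : ∀ n, n ≠ 2 → n ≠ 3 → F (List.replicate n θ) = 0) :
    listTwist 𝕜 F θ [] = mcCubic 𝕜 F θ := by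
  rw [listTwist, finsum_eq_sum_of_support_subset (s := {2, 3})]
  · simp [mcCubic, Nat.factorial, List.replicate_succ]
  · intro k hk
    by_contra hk'
    simp only [Finset.coe_insert, Finset.coe_singleton, Set.mem_insert_iff,
      Set.mem_singleton_iff] at hk'
    exact hk (by beta_reduce; rw [List.append_nil, h _ (by omega) (by omega), smul_zero])

theorem listTwist_replicate (h : ∀ l : List T, (∀ x ∈ l, x = θ ∨ x = θ') → l.length ≠ 2 →
    l.length ≠ 3 → F l = 0) (k : ℕ) (hk : 1 ≤ k) :
    listTwist 𝕜 F θ (List.replicate k θ') =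
      F (List.replicate k θ') + F (θ :: List.replicate k θ') +
        (2 : 𝕜)⁻¹ • F (θ :: θ :: List.replicate k θ') := by
  -- With k ≥ 1, three or more copies of `θ` make the word longer than 3.
  rw [listTwist, finsum_eq_sum_of_support_subset (s := {0, 1, 2})]
  · simp [Nat.factorial, List.replicate_succ, add_assoc]
  · intro n hn
    by_contra hn'
    simp only [Finset.coe_insert, Finset.coe_singleton, Set.mem_insert_iff,
      Set.mem_singleton_iff] at hn'
    refine hn ?_
    beta_reduce
    rw [h _ (fun x hx => ?_) (by simp; omega) (by simp; omega), smul_zero]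
    rcases List.mem_append.1 hx with hx | hx
    · exact Or.inl (List.eq_of_mem_replicate hx)
    · exact Or.inr (List.eq_of_mem_replicate hx)

/-- The Maurer–Cartan series of the twisted operations. -/
theorem IsListLInfinity.finsum_listTwist [CharZero 𝕜] {𝒜 : ℤ → Submodule 𝕜 T}
    (hF : IsListLInfinity 𝒜 F) (hθ : θ ∈ 𝒜 0) (hθ' : θ' ∈ 𝒜 0)
    (h : ∀ l : List T, (∀ x ∈ l, x = θ ∨ x = θ') → l.length ≠ 2 → l.length ≠ 3 → F l = 0) :
    ∑ᶠ k : ℕ, (((k + 1)! : ℕ) : 𝕜)⁻¹ • HomLL.listTwist 𝕜 F θ (List.replicate (k + 1) θ') =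
      mcCubic 𝕜 F (θ + θ') - mcCubic 𝕜 F θ := by
  have hm : ∀ l : List T, l.length ≠ 2 → l.length ≠ 3 → (∀ x ∈ l, x = θ ∨ x = θ') → F l = 0 :=
    fun l h1 h2 h3 => h l h3 h1 h2
  have e1 := listTwist_replicate (𝕜 := 𝕜) h 1 le_rfl
  have e2 := listTwist_replicate (𝕜 := 𝕜) h 2 (by norm_num)
  have e3 := listTwist_replicate (𝕜 := 𝕜) h 3 (by norm_num)
  simp only [List.replicate_succ, List.replicate_zero] at e1 e2 e3
  rw [hm [θ'] (by simp) (by simp) (by simp), zero_add] at e1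
  rw [hm [θ, θ, θ', θ'] (by simp) (by simp) (by simp), smul_zero, add_zero] at e2
  rw [hm [θ, θ', θ', θ'] (by simp) (by simp) (by simp),
    hm [θ, θ, θ', θ', θ'] (by simp) (by simp) (by simp), smul_zero, add_zero, add_zero] at e3
  have hsum : ∑ᶠ k : ℕ, (((k + 1)! : ℕ) : 𝕜)⁻¹ • HomLL.listTwist 𝕜 F θ
      (List.replicate (k + 1) θ') = HomLL.listTwist 𝕜 F θ [θ'] +
        ((2 : 𝕜)⁻¹ • HomLL.listTwist 𝕜 F θ [θ', θ'] +
          (6 : 𝕜)⁻¹ • HomLL.listTwist 𝕜 F θ [θ', θ', θ']) := by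
    rw [finsum_eq_sum_of_support_subset (s := {0, 1, 2})]
    · simp [Nat.factorial, List.replicate_succ]
      norm_num
    · intro n hn
      by_contra hn'
      simp only [Finset.coe_insert, Finset.coe_singleton, Set.mem_insert_iff,
        Set.mem_singleton_iff] at hn'
      refine hn ?_
      beta_reduce
      rw [listTwist_replicate h _ (by omega), hm, hm, hm]
      · simp
      all_goals first
        | (simp; done)
        | (simp; omega)
  have a : ∀ x a b c, F (a ++ (x + b) :: c) = F (a ++ x :: c) + F (a ++ b :: c) :=
    fun x a b c => hF.additive a x b c
  have s : ∀ (a : List (Homog 𝒜)) (x y : T) (_ : x ∈ 𝒜 0) (_ : y ∈ 𝒜 0) (b : List (Homog 𝒜)),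
      F (a.map Homog.val ++ x :: y :: b.map Homog.val) =
        F (a.map Homog.val ++ y :: x :: b.map Homog.val) := by
    intro a x y hx hy b
    have := hF.symmetric a ⟨0, x, hx⟩ ⟨0, y, hy⟩ b
    simpa [Homog.val] using this
  let z : Homog 𝒜 := ⟨0, θ, hθ⟩
  let z' : Homog 𝒜 := ⟨0, θ', hθ'⟩
  have s0 : F [θ', θ] = F [θ, θ'] := s [] θ' θ hθ' hθ []
  have s1 : F [θ', θ, θ] = F [θ, θ', θ] := s [] θ' θ hθ' hθ [z]
  have s2 : F [θ, θ', θ] = F [θ, θ, θ'] := s [z] θ' θ hθ' hθ []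
  have s3 : F [θ', θ', θ] = F [θ', θ, θ'] := s [z'] θ' θ hθ' hθ []
  have s4 : F [θ', θ, θ'] = F [θ, θ', θ'] := s [] θ' θ hθ' hθ [z']
  have a1 : ∀ x y b, F ((x + y) :: b) = F (x :: b) + F (y :: b) := fun x y b => a x [] y b
  have a2 : ∀ w x y b, F (w :: (x + y) :: b) = F (w :: x :: b) + F (w :: y :: b) :=
    fun w x y b => a x [w] y b
  have a3 : ∀ v w x y b, F (v :: w :: (x + y) :: b) = F (v :: w :: x :: b) + F (v :: w :: y :: b) :=
    fun v w x y b => a x [v, w] y b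
  rw [hsum, e1, e2, e3, mcCubic, mcCubic]
  -- By symmetry every mixed word is sorted with `θ` in front, so both sides become combinations of
  -- the same few values and only rational coefficients are compared.
  simp only [a1, a2, a3, s0, s3, s4, s1, s2]
  have h6 : (6 : 𝕜)⁻¹ = (2 : 𝕜)⁻¹ * (3 : 𝕜)⁻¹ := by rw [← mul_inv]; norm_num
  have h2 : (2 : 𝕜) ≠ 0 := two_ne_zero
  have h3 : (3 : 𝕜) ≠ 0 := three_ne_zero
  rw [h6]
  match_scalars <;> field_simp <;> norm_num

end Series

/-! ### The Maurer–Cartan equation of a triple in terms of its structure identities. -/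

section Triples

variable {𝕜 : Type*} [Field 𝕜]
variable {g : Type*} [AddCommGroup g] [Module 𝕜 g] {V : Type*} [AddCommGroup V] [Module 𝕜 V]
variable {α : g →ₗ[𝕜] g} {β : V →ₗ[𝕜] V}

/-- The element `μ ⊞ ρ` of `q`. -/
abbrev boxElement (μ : WedgeTwoHom α) (ρ : ActionHom α β) : LSpace α β :=
  inDegree _ 1 (boxPlusCochain μ ρ)

/-- The element `T` of `a`. -/
abbrev tensorElement (β : V →ₗ[𝕜] V) (T : TwistHom α β) : LSpace α β :=
  inDegree _ 0 (tensorCochain T)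

/-- The 𝔮-component μ ⊞ ρ has weight 1, so besides 2 only 1 + 2 = 3 inputs are possible. -/
theorem derivedOp_tripleElement [CharZero 𝕜] {l : List (TripleSpace α β)}
    (hl : ∀ x ∈ l, ∃ (μ : WedgeTwoHom α) (ρ : ActionHom α β) (T : TwistHom α β),
      x = tripleElement μ ρ T) (h2 : l.length ≠ 2) (h3 : l.length ≠ 3) : derivedOp α β l = 0 := by
  refine derivedOp_eq_zero_of_weight (w := 1) (fun x hx => ?_) h2 (by omega)
  obtain ⟨μ, ρ, T, rfl⟩ := hl x hx
  exact qPart_weight (boxPlusCochain_mem μ ρ)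

theorem lam_tensorElement (T : TwistHom α β) {e : ℤ} {u : LSpace α β}
    (hu : u ∈ homogeneousPart (α.prodMap β) e) :
    (voronovData α β).lam (tensorElement β T) u = balavoineBracket _ u (tensorElement β T) := by
  have h := VoronovData.lam_eq_br (D := voronovData α β) (d := 0)
    (inDegree_mem 0 (tensorCochain T)) hu
  rw [mul_zero, sgn_zero, one_smul] at h
  exact h

variable (μ : WedgeTwoHom α) (ρ : ActionHom α β) (T : TwistHom α β)

theorem derived_two : (voronovData α β).derived [tripleElement μ ρ T, tripleElement μ ρ T] =
    (2 : 𝕜) • balavoineBracket _ (boxElement μ ρ) (tensorElement β T) := by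
  have hq : boxElement μ ρ ∈ homogeneousPart (α.prodMap β) (1 : ℕ) := inDegree_mem 1 _
  change balavoineBracket _ (boxElement μ ρ) (tensorElement β T) +
    (voronovData α β).lam (tensorElement β T) (boxElement μ ρ +
      (voronovData α β).lam (tensorElement β T) 0) = _
  rw [map_zero, add_zero, lam_tensorElement T hq, two_smul]

/-- Each of the three letters may supply μ ⊞ ρ. As T has degree 0, brackets from the left and from
the right agree under `lam`, and the three terms are equal. -/
theorem derived_three : (voronovData α β).derived
      [tripleElement μ ρ T, tripleElement μ ρ T, tripleElement μ ρ T] =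
    (3 : 𝕜) • balavoineBracket _ (balavoineBracket _ (boxElement μ ρ) (tensorElement β T))
      (tensorElement β T) := by
  have hq : boxElement μ ρ ∈ homogeneousPart (α.prodMap β) (1 : ℕ) := inDegree_mem 1 _
  have ht : tensorElement β T ∈ homogeneousPart (α.prodMap β) (0 : ℕ) := inDegree_mem 0 _
  change balavoineBracket _ (balavoineBracket _ (boxElement μ ρ) (tensorElement β T))
      (tensorElement β T) + (voronovData α β).lam (tensorElement β T)
      ((voronovData α β).derived [tripleElement μ ρ T, tripleElement μ ρ T]) = _
  rw [derived_two, map_smul, lam_tensorElement T (bracket_mem hq ht)]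
  module

theorem derivedOp_three :
    derivedOp α β [tripleElement μ ρ T, tripleElement μ ρ T, tripleElement μ ρ T] =
    (0, ⟨(3 : 𝕜) • projA α β (balavoineBracket _ (balavoineBracket _ (boxElement μ ρ)
      (tensorElement β T)) (tensorElement β T)), Submodule.smul_mem _ _ (projA_mem _)⟩) := by
  refine Prod.ext rfl (Subtype.ext ?_)
  exact (congrArg (projA α β) (derived_three μ ρ T)).trans (map_smul _ _ _)

variable [CharZero 𝕜]

/-- The minus sign is (-1)^{|q|} for |q| = 1. The 𝔞-component would be 2P[μ ⊞ ρ, T], whose argument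
has weight 0 and is killed by P. -/
theorem derivedOp_two : derivedOp α β [tripleElement μ ρ T, tripleElement μ ρ T] =
    (⟨-balavoineBracket _ (boxElement μ ρ) (boxElement μ ρ), neg_mem (bracket_qSpace
      (tripleElement μ ρ T).1.2 (tripleElement μ ρ T).1.2)⟩, 0) := by
  refine Prod.ext (Subtype.ext ?_) (Subtype.ext ?_)
  · change balavoineBracket _ ((voronovData α β).E (boxElement μ ρ)) (boxElement μ ρ) = _
    have hq : boxElement μ ρ ∈ (voronovData α β).gr (1 : ℕ) := inDegree_mem 1 _
    rw [(voronovData α β).E_apply hq, sgn_natCast, pow_one, neg_one_smul, map_neg,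
      LinearMap.neg_apply]
  · change projA α β ((voronovData α β).derived _) = 0
    refine (congrArg (projA α β) (derived_two μ ρ T)).trans ?_
    rw [map_smul, projA_weight (w := 1 + -1) (by norm_num) (bracket_weight
      (qPart_weight (boxPlusCochain_mem μ ρ)) (aPart_weight (tensorCochain_mem T))), smul_zero]

theorem mcCubic_eq_zero_iff : mcCubic 𝕜 (derivedOp α β) (tripleElement μ ρ T) = 0 ↔
    balavoineBracket _ (boxElement μ ρ) (boxElement μ ρ) = 0 ∧
      projA α β (balavoineBracket _ (balavoineBracket _ (boxElement μ ρ) (tensorElement β T))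
        (tensorElement β T)) = 0 := by
  have h2 : (2 : 𝕜)⁻¹ ≠ 0 := inv_ne_zero two_ne_zero
  have h6 : (6 : 𝕜)⁻¹ ≠ 0 := inv_ne_zero (by norm_num)
  have h3 : (3 : 𝕜) ≠ 0 := three_ne_zero
  rw [mcCubic, derivedOp_two, derivedOp_three, Prod.ext_iff, Subtype.ext_iff, Subtype.ext_iff]
  simp [h2, h6, h3]

theorem bracket_boxElement_eq_zero_iff :
    balavoineBracket _ (boxElement μ ρ) (boxElement μ ρ) = 0 ↔
      ∀ (x y z : g) (v : V),
        μ.1 (μ.1 x y) (α z) - μ.1 (α x) (μ.1 y z) + μ.1 (α y) (μ.1 x z) = 0 ∧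
        ρ.1 (μ.1 x y) (β v) - ρ.1 (α x) (ρ.1 y v) + ρ.1 (α y) (ρ.1 x v) = 0 := by
  have h2 : (2 : 𝕜) ≠ 0 := two_ne_zero
  constructor
  · intro h x y z v
    have h' := bracket_boxPlus μ ρ (x, 0) (y, 0) (z, v)
    rw [h, map_zero] at h'
    have h'' := (smul_eq_zero.1 h'.symm).resolve_left h2
    exact ⟨congrArg Prod.fst h'', congrArg Prod.snd h''⟩
  · intro h
    apply spaceEval_injective
    intro l
    rw [map_zero]
    by_cases hl : l.length = 3
    · obtain ⟨x, y, z, rfl⟩ := List.length_eq_three.1 hl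
      obtain ⟨h1, -⟩ := h x.1 y.1 z.1 0
      obtain ⟨-, h1'⟩ := h x.1 y.1 z.1 z.2
      rw [bracket_boxPlus, h1, h1']
      exact smul_zero _
    · rw [bracket_inDegree, map_sub, map_smul, spaceEval_inDegree, Pi.sub_apply, Pi.smul_apply,
        listEval_eq_zero _ hl]
      simp

theorem bracket_tensorElement_eq_zero_iff :
    projA α β (balavoineBracket _ (balavoineBracket _ (boxElement μ ρ) (tensorElement β T))
        (tensorElement β T)) = 0 ↔
      ∀ u v : V, μ.1 (T.1 u) (T.1 v) = T.1 (ρ.1 (T.1 u) v) := by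
  have h2 : (2 : 𝕜) ≠ 0 := two_ne_zero
  constructor
  · intro h u v
    have h' := bracket_tensor μ ρ T (0, u) (0, v)
    rw [h, map_zero] at h'
    exact sub_eq_zero.1 (congrArg Prod.fst ((smul_eq_zero.1 h'.symm).resolve_left h2))
  · intro h
    have hd : balavoineBracket _ (balavoineBracket _ (boxElement μ ρ) (tensorElement β T))
        (tensorElement β T) ∈ homogeneousPart (α.prodMap β) (1 : ℕ) :=
      bracket_mem (bracket_mem (inDegree_mem 1 _) (inDegree_mem 0 _)) (inDegree_mem 0 _)
    apply spaceEval_injective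
    intro l
    rw [map_zero]
    by_cases hl : l.length = 2
    · obtain ⟨x, y, rfl⟩ := List.length_eq_two.1 hl
      rw [bracket_tensor, h, sub_self]
      exact smul_zero _
    · rw [eq_inDegree (projA_homogeneous hd), spaceEval_inDegree, listEval_eq_zero _ hl]
      rfl

/-- Skew-symmetry and equivariance are built into the three Hom spaces. What is left are the three
structure identities, which are the components of the cubic up to sign and order. -/
theorem isHomLieLeibnizTriple_iff : IsHomLieLeibnizTriple α β μ.1 ρ.1 T.1 ↔
    mcCubic 𝕜 (derivedOp α β) (tripleElement μ ρ T) = 0 := by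
  have hs : ∀ x y, μ.1 x y = -μ.1 y x := fun x y => by
    have h := μ.2.1 (x + y)
    simp only [map_add, LinearMap.add_apply, μ.2.1, zero_add, add_zero] at h
    exact eq_neg_of_add_eq_zero_right h
  rw [mcCubic_eq_zero_iff, bracket_boxElement_eq_zero_iff, bracket_tensorElement_eq_zero_iff]
  constructor
  · rintro ⟨⟨_, _, h1⟩, ⟨_, h2⟩, ⟨_, h3⟩⟩
    refine ⟨fun x y z v => ⟨?_, ?_⟩, h3⟩
    · have h := h1 x y z
      rw [hs (α z), hs z x, map_neg] at h
      rw [← neg_eq_zero, ← h]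
      abel
    · rw [← h2]
      abel
  · rintro ⟨h1, h3⟩
    refine ⟨⟨hs, μ.2.2, fun x y z => ?_⟩, ⟨ρ.2, fun x y v => ?_⟩, ⟨T.2, h3⟩⟩
    · have h := (h1 x y z 0).1
      rw [hs (α z), hs z x, map_neg, ← neg_eq_zero, ← h]
      abel
    · have h := (h1 x y 0 v).2
      rw [← sub_eq_zero, ← neg_eq_zero, ← h]
      abel

theorem isMaurerCartan_iff :
    IsMaurerCartan (tripleGrading α β) (fun k x => derivedOp α β (List.ofFn (n := k) x))
      (tripleElement μ ρ T) ↔ mcCubic 𝕜 (derivedOp α β) (tripleElement μ ρ T) = 0 := by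
  have h0 : ∑ᶠ k : ℕ, (((k + 1)! : ℕ) : 𝕜)⁻¹ • derivedOp α β
      (List.ofFn fun _ : Fin (k + 1) => tripleElement μ ρ T) =
        mcCubic 𝕜 (derivedOp α β) (tripleElement μ ρ T) := by
    simp only [List.ofFn_const]
    exact finsum_mc fun n h2 h3 => derivedOp_tripleElement
      (fun x hx => ⟨μ, ρ, T, List.eq_of_mem_replicate hx⟩) (by simpa) (by simpa)
  constructor
  · exact fun h => h0.symm.trans h.sum_eq_zero
  · exact fun h => ⟨tripleElement_mem μ ρ T, mcSeriesFinite_derivedOp _, h0.trans h⟩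

end Triples


end HomLL

end

/-! ### The theorem, with the operations realized by `derivedOp`. -/

theorem mainTheorem7 {𝕜 : Type*} [Field 𝕜] [CharZero 𝕜]
    {g : Type*} [AddCommGroup g] [Module 𝕜 g] {V : Type*} [AddCommGroup V] [Module 𝕜 V]
    (α : g →ₗ[𝕜] g) (β : V →ₗ[𝕜] V) :
    ∃ l : (k : ℕ) → (Fin k → HomLL.TripleSpace α β) → HomLL.TripleSpace α β,
      -- the operations `l` are the higher derived brackets, which determine them
      HomLL.IsHigherDerivedBracket α β l ∧
      (∀ l', HomLL.IsHigherDerivedBracket α β l' → ∀ k, 1 ≤ k → l' k = l k) ∧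
      -- they form an `L_∞`-algebra on `s⁻¹q ⊕ a`
      HomLL.IsLInfinity (HomLL.tripleGrading α β) l ∧
      -- the series for Maurer–Cartan elements and for twisting converge
      (∀ θ ∈ HomLL.tripleGrading α β 0,
        HomLL.MCSeriesFinite l θ ∧ HomLL.TwistSeriesFinite l θ) ∧
      -- the degree `0` elements are exactly the `(s⁻¹(μ ⊞ ρ), T)`, without repetition
      (∀ (μ : HomLL.WedgeTwoHom α) (ρ : HomLL.ActionHom α β) (T : HomLL.TwistHom α β),
        HomLL.tripleElement μ ρ T ∈ HomLL.tripleGrading α β 0) ∧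
      (∀ θ ∈ HomLL.tripleGrading α β 0,
        ∃! t : HomLL.WedgeTwoHom α × HomLL.ActionHom α β × HomLL.TwistHom α β,
          HomLL.tripleElement t.1 t.2.1 t.2.2 = θ) ∧
      -- Maurer–Cartan characterization of Hom-Lie-Leibniz triples
      (∀ (μ : HomLL.WedgeTwoHom α) (ρ : HomLL.ActionHom α β) (T : HomLL.TwistHom α β),
        HomLL.IsHomLieLeibnizTriple α β μ.1 ρ.1 T.1 ↔
          HomLL.IsMaurerCartan (HomLL.tripleGrading α β) l (HomLL.tripleElement μ ρ T)) ∧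
      -- the twisted `L_∞`-algebra and its Maurer–Cartan elements
      (∀ (μ : HomLL.WedgeTwoHom α) (ρ : HomLL.ActionHom α β) (T : HomLL.TwistHom α β),
        HomLL.IsHomLieLeibnizTriple α β μ.1 ρ.1 T.1 →
          HomLL.IsLInfinity (HomLL.tripleGrading α β)
            (HomLL.twist 𝕜 l (HomLL.tripleElement μ ρ T)) ∧
          (∀ θ' ∈ HomLL.tripleGrading α β 0,
            HomLL.MCSeriesFinite (HomLL.twist 𝕜 l (HomLL.tripleElement μ ρ T)) θ') ∧
          ∀ (μ' : HomLL.WedgeTwoHom α) (ρ' : HomLL.ActionHom α β) (T' : HomLL.TwistHom α β),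
            HomLL.IsHomLieLeibnizTriple α β (μ.1 + μ'.1) (ρ.1 + ρ'.1) (T.1 + T'.1) ↔
              HomLL.IsMaurerCartan (HomLL.tripleGrading α β)
                (HomLL.twist 𝕜 l (HomLL.tripleElement μ ρ T))
                (HomLL.tripleElement μ' ρ' T')) := by
  have hL := HomLL.derivedOp_isListLInfinity α β
  refine ⟨fun k x => HomLL.derivedOp α β (List.ofFn (n := k) x),
    HomLL.derivedOp_isHigherDerivedBracket α β,
    fun l' h' k hk => h'.unique (HomLL.derivedOp_isHigherDerivedBracket α β) k hk,
    hL.isLInfinity,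
    fun θ _ => ⟨HomLL.mcSeriesFinite_derivedOp θ, HomLL.twistSeriesFinite_derivedOp θ⟩,
    HomLL.tripleElement_mem, fun θ hθ => HomLL.existsUnique_tripleElement hθ,
    fun μ ρ T => (HomLL.isHomLieLeibnizTriple_iff μ ρ T).trans
      (HomLL.isMaurerCartan_iff μ ρ T).symm, fun μ ρ T hT => ?_⟩
  have h0 := (HomLL.isHomLieLeibnizTriple_iff μ ρ T).1 hT
  have hfin : ∀ θ' : HomLL.TripleSpace α β, HomLL.MCSeriesFinite
      (fun k x => HomLL.listTwist 𝕜 (HomLL.derivedOp α β) (HomLL.tripleElement μ ρ T)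
        (List.ofFn (n := k) x)) θ' := fun θ' => by
    refine (HomLL.listTwist_derivedOp_finite (HomLL.tripleElement μ ρ T) θ').subset
      fun k hk => ?_
    have := hk.2
    beta_reduce at this
    rwa [List.ofFn_const] at this
  rw [HomLL.twist_eq_listTwist]
  refine ⟨(hL.listTwist (HomLL.tripleElement_mem μ ρ T) (HomLL.derivedOp_finite _)
    ?_).isLInfinity, fun θ' _ => hfin θ', fun μ' ρ' T' => ?_⟩
  -- The curvature of the twist is the Maurer–Cartan series of θ, which vanishes because θ comes
  -- from a triple.
  · rw [HomLL.listTwist_nil, h0]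
    exact fun n h2 h3 => HomLL.derivedOp_tripleElement
      (fun x hx => ⟨μ, ρ, T, List.eq_of_mem_replicate hx⟩) (by simpa) (by simpa)
  -- The perturbed triple corresponds to θ + θ'. As the cubic vanishes at θ, its value at θ + θ' is
  -- the twisted Maurer–Cartan series at θ'.
  · have h1 := HomLL.isHomLieLeibnizTriple_iff (μ + μ') (ρ + ρ') (T + T')
    rw [HomLL.tripleElement_add] at h1
    have h2 := hL.finsum_listTwist (HomLL.tripleElement_mem μ ρ T)
      (HomLL.tripleElement_mem μ' ρ' T') fun l hl => HomLL.derivedOp_tripleElement fun x hx => by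
        rcases hl x hx with h | h
        · exact ⟨μ, ρ, T, h⟩
        · exact ⟨μ', ρ', T', h⟩
    rw [h0, sub_zero] at h2
    rw [← h2] at h1
    refine h1.trans ⟨fun h => ⟨HomLL.tripleElement_mem μ' ρ' T', hfin _, ?_⟩, fun h => ?_⟩
    · simpa only [List.ofFn_const] using h
    · simpa only [List.ofFn_const] using h.sum_eq_zero
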